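/- Conventions. All links are smooth, oriented, and have finitely many components. Identify $\mathbb C^2=\mathbb R^4$ and let $S^3\subset\mathbb C^2$ be the unit sphere, oriented as the boundary of the unit ball. An algebraic curve in $\mathbb C^2$ is the zero set of a non-constant polynomial in $\mathbb C[z,w]$ (it may be reducible or singular). A smooth ball $B\subset\mathbb C^2$ is the image of the closed unit ball under an orientation-preserving smooth embedding $\Phi$ of a neighbourhood of it. An oriented link $L\subset S^3$ is called a $\mathbb C$-boundary if there are an algebraic curve $A\subset\mathbb C^2$ and a smooth ball $B=\Phi(\text{closed unit ball})$ such that $A$ is transverse to $\partial B$ (in particular, smooth at the points of $A\cap\partial B$) and $\Phi|_{S^3}:S^3\to\partial B$ maps $L$ onto $A\cap\partial B$ with its orientation as the boundary of $A\cap B$. It is called a strong $\mathbb C$-boundary if $A$ and $B$ can be chosen such that, moreover, $A\setminus B$ is connected. **Lemma 3.8.** Let $L$ be a $\mathbb C$-boundary which is not a strong $\mathbb C$-boundary. Then the set of components of $L$ is a disjoint union of two non-empty subsets forming links $L_0$ and $L_1$ whose linking number is zero: $\operatorname{lk}(L_0,L_1)=\sum_{K\subset L_0,\ K'\subset L_1}\operatorname{lk}(K,K')=0$,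 where the sum is over the components $K$ of $L_0$ and $K'$ of $L_1$. In other words, some non-empty proper sublink of $L$ has zero linking number with its complement. -/

import Mathlib

open Set
open scoped ContDiff

/-- The affine complex plane `ℂ²` with its Hermitian norm; as a real vector space it is `ℝ⁴`. -/
abbrev C2 : Type := EuclideanSpace ℂ (Fin 2)

/-- The unit sphere `S³ ⊂ ℂ²`. -/
def S3 : Set C2 := Metric.sphere 0 1

/-- The real scalar product on `ℂ² = ℝ⁴`. -/
noncomputable def realInner (x y : C2) : ℝ := (inner ℂ x y).re

/-- The determinant of four vectors of `ℂ² = ℝ⁴` in the real coordinates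
`(Re z₀, Im z₀, Re z₁, Im z₁)`. A basis is positive for the complex orientation of `ℂ²` if and only
if this is positive. -/
noncomputable def det4 (a b c d : C2) : ℝ :=
  Matrix.det (Matrix.of fun i : Fin 4 =>
    let v : C2 := ![a, b, c, d] i
    ![(v 0).re, (v 0).im, (v 1).re, (v 1).im])

/-- A smooth oriented link in `S³` with its components indexed by `ι` (a finite type in all uses).
Every component is an embedded circle, given by a `1`-periodic regular parametrization
compatible with the orientation; the components are pairwise disjoint. -/
structure OrientedLink (ι : Type*) where
  /-- the parametrizations of the components -/
  γ : ι → ℝ → C2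
  smooth : ∀ i, ContDiff ℝ ∞ (γ i)
  periodic : ∀ i, Function.Periodic (γ i) 1
  mem_S3 : ∀ i t, γ i t ∈ S3
  regular : ∀ i t, deriv (γ i) t ≠ 0
  embedded : ∀ i j, ∀ s ∈ Ico (0 : ℝ) 1, ∀ t ∈ Ico (0 : ℝ) 1, γ i s = γ j t → i = j ∧ s = t

/-- A `4`-ball smoothly embedded in `ℂ²`, as the image of the closed unit ball under an orientation
preserving smooth embedding `Φ` of a neighbourhood of it. (An embedding that reverses the
orientation can be precomposed with a reflection.) -/
structure SmoothBall where
  /-- the embedding -/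
  Φ : C2 → C2
  smooth : ∃ U : Set C2, IsOpen U ∧ Metric.closedBall 0 1 ⊆ U ∧ ContDiffOn ℝ ∞ Φ U
  injOn : InjOn Φ (Metric.closedBall 0 1)
  det_pos : ∀ x ∈ Metric.closedBall (0 : C2) 1, 0 < (fderiv ℝ Φ x).det

/-- The closed ball `B` itself. -/
def SmoothBall.carrier (B : SmoothBall) : Set C2 := B.Φ '' Metric.closedBall 0 1

/-- The boundary sphere `∂B`. -/
def SmoothBall.boundary (B : SmoothBall) : Set C2 := B.Φ '' S3

/-- The set of zeros in `ℂ²` of a polynomial in two variables; it is an algebraic curve when the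
polynomial is not constant. -/
def zeroSet (f : MvPolynomial (Fin 2) ℂ) : Set C2 := {p | MvPolynomial.eval p.ofLp f = 0}

/-- The complex differential `df_p(w) = ∑ᵢ ∂ᵢf(p) wᵢ`. -/
noncomputable def polyDiff (f : MvPolynomial (Fin 2) ℂ) (p w : C2) : ℂ :=
  ∑ i, MvPolynomial.eval p.ofLp (MvPolynomial.pderiv i f) * w i

/-- The curve `A = {f = 0}` is transverse to `∂B`: at every point `p = Φ(x)` of `A ∩ ∂B`, `A` is
smooth (`df_p ≠ 0`), and its tangent line `ker df_p` is not contained in the tangent space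
`dΦ_x(x^⊥)` of `∂B`. -/
def IsTransverse (f : MvPolynomial (Fin 2) ℂ) (B : SmoothBall) : Prop :=
  ∀ x ∈ S3, B.Φ x ∈ zeroSet f →
    (∃ w, polyDiff f (B.Φ x) w ≠ 0) ∧
    ∃ u, polyDiff f (B.Φ x) (fderiv ℝ B.Φ x u) = 0 ∧ realInner x u ≠ 0

/-- `L` is cut on `∂B` by the algebraic curve `A = {f = 0}`: the curve is transverse to `∂B`, the
orientation preserving identification `Φ : S³ → ∂B` maps `L` onto `A ∩ ∂B`, and the orientation of
`L` becomes the boundary orientation from `A ∩ B`. The latter means that (outward vector, positive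
tangent vector `τ` of the link) is a positive basis of the complex tangent line of `A`, that is,
that `-i τ` (with `τ = i (-i τ)`) points out of `B`; and `dΦ_x(u)` points out of `B` when `u`
points out of the unit ball. -/
structure OrientedLink.IsCutBy {ι : Type*} (L : OrientedLink ι)
    (f : MvPolynomial (Fin 2) ℂ) (B : SmoothBall) : Prop where
  nonconstant : 0 < f.totalDegree
  transverse : IsTransverse f B
  image : B.Φ '' (⋃ i, range (L.γ i)) = zeroSet f ∩ B.boundary
  orientation : ∀ i t, ∃ u, 0 < realInner (L.γ i t) u ∧
    fderiv ℝ B.Φ (L.γ i t) u = -(Complex.I • fderiv ℝ B.Φ (L.γ i t) (deriv (L.γ i) t))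

/-- `L` is a `ℂ`-boundary: it is realizable as `A ∩ ∂B` with an algebraic curve `A ⊂ ℂ²` and a
smooth `4`-ball `B`. -/
def OrientedLink.IsCBoundary {ι : Type*} (L : OrientedLink ι) : Prop :=
  ∃ (f : MvPolynomial (Fin 2) ℂ) (B : SmoothBall), L.IsCutBy f B

/-- `L` is a strong `ℂ`-boundary: it is realizable as `A ∩ ∂B` with, moreover, `A \ B` connected. -/
def OrientedLink.IsStrongCBoundary {ι : Type*} (L : OrientedLink ι) : Prop :=
  ∃ (f : MvPolynomial (Fin 2) ℂ) (B : SmoothBall),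
    L.IsCutBy f B ∧ IsConnected (zeroSet f \ B.carrier)

/-- The sublink formed by the components with index in `S`. -/
def OrientedLink.sublink {ι : Type*} (L : OrientedLink ι) (S : Finset ι) : OrientedLink S where
  γ i := L.γ i
  smooth i := L.smooth i
  periodic i := L.periodic i
  mem_S3 i := L.mem_S3 i
  regular i := L.regular i
  embedded i j s hs t ht h :=
    ⟨Subtype.ext (L.embedded i j s hs t ht h).1, (L.embedded i j s hs t ht h).2⟩

/-- The loop `c : [0, 1] → ℂ \ {0}` has winding number `n` around `0`. -/
def HasWindingNumber (c : ℝ → ℂ) (n : ℤ) : Prop :=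
  ∃ l : ℝ → ℂ, Continuous l ∧ (∀ t, c t = Complex.exp (l t)) ∧
    l 1 - l 0 = 2 * Real.pi * Complex.I * n

/-- `g : S³ → ℂ` is a defining function of the oriented link `J`: it is smooth, its zero set
in `S³` is `J`, the value `0` is regular, and the orientation of `J` is that of the preimage of `0`:
if the tangent vectors `e₁, e₂` of `S³` are mapped to `1, i`, then (positive tangent vector of `J`,
`e₁`, `e₂`) is a positive basis of the tangent space of `S³`, where `S³` is oriented as the boundary
of the unit ball (outward normal vector first). So `g` makes one positive turn along each positive
meridian of `J`, and for almost all unit numbers `u` the set `g⁻¹(ℝ_{>0} u) ∪ J` is a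
Seifert surface of `J`. -/
structure OrientedLink.IsDefiningFunction {ι : Type*} (J : OrientedLink ι) (g : C2 → ℂ) : Prop where
  smooth : ∃ U : Set C2, IsOpen U ∧ S3 ⊆ U ∧ ContDiffOn ℝ ∞ g U
  zeros : ∀ x ∈ S3, g x = 0 ↔ ∃ i t, J.γ i t = x
  regular : ∀ i t, ∀ z : ℂ, ∃ e, realInner (J.γ i t) e = 0 ∧ fderiv ℝ g (J.γ i t) e = z
  orientation : ∀ i t e₁ e₂, realInner (J.γ i t) e₁ = 0 → realInner (J.γ i t) e₂ = 0 →
    fderiv ℝ g (J.γ i t) e₁ = 1 → fderiv ℝ g (J.γ i t) e₂ = Complex.I →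
    0 < det4 (J.γ i t) (deriv (J.γ i) t) e₁ e₂

/-- The (total) linking number in `S³` of the disjoint oriented links `J` and `K` is `n`.
The homomorphism `H₁(S³ \ J) → ℤ` that maps all positive meridians of `J` to `1` sends the
class of a loop `c` to the winding number of `g ∘ c`, for any defining function `g` of `J`; so the
linking number is the sum of the winding numbers of `g` along the components of `K`. Equivalently,
it is the intersection number of `K` with the Seifert surface of `J` given by `g`. -/
def OrientedLink.HasLinkingNumber {ι κ : Type*} [Fintype κ] (J : OrientedLink ι)
    (K : OrientedLink κ) (n : ℤ) : Prop :=
  ∃ g : C2 → ℂ, J.IsDefiningFunction g ∧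
    ∃ m : κ → ℤ, (∀ k, HasWindingNumber (fun t => g (K.γ k t)) (m k)) ∧ ∑ k, m k = n

/-!
Let `A = {f = 0}` be a curve that cuts the link `L` on the boundary of the ball `B`. A line `ℓ` far
from `B` may be added to `A` without changing the link. As `L` is not a strong `ℂ`-boundary,
`(A ∪ ℓ) \ B` is disconnected, so an open and closed part of `A \ B` does not meet the component of the
line. For a suitable projection `λ : ℂ² → ℂ` whose restriction to `A` is open and proper, and for a
fibre `ℓ` of `λ`, the image of this part outside of a large disc is open and closed and misses a
point; hence the part is bounded (`norm_parallelForm_le_of_notMem_image`). So the complement of the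
interior of `B` in `A` is a disjoint union of a compact set `K₀` and a closed set `K₁`. Both
contain components of the link, since `A` has no compact relatively open subset
(`OrientedLink.IsCutBy.exists_decomposition`). The components in `K₀` form the sublink `L₀`, and
those in `K₁` form `L₁`.

The linking number is computed from a function `F` on `ℂ²` with `F = f` up to a nonvanishing factor
along `K₀` and without other zeros outside of the interior of `B`; moreover `F = 1` far away
(`SmoothBall.IsBoundaryDefining.exists_contDiff_vanishing_on`). In other words, the surface `K₀` is
the divisor of a section of a line bundle on the complement of the interior of `B`, and this bundle
is trivialized by transport from infinity along rays (`exists_contDiff_apply_ne_zero`). The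
function `F` restricts to a defining function of `L₀` on `∂B`, and the sum of its winding numbers
along `L₁` is the integral of `d log F / 2πi` over the boundary of the surface `K₁`. As `F` has no
zeros on `K₁` and is constant far away, this integral is zero.

The last step is Stokes' theorem on the surface `{f = 0, R ≥ 0}`, where `R` defines the boundary of
the ball. The surface is singular in general, and the theorem is derived from integration by parts
in `ℝ⁴` (`integral_det_pderivAt_eq_zero`): integrals over the surface and its boundary are replaced
by integrals against bump forms `ε⁻³ B((R, f) / ε)`, and the limit over shrinking tubes around the
boundary curves, which are regular, is computed in tube coordinates (`tendsto_integral_comp_smul`).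
Close to the surface the form `d log F` times a cutoff function is closed, so the singularities do
not matter (`sum_integral_logDeriv_eq_zero`).
-/

open Filter Topology MeasureTheory

/-! ### Stokes' theorem for compactly supported forms on `ℝ⁴` -/

/-- The `i`-th partial derivative at `x` of a function on `ℝⁿ`. -/
noncomputable def pderivAt {n : ℕ} {E : Type*} [NormedAddCommGroup E] [NormedSpace ℝ E]
    (g : (Fin n → ℝ) → E) (x : Fin n → ℝ) (i : Fin n) : E :=
  fderiv ℝ g x (Pi.single i 1)

theorem contDiff_pderivAt {n : ℕ} {E : Type*} [NormedAddCommGroup E] [NormedSpace ℝ E]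
    {g : (Fin n → ℝ) → E} (hg : ContDiff ℝ ∞ g) (i : Fin n) :
    ContDiff ℝ ∞ fun x => pderivAt g x i :=
  (hg.fderiv_right (m := ∞) (by simp)).clm_apply contDiff_const

theorem pderivAt_pderivAt_comm {n : ℕ} {E : Type*} [NormedAddCommGroup E] [NormedSpace ℝ E]
    {g : (Fin n → ℝ) → E} (hg : ContDiff ℝ ∞ g) (x : Fin n → ℝ) (i j : Fin n) :
    pderivAt (fun y => pderivAt g y i) x j = pderivAt (fun y => pderivAt g y j) x i := by
  have h : IsSymmSndFDerivAt ℝ g x :=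
    hg.contDiffAt.isSymmSndFDerivAt (by
      simp only [minSmoothness_of_isRCLikeNormedField]
      exact WithTop.coe_le_coe.2 (le_top : (2 : ℕ∞) ≤ ⊤))
  have hd : DifferentiableAt ℝ (fderiv ℝ g) x :=
    ((hg.fderiv_right (m := ∞) (by simp)).differentiable (by simp)) x
  have key : ∀ v w, fderiv ℝ (fun y => fderiv ℝ g y v) x w = fderiv ℝ (fderiv ℝ g) x w v := by
    intro v w
    rw [fderiv_clm_apply hd (differentiableAt_const _)]
    simp
  unfold pderivAt
  rw [key, key]
  exact h _ _

theorem pderivAt_mul {n : ℕ} {a b : (Fin n → ℝ) → ℂ} (ha : ContDiff ℝ ∞ a)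
    (hb : ContDiff ℝ ∞ b) (x : Fin n → ℝ) (i : Fin n) :
    pderivAt (fun y => a y * b y) x i = a x * pderivAt b x i + pderivAt a x i * b x := by
  unfold pderivAt
  rw [fderiv_fun_mul (ha.differentiable (by simp) x) (hb.differentiable (by simp) x)]
  simp [mul_comm]

/-- An alternating sum over permutations vanishes when its terms are invariant under a transposition
of two positions. -/
theorem sum_sign_smul_eq_zero_of_mul_swap {n : ℕ} {φ : Equiv.Perm (Fin n) → ℂ} {i j : Fin n}
    (hij : i ≠ j) (h : ∀ σ, φ (σ * Equiv.swap i j) = φ σ) :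
    ∑ σ : Equiv.Perm (Fin n), ((Equiv.Perm.sign σ : ℤ) : ℂ) * φ σ = 0 := by
  have := Equiv.sum_comp (Equiv.mulRight (Equiv.swap i j))
    (fun σ : Equiv.Perm (Fin n) => ((Equiv.Perm.sign σ : ℤ) : ℂ) * φ σ)
  simp only [Equiv.coe_mulRight, Equiv.Perm.sign_mul, h, Equiv.Perm.sign_swap hij] at this
  simp only [mul_neg, mul_one, Units.val_neg, Int.cast_neg, neg_mul, Finset.sum_neg_distrib] at this
  exact self_eq_neg.1 this.symm

/-- Stokes' theorem for the exact `4`-form `d (u dg₁ ∧ dg₂ ∧ dg₃)` with compact support: integration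
by parts moves the derivative of `u` to the other factors, and the second derivatives that arise
are symmetric, so that they cancel in the determinant. -/
theorem integral_det_pderivAt_eq_zero {u g₁ g₂ g₃ : (Fin 4 → ℝ) → ℂ} (hu : ContDiff ℝ ∞ u)
    (hs : HasCompactSupport u) (h₁ : ContDiff ℝ ∞ g₁) (h₂ : ContDiff ℝ ∞ g₂)
    (h₃ : ContDiff ℝ ∞ g₃) :
    ∫ x, Matrix.det (Matrix.of ![pderivAt u x, pderivAt g₁ x, pderivAt g₂ x, pderivAt g₃ x])
      = 0 := by
  have hsd : ∀ i, HasCompactSupport fun x => pderivAt u x i := fun i =>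
    (hs.fderiv (𝕜 := ℝ)).comp_left (g := fun L : (Fin 4 → ℝ) →L[ℝ] ℂ => L (Pi.single i 1)) (by simp)
  have hc : ∀ σ : Equiv.Perm (Fin 4), ContDiff ℝ ∞ fun x =>
      pderivAt g₁ x (σ 1) * (pderivAt g₂ x (σ 2) * pderivAt g₃ x (σ 3)) := fun σ =>
    (contDiff_pderivAt h₁ _).mul ((contDiff_pderivAt h₂ _).mul (contDiff_pderivAt h₃ _))
  have hdet : ∀ x, Matrix.det (Matrix.of ![pderivAt u x, pderivAt g₁ x, pderivAt g₂ x,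
      pderivAt g₃ x]) = ∑ σ : Equiv.Perm (Fin 4), ((Equiv.Perm.sign σ : ℤ) : ℂ) *
        (pderivAt u x (σ 0) *
          (pderivAt g₁ x (σ 1) * (pderivAt g₂ x (σ 2) * pderivAt g₃ x (σ 3)))) := by
    intro x
    rw [← Matrix.det_transpose, Matrix.det_apply']
    simp [Fin.prod_univ_four, mul_assoc]
  have hint1 : ∀ σ : Equiv.Perm (Fin 4), Integrable fun x => pderivAt u x (σ 0) *
          (pderivAt g₁ x (σ 1) * (pderivAt g₂ x (σ 2) * pderivAt g₃ x (σ 3))) := fun σ =>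
    ((contDiff_pderivAt hu _).mul (hc σ)).continuous.integrable_of_hasCompactSupport
      (hsd _).mul_right
  have hint2 : ∀ σ : Equiv.Perm (Fin 4), Integrable fun x => u x * pderivAt (fun y =>
      pderivAt g₁ y (σ 1) * (pderivAt g₂ y (σ 2) * pderivAt g₃ y (σ 3))) x (σ 0) := fun σ =>
    (hu.mul (contDiff_pderivAt (hc σ) _)).continuous.integrable_of_hasCompactSupport hs.mul_right
  have hparts : ∀ σ : Equiv.Perm (Fin 4), ∫ x, pderivAt u x (σ 0) *
          (pderivAt g₁ x (σ 1) * (pderivAt g₂ x (σ 2) * pderivAt g₃ x (σ 3))) =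
        - ∫ x, u x * pderivAt (fun y =>
      pderivAt g₁ y (σ 1) * (pderivAt g₂ y (σ 2) * pderivAt g₃ y (σ 3))) x (σ 0) := by
    intro σ
    rw [eq_neg_iff_add_eq_zero, add_comm, ← eq_neg_iff_add_eq_zero]
    exact integral_mul_fderiv_eq_neg_fderiv_mul_of_integrable (v := Pi.single (σ 0) 1) (hint1 σ)
      (hint2 σ) ((hu.mul (hc σ)).continuous.integrable_of_hasCompactSupport hs.mul_right)
      (fun x _ => hu.differentiable (by simp) x) (fun x _ => (hc σ).differentiable (by simp) x)
  simp_rw [hdet]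
  rw [integral_finsetSum _ fun σ _ => (hint1 σ).const_mul _]
  have : ∀ σ : Equiv.Perm (Fin 4), ∫ x, ((Equiv.Perm.sign σ : ℤ) : ℂ) * (pderivAt u x (σ 0) *
          (pderivAt g₁ x (σ 1) * (pderivAt g₂ x (σ 2) * pderivAt g₃ x (σ 3)))) =
        - ∫ x, ((Equiv.Perm.sign σ : ℤ) : ℂ) * (u x * pderivAt (fun y =>
      pderivAt g₁ y (σ 1) * (pderivAt g₂ y (σ 2) * pderivAt g₃ y (σ 3))) x (σ 0)) := by
    intro σ
    simp only [integral_const_mul, hparts σ, mul_neg]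
  rw [Finset.sum_congr rfl fun σ _ => this σ, Finset.sum_neg_distrib, neg_eq_zero,
    ← integral_finsetSum _ fun σ _ => (hint2 σ).const_mul _]
  refine integral_eq_zero_of_ae (Eventually.of_forall fun x => ?_)
  have hexp : ∀ σ : Equiv.Perm (Fin 4), ((Equiv.Perm.sign σ : ℤ) : ℂ) * (u x * pderivAt (fun y =>
      pderivAt g₁ y (σ 1) * (pderivAt g₂ y (σ 2) * pderivAt g₃ y (σ 3))) x (σ 0)) =
      ((Equiv.Perm.sign σ : ℤ) : ℂ) * (u x * pderivAt (fun y => pderivAt g₁ y (σ 1)) x (σ 0) *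
        pderivAt g₂ x (σ 2) * pderivAt g₃ x (σ 3)) +
      ((Equiv.Perm.sign σ : ℤ) : ℂ) * (u x * pderivAt (fun y => pderivAt g₂ y (σ 2)) x (σ 0) *
        pderivAt g₁ x (σ 1) * pderivAt g₃ x (σ 3)) +
      ((Equiv.Perm.sign σ : ℤ) : ℂ) * (u x * pderivAt (fun y => pderivAt g₃ y (σ 3)) x (σ 0) *
        pderivAt g₁ x (σ 1) * pderivAt g₂ x (σ 2)) := by
    intro σ
    rw [pderivAt_mul (contDiff_pderivAt h₁ _)
      ((contDiff_pderivAt h₂ _).mul (contDiff_pderivAt h₃ _)),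
      pderivAt_mul (contDiff_pderivAt h₂ _) (contDiff_pderivAt h₃ _), ← mul_add, ← mul_add]
    congr 1
    ring
  simp only [hexp, Finset.sum_add_distrib, Pi.zero_apply]
  rw [sum_sign_smul_eq_zero_of_mul_swap (i := 0) (j := 1) (by decide),
    sum_sign_smul_eq_zero_of_mul_swap (i := 0) (j := 2) (by decide),
    sum_sign_smul_eq_zero_of_mul_swap (i := 0) (j := 3) (by decide)]
  · simp
  · intro σ
    have e1 : Equiv.swap (0 : Fin 4) 3 1 = 1 := by decide
    have e2 : Equiv.swap (0 : Fin 4) 3 2 = 2 := by decide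
    simp [e1, e2, pderivAt_pderivAt_comm h₃ x (σ 0) (σ 3)]
  · intro σ
    have e1 : Equiv.swap (0 : Fin 4) 2 1 = 1 := by decide
    have e2 : Equiv.swap (0 : Fin 4) 2 3 = 3 := by decide
    simp [e1, e2, pderivAt_pderivAt_comm h₂ x (σ 0) (σ 2)]
  · intro σ
    have e1 : Equiv.swap (0 : Fin 4) 1 2 = 2 := by decide
    have e2 : Equiv.swap (0 : Fin 4) 1 3 = 3 := by decide
    simp [e1, e2, pderivAt_pderivAt_comm h₁ x (σ 0) (σ 1)]

/-! ### Tubes around closed curves -/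

/-- The first three coordinates of a vector of `ℝ⁴`. -/
noncomputable def initL : (Fin 4 → ℝ) →L[ℝ] (Fin 3 → ℝ) :=
  ContinuousLinearMap.pi fun i => ContinuousLinearMap.proj i.castSucc

@[simp] theorem initL_apply (s : Fin 4 → ℝ) (i : Fin 3) : initL s i = s i.castSucc := rfl

/-- The tube map of a curve `c` in `ℝ⁴` with three vector fields `n` along it. The last coordinate
is the parameter of the curve, the first three are the coordinates normal to it. -/
noncomputable def tubeMap (c : ℝ → Fin 4 → ℝ) (n : Fin 3 → ℝ → Fin 4 → ℝ) (s : Fin 4 → ℝ) :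
    Fin 4 → ℝ :=
  c (s 3) + ∑ i : Fin 3, s i.castSucc • n i (s 3)

theorem contDiff_tubeMap {c : ℝ → Fin 4 → ℝ} {n : Fin 3 → ℝ → Fin 4 → ℝ} (hc : ContDiff ℝ ∞ c)
    (hn : ∀ i, ContDiff ℝ ∞ (n i)) : ContDiff ℝ ∞ (tubeMap c n) := by
  have h3 : ContDiff ℝ ∞ fun s : Fin 4 → ℝ => s 3 := contDiff_apply ℝ ℝ 3
  refine (hc.comp h3).add (ContDiff.sum fun i _ => ?_)
  exact (contDiff_apply ℝ ℝ i.castSucc).smul ((hn i).comp h3)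

theorem tubeMap_of_initL_eq_zero {c : ℝ → Fin 4 → ℝ} {n : Fin 3 → ℝ → Fin 4 → ℝ} {s : Fin 4 → ℝ}
    (hs : initL s = 0) : tubeMap c n s = c (s 3) := by
  have : ∀ i : Fin 3, s i.castSucc = 0 := fun i => congrFun hs i
  simp [tubeMap, this]

theorem fderiv_tubeMap {c : ℝ → Fin 4 → ℝ} {n : Fin 3 → ℝ → Fin 4 → ℝ} (hc : ContDiff ℝ ∞ c)
    (hn : ∀ i, ContDiff ℝ ∞ (n i)) {s : Fin 4 → ℝ} (hs : initL s = 0) (v : Fin 4 → ℝ) :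
    fderiv ℝ (tubeMap c n) s v
      = v 3 • deriv c (s 3) + ∑ i : Fin 3, v i.castSucc • n i (s 3) := by
  have hs' : ∀ i : Fin 3, s i.castSucc = 0 := fun i => congrFun hs i
  have hp : ∀ k : Fin 4, HasFDerivAt (fun s : Fin 4 → ℝ => s k)
      (ContinuousLinearMap.proj (R := ℝ) (φ := fun _ : Fin 4 => ℝ) k) s := fun k =>
    (ContinuousLinearMap.proj (R := ℝ) (φ := fun _ : Fin 4 => ℝ) k).hasFDerivAt
  have h1 : HasFDerivAt (fun s : Fin 4 → ℝ => c (s 3)) _ s :=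
    ((hc.differentiable (by simp) (s 3)).hasDerivAt.hasFDerivAt).comp s (hp 3)
  have h2 : ∀ i : Fin 3, HasFDerivAt (fun s : Fin 4 → ℝ => n i (s 3)) _ s := fun i =>
    (((hn i).differentiable (by simp) (s 3)).hasDerivAt.hasFDerivAt).comp s (hp 3)
  have h3 := h1.add (HasFDerivAt.fun_sum (u := Finset.univ)
    fun (i : Fin 3) _ => (hp i.castSucc).smul (h2 i))
  have h4 : HasFDerivAt (tubeMap c n) _ s := h3
  rw [h4.fderiv]
  simp [hs']

/-- Normal vector fields `n` along a closed curve `c` in `ℝ⁴` which is a component of the zero set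
of `Ψ : ℝ⁴ → ℝ³`; they are normalized to be dual to the differential of `Ψ`. -/
structure IsNormalFrame (Ψ : (Fin 4 → ℝ) → Fin 3 → ℝ) (c : ℝ → Fin 4 → ℝ)
    (n : Fin 3 → ℝ → Fin 4 → ℝ) : Prop where
  smooth_curve : ContDiff ℝ ∞ c
  periodic_curve : Function.Periodic c 1
  regular_curve : ∀ t, deriv c t ≠ 0
  zero_curve : ∀ t, Ψ (c t) = 0
  smooth_frame : ∀ i, ContDiff ℝ ∞ (n i)
  periodic_frame : ∀ i, Function.Periodic (n i) 1
  dual : ∀ i t, fderiv ℝ Ψ (c t) (n i t) = Pi.single i 1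

namespace IsNormalFrame

variable {Ψ : (Fin 4 → ℝ) → Fin 3 → ℝ} {c : ℝ → Fin 4 → ℝ} {n : Fin 3 → ℝ → Fin 4 → ℝ}

theorem fderiv_deriv_eq_zero (h : IsNormalFrame Ψ c n) (hΨ : ContDiff ℝ ∞ Ψ) (t : ℝ) :
    fderiv ℝ Ψ (c t) (deriv c t) = 0 := by
  have h1 : HasDerivAt (Ψ ∘ c) (fderiv ℝ Ψ (c t) (deriv c t)) t :=
    ((hΨ.differentiable (by simp) (c t)).hasFDerivAt).comp_hasDerivAt t
      (h.smooth_curve.differentiable (by simp) t).hasDerivAt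
  have h2 : Ψ ∘ c = fun _ => 0 := funext h.zero_curve
  rw [h2] at h1
  exact h1.unique (hasDerivAt_const t 0)

/-- In the coordinates of the tube, the differential of `Ψ` along the curve is the projection to the
normal coordinates. -/
theorem fderiv_comp_tubeMap (h : IsNormalFrame Ψ c n) (hΨ : ContDiff ℝ ∞ Ψ) {s : Fin 4 → ℝ}
    (hs : initL s = 0) (v : Fin 4 → ℝ) :
    fderiv ℝ Ψ (c (s 3)) (fderiv ℝ (tubeMap c n) s v) = initL v := by
  rw [fderiv_tubeMap h.smooth_curve h.smooth_frame hs]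
  simp only [map_add, map_smul, map_sum, h.fderiv_deriv_eq_zero hΨ, h.dual]
  ext i
  simp [Finset.sum_apply, Pi.single_apply]

theorem hasStrictFDerivAt_comp_tubeMap (h : IsNormalFrame Ψ c n) (hΨ : ContDiff ℝ ∞ Ψ)
    {s : Fin 4 → ℝ} (hs : initL s = 0) :
    HasStrictFDerivAt (fun s => Ψ (tubeMap c n s)) initL s := by
  have h1 : HasStrictFDerivAt (tubeMap c n) _ s :=
    ((contDiff_tubeMap h.smooth_curve h.smooth_frame).contDiffAt).hasStrictFDerivAt (by simp)
  have h2 : HasStrictFDerivAt Ψ _ (tubeMap c n s) := hΨ.contDiffAt.hasStrictFDerivAt (by simp)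
  have h3 := h2.comp s h1
  have e : initL = (fderiv ℝ Ψ (tubeMap c n s)).comp (fderiv ℝ (tubeMap c n) s) := by
    ext1 v
    rw [tubeMap_of_initL_eq_zero hs]
    exact (h.fderiv_comp_tubeMap hΨ hs v).symm
  rw [e]
  exact h3

theorem exists_hasStrictFDerivAt_equiv (h : IsNormalFrame Ψ c n) (hΨ : ContDiff ℝ ∞ Ψ)
    {s : Fin 4 → ℝ} (hs : initL s = 0) :
    ∃ L : (Fin 4 → ℝ) ≃L[ℝ] (Fin 4 → ℝ),
      HasStrictFDerivAt (tubeMap c n) (L : (Fin 4 → ℝ) →L[ℝ] (Fin 4 → ℝ)) s := by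
  have h1 : HasStrictFDerivAt (tubeMap c n) _ s :=
    ((contDiff_tubeMap h.smooth_curve h.smooth_frame).contDiffAt).hasStrictFDerivAt (by simp)
  have hinj : Function.Injective (fderiv ℝ (tubeMap c n) s).toLinearMap := by
    rw [← LinearMap.ker_eq_bot, LinearMap.ker_eq_bot']
    intro v hv
    have hv' : fderiv ℝ (tubeMap c n) s v = 0 := hv
    have h0 : initL v = 0 := by
      rw [← h.fderiv_comp_tubeMap hΨ hs v, hv', map_zero]
    have h0' : ∀ i : Fin 3, v i.castSucc = 0 := fun i => congrFun h0 i
    rw [fderiv_tubeMap h.smooth_curve h.smooth_frame hs] at hv'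
    simp only [h0', zero_smul, Finset.sum_const_zero, add_zero, smul_eq_zero,
      h.regular_curve, or_false] at hv'
    funext i
    refine Fin.lastCases hv' (fun i => h0' i) i
  exact ⟨(LinearEquiv.ofInjectiveEndo _ hinj).toContinuousLinearEquiv, h1⟩

/-- The tube map is periodic in the parameter of the curve. -/
theorem tubeMap_add_int (h : IsNormalFrame Ψ c n) (s : Fin 4 → ℝ) (m : ℤ) :
    tubeMap c n (s + Pi.single 3 (m : ℝ)) = tubeMap c n s := by
  have hi : ∀ i : Fin 3, i.castSucc ≠ (3 : Fin 4) := fun i => (Fin.castSucc_lt_last i).ne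
  have e1 : c (s 3 + m) = c (s 3) := by simpa using (h.periodic_curve.int_mul m) (s 3)
  have e2 : ∀ i, n i (s 3 + m) = n i (s 3) := fun i => by
    simpa using ((h.periodic_frame i).int_mul m) (s 3)
  simp [tubeMap, hi, e1, e2]

/-- Points near the curve are in the image of the tube map, and their normal coordinates are
controlled by the values of `Ψ`. -/
theorem eventually_exists_tubeMap (h : IsNormalFrame Ψ c n) (hΨ : ContDiff ℝ ∞ Ψ) (t : ℝ) :
    ∀ᶠ y in 𝓝 (c t), ∃ s, tubeMap c n s = y ∧ s 3 ∈ Ico (0 : ℝ) 1 ∧ ‖initL s‖ ≤ 2 * ‖Ψ y‖ := by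
  set p : Fin 4 → ℝ := Pi.single 3 t with hp
  have hi : ∀ i : Fin 3, i.castSucc ≠ (3 : Fin 4) := fun i => (Fin.castSucc_lt_last i).ne
  have hp0 : initL p = 0 := by ext i; simp [hp, hi]
  obtain ⟨L, hL⟩ := h.exists_hasStrictFDerivAt_equiv hΨ hp0
  have hmap := hL.map_nhds_eq_of_equiv
  have hpc : tubeMap c n p = c t := by rw [tubeMap_of_initL_eq_zero hp0]; simp [hp]
  rw [hpc] at hmap
  rw [← hmap, eventually_map]
  -- with the constant `1 / 2`, strict differentiability bounds the normal coordinates by `2 ‖Ψ‖`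
  have hst := (h.hasStrictFDerivAt_comp_tubeMap hΨ hp0).isLittleO.def (c := 1 / 2) (by norm_num)
  have hcont : Tendsto (fun s : Fin 4 → ℝ => (s, (Pi.single 3 (s 3) : Fin 4 → ℝ))) (𝓝 p)
      (𝓝 (p, p)) := by
    have : Continuous fun s : Fin 4 → ℝ => (s, (Pi.single 3 (s 3) : Fin 4 → ℝ)) :=
      continuous_id.prodMk ((continuous_single 3).comp (continuous_apply 3))
    have h2 := this.tendsto p
    simpa [hp] using h2
  filter_upwards [hcont.eventually hst] with s hs
  have hq0 : initL (Pi.single 3 (s 3) : Fin 4 → ℝ) = 0 := by ext i; simp [hi]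
  have hs0 : Ψ (tubeMap c n (Pi.single 3 (s 3))) = 0 := by
    rw [tubeMap_of_initL_eq_zero hq0]; exact h.zero_curve _
  have hnorm : ‖s - (Pi.single 3 (s 3) : Fin 4 → ℝ)‖ ≤ ‖initL s‖ := by
    refine (pi_norm_le_iff_of_nonneg (norm_nonneg _)).2 fun k => ?_
    refine Fin.lastCases ?_ (fun i => ?_) k
    · have : (Fin.last 3 : Fin 4) = 3 := rfl
      simp [this]
    · simpa [hi] using norm_le_pi_norm (initL s) i
  simp only [hs0, sub_zero, map_sub, hq0] at hs
  have hle : ‖initL s‖ ≤ 2 * ‖Ψ (tubeMap c n s)‖ := by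
    have h1 : ‖initL s‖ ≤ ‖Ψ (tubeMap c n s)‖ + ‖Ψ (tubeMap c n s) - initL s‖ := by
      have := norm_sub_norm_le (initL s) (Ψ (tubeMap c n s))
      rw [norm_sub_rev] at this
      linarith
    linarith
  -- a shift of the parameter by an integer brings it to `[0, 1)`
  refine ⟨s + Pi.single 3 ((-⌊s 3⌋ : ℤ) : ℝ), h.tubeMap_add_int s _, ?_, ?_⟩
  · have : (s + Pi.single 3 ((-⌊s 3⌋ : ℤ) : ℝ) : Fin 4 → ℝ) 3 = Int.fract (s 3) := by
      simp [Int.fract, sub_eq_add_neg]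
    rw [this]
    exact ⟨Int.fract_nonneg _, Int.fract_lt_one _⟩
  · have : initL (s + Pi.single 3 ((-⌊s 3⌋ : ℤ) : ℝ)) = initL s := by ext i; simp [hi]
    rw [this]
    exact hle

end IsNormalFrame

/-- The tube maps of disjoint embedded closed curves are jointly injective near the curves. -/
theorem exists_tubeMap_injective {κ : Type*} [Finite κ] {Ψ : (Fin 4 → ℝ) → Fin 3 → ℝ}
    (hΨ : ContDiff ℝ ∞ Ψ) {c : κ → ℝ → Fin 4 → ℝ} {n : κ → Fin 3 → ℝ → Fin 4 → ℝ}
    (h : ∀ j, IsNormalFrame Ψ (c j) (n j))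
    (hemb : ∀ i j, ∀ s ∈ Ico (0 : ℝ) 1, ∀ t ∈ Ico (0 : ℝ) 1, c i s = c j t → i = j ∧ s = t) :
    ∃ δ > 0, ∀ j k, ∀ s s' : Fin 4 → ℝ, s 3 ∈ Ico (0 : ℝ) 1 → s' 3 ∈ Ico (0 : ℝ) 1 →
      ‖initL s‖ < δ → ‖initL s'‖ < δ → tubeMap (c j) (n j) s = tubeMap (c k) (n k) s' →
      j = k ∧ s = s' := by
  have hi : ∀ i : Fin 3, i.castSucc ≠ (3 : Fin 4) := fun i => (Fin.castSucc_lt_last i).ne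
  set P : κ → κ → ((Fin 3 → ℝ) × (Fin 3 → ℝ)) → ℝ × ℝ → Prop := fun j k a t =>
    t.1 ∈ Ico (0 : ℝ) 1 → t.2 ∈ Ico (0 : ℝ) 1 →
      tubeMap (c j) (n j) (Fin.snoc a.1 t.1) = tubeMap (c k) (n k) (Fin.snoc a.2 t.2) →
      j = k ∧ a.1 = a.2 ∧ t.1 = t.2 with hP
  have hsnoc : Continuous fun q : (Fin 3 → ℝ) × ℝ => (Fin.snoc q.1 q.2 : Fin 4 → ℝ) := by
    refine continuous_pi fun k => ?_
    refine Fin.lastCases ?_ (fun i => ?_) k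
    · simpa only [Fin.snoc_last] using continuous_snd
    · simp only [Fin.snoc_castSucc]
      exact (continuous_apply i).comp continuous_fst
  have hinit : ∀ (a : Fin 3 → ℝ) (t : ℝ), initL (Fin.snoc a t) = a := fun a t => by
    ext i; simp
  have hlast : ∀ (a : Fin 3 → ℝ) (t : ℝ), (Fin.snoc a t : Fin 4 → ℝ) 3 = t := fun a t =>
    Fin.snoc_last (α := fun _ => ℝ) t a
  have hcont : ∀ j, Continuous (tubeMap (c j) (n j)) := fun j =>
    (contDiff_tubeMap (h j).smooth_curve (h j).smooth_frame).continuous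
  -- by compactness it is enough to look near each pair of parameters
  have key : ∀ j k, ∀ᶠ a in 𝓝 ((0, 0) : (Fin 3 → ℝ) × (Fin 3 → ℝ)),
      ∀ t ∈ Icc (0 : ℝ) 1 ×ˢ Icc (0 : ℝ) 1, P j k a t := by
    intro j k
    refine (isCompact_Icc.prod isCompact_Icc).eventually_forall_of_forall_eventually ?_
    rintro ⟨t, t'⟩ -
    have hc1 : Continuous fun z : ((Fin 3 → ℝ) × (Fin 3 → ℝ)) × ℝ × ℝ =>
        (Fin.snoc z.1.1 z.2.1 : Fin 4 → ℝ) :=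
      hsnoc.comp (continuous_fst.fst.prodMk continuous_snd.fst)
    have hc2 : Continuous fun z : ((Fin 3 → ℝ) × (Fin 3 → ℝ)) × ℝ × ℝ =>
        (Fin.snoc z.1.2 z.2.2 : Fin 4 → ℝ) :=
      hsnoc.comp (continuous_fst.snd.prodMk continuous_snd.snd)
    by_cases hne : c j t = c k t'
    · have hfr : ∀ (i : κ) (x : ℝ), c i x = c i (Int.fract x) := fun i x => by
        have := ((h i).periodic_curve.int_mul ⌊x⌋) (Int.fract x)
        rw [mul_one, Int.fract_add_floor] at this
        exact this
      have he := hemb j k (Int.fract t) ⟨Int.fract_nonneg _, Int.fract_lt_one _⟩ (Int.fract t')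
        ⟨Int.fract_nonneg _, Int.fract_lt_one _⟩ (by rw [← hfr, ← hfr, hne])
      obtain ⟨rfl, hft⟩ := he
      -- the parameters of the two points differ by an integer `m`; after a shift by `m` both lie in
      -- a set on which the tube map is injective by the inverse function theorem
      obtain ⟨m, hm⟩ := Int.fract_eq_fract.1 hft
      have hp0 : initL (Fin.snoc 0 t) = 0 := hinit 0 t
      obtain ⟨L, hL⟩ := (h j).exists_hasStrictFDerivAt_equiv hΨ hp0
      have hinj : InjOn (tubeMap (c j) (n j)) (hL.toOpenPartialHomeomorph _).source :=
        (hL.toOpenPartialHomeomorph _).injOn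
      have hmem : (hL.toOpenPartialHomeomorph _).source ∈ 𝓝 (Fin.snoc 0 t : Fin 4 → ℝ) :=
        (hL.toOpenPartialHomeomorph _).open_source.mem_nhds hL.mem_toOpenPartialHomeomorph_source
      have ht1 : Tendsto (fun z : ((Fin 3 → ℝ) × (Fin 3 → ℝ)) × ℝ × ℝ =>
          (Fin.snoc z.1.1 z.2.1 : Fin 4 → ℝ)) (𝓝 ((0, 0), t, t')) (𝓝 (Fin.snoc 0 t)) :=
        hc1.tendsto _
      have ht2 : Tendsto (fun z : ((Fin 3 → ℝ) × (Fin 3 → ℝ)) × ℝ × ℝ =>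
          (Fin.snoc z.1.2 z.2.2 : Fin 4 → ℝ) + Pi.single 3 (m : ℝ)) (𝓝 ((0, 0), t, t'))
          (𝓝 (Fin.snoc 0 t)) := by
        have e : (Fin.snoc 0 t : Fin 4 → ℝ) = Fin.snoc 0 t' + Pi.single 3 (m : ℝ) := by
          funext k
          refine Fin.lastCases ?_ (fun i => ?_) k
          · have e3 : (Fin.last 3 : Fin 4) = 3 := rfl
            simp only [Pi.add_apply, Fin.snoc_last]
            rw [e3, Pi.single_eq_same, ← hm]
            exact (add_sub_cancel _ _).symm
          · simp [hi]
        rw [e]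
        exact (hc2.add (continuous_const (y := (Pi.single 3 (m : ℝ) : Fin 4 → ℝ)))).tendsto
          ((0, 0), t, t')
      filter_upwards [ht1.eventually hmem, ht2.eventually hmem] with z hz1 hz2 hzt hzt' heq
      rw [← (h j).tubeMap_add_int (Fin.snoc z.1.2 z.2.2) m] at heq
      have heq' := hinj hz1 hz2 heq
      have e1 : z.1.1 = z.1.2 := by
        have := congrArg initL heq'
        rw [map_add, hinit, hinit] at this
        rw [this]
        ext i
        simp [hi]
      have e2 : z.2.1 = z.2.2 + m := by
        have := congrFun heq' 3
        rw [Pi.add_apply, hlast, hlast, Pi.single_eq_same] at this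
        exact this
      refine ⟨rfl, e1, ?_⟩
      have hm1 : (m : ℝ) < 1 := by linarith [hzt.2, hzt'.1]
      have hm2 : (-1 : ℝ) < m := by linarith [hzt.1, hzt'.2]
      have : m = 0 := by
        have a1 : m < 1 := by exact_mod_cast hm1
        have a2 : -1 < m := by exact_mod_cast hm2
        omega
      rw [e2, this]; simp
    · have h1 : ∀ᶠ z : ((Fin 3 → ℝ) × (Fin 3 → ℝ)) × ℝ × ℝ in 𝓝 ((0, 0), t, t'),
          tubeMap (c j) (n j) (Fin.snoc z.1.1 z.2.1) ≠
            tubeMap (c k) (n k) (Fin.snoc z.1.2 z.2.2) := by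
        refine (ContinuousAt.ne_iff_eventually_ne ((hcont j).comp hc1).continuousAt
          ((hcont k).comp hc2).continuousAt).1 ?_
        · simp only [Function.comp_apply]
          rw [tubeMap_of_initL_eq_zero (hinit 0 t), tubeMap_of_initL_eq_zero (hinit 0 t'),
            hlast, hlast]
          exact hne
      filter_upwards [h1] with z hz _ _ heq
      exact absurd heq hz
  have key2 : ∀ᶠ a in 𝓝 ((0, 0) : (Fin 3 → ℝ) × (Fin 3 → ℝ)), ∀ j k,
      ∀ t ∈ Icc (0 : ℝ) 1 ×ˢ Icc (0 : ℝ) 1, P j k a t := by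
    rw [eventually_all]; intro j
    rw [eventually_all]; exact key j
  obtain ⟨δ, hδ, hball⟩ := Metric.eventually_nhds_iff_ball.1 key2
  refine ⟨δ, hδ, fun j k s s' hs hs' hn hn' heq => ?_⟩
  have hrep : ∀ s : Fin 4 → ℝ, s = Fin.snoc (initL s) (s 3) := fun s => by
    funext k
    refine Fin.lastCases ?_ (fun i => ?_) k
    · simp; rfl
    · simp
  have hmem : (initL s, initL s') ∈ Metric.ball ((0, 0) : (Fin 3 → ℝ) × (Fin 3 → ℝ)) δ := by
    rw [mem_ball_iff_norm]
    simpa [Prod.norm_def] using ⟨hn, hn'⟩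
  have := hball _ hmem j k (s 3, s' 3) ⟨⟨hs.1, hs.2.le⟩, ⟨hs'.1, hs'.2.le⟩⟩ hs hs' (by
    simp only
    rw [← hrep s, ← hrep s']
    exact heq)
  refine ⟨this.1, ?_⟩
  have e1 : initL s = initL s' := this.2.1
  have e2 : s 3 = s' 3 := this.2.2
  rw [hrep s, hrep s', e1, e2]

/-! ### Integration over shrinking tubes -/

/-- The linear map that multiplies the first three coordinates of `ℝ⁴` by `ε`. -/
noncomputable def normalScale (ε : ℝ) : (Fin 4 → ℝ) →L[ℝ] (Fin 4 → ℝ) :=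
  LinearMap.toContinuousLinearMap (Matrix.toLin' (Matrix.diagonal ![ε, ε, ε, 1]))

theorem normalScale_castSucc (ε : ℝ) (s : Fin 4 → ℝ) (i : Fin 3) :
    normalScale ε s i.castSucc = ε * s i.castSucc := by
  fin_cases i <;> simp [normalScale, Matrix.mulVec_diagonal]

theorem normalScale_three (ε : ℝ) (s : Fin 4 → ℝ) : normalScale ε s 3 = s 3 := by
  simp [normalScale, Matrix.mulVec_diagonal]

theorem initL_normalScale (ε : ℝ) (s : Fin 4 → ℝ) : initL (normalScale ε s) = ε • initL s := by
  ext i; simp [normalScale_castSucc]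

theorem det_normalScale (ε : ℝ) : (normalScale ε).det = ε ^ 3 := by
  unfold normalScale
  rw [LinearMap.det_toContinuousLinearMap, LinearMap.det_toLin', Matrix.det_diagonal]
  simp [Fin.prod_univ_four]
  ring

theorem ext_initL {s s' : Fin 4 → ℝ} (h : initL s = initL s') (h3 : s 3 = s' 3) : s = s' := by
  funext k
  exact Fin.lastCases h3 (fun i => congrFun h i) k

theorem continuous_normalScale_apply (s : Fin 4 → ℝ) : Continuous fun ε => normalScale ε s := by
  refine continuous_pi fun k => ?_
  refine Fin.lastCases ?_ (fun i => ?_) k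
  · have : ∀ ε, normalScale ε s (Fin.last 3) = s 3 := fun ε => normalScale_three ε s
    simp only [this]
    exact continuous_const
  · simp only [normalScale_castSucc]
    exact continuous_id.mul continuous_const

theorem det_fderiv_tubeMap {c : ℝ → Fin 4 → ℝ} {n : Fin 3 → ℝ → Fin 4 → ℝ} (hc : ContDiff ℝ ∞ c)
    (hn : ∀ i, ContDiff ℝ ∞ (n i)) {s : Fin 4 → ℝ} (hs : initL s = 0) :
    (fderiv ℝ (tubeMap c n) s).det =
      Matrix.det (Matrix.of ![n 0 (s 3), n 1 (s 3), n 2 (s 3), deriv c (s 3)]) := by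
  unfold ContinuousLinearMap.det
  rw [← LinearMap.det_toMatrix', ← Matrix.det_transpose]
  refine congrArg Matrix.det (Matrix.ext fun i j => ?_)
  have e : fderiv ℝ (tubeMap c n) s (Pi.single i 1) =
      ![n 0 (s 3), n 1 (s 3), n 2 (s 3), deriv c (s 3)] i := by
    rw [fderiv_tubeMap hc hn hs]
    refine Fin.lastCases ?_ (fun k => ?_) i
    · have e3 : (Fin.last 3 : Fin 4) = 3 := rfl
      have hi : ∀ i : Fin 3, i.castSucc ≠ (3 : Fin 4) := fun i => (Fin.castSucc_lt_last i).ne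
      rw [e3]
      simp [hi]
    · have hk : (3 : Fin 4) ≠ k.castSucc := (Fin.castSucc_lt_last k).ne'
      have : ![n 0 (s 3), n 1 (s 3), n 2 (s 3), deriv c (s 3)] k.castSucc = n k (s 3) := by
        fin_cases k <;> rfl
      rw [this]
      simp [hk, Pi.single_apply]
  rw [Matrix.transpose_apply, LinearMap.toMatrix'_apply, Matrix.of_apply, ← e]
  rfl

/-- Fubini's theorem for the product of a function of the normal coordinates and a function of the
parameter. -/
theorem setIntegral_initL_mul (B : (Fin 3 → ℝ) → ℝ) (G : ℝ → ℂ) {ρ : ℝ}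
    (hB : ∀ a, B a ≠ 0 → ‖a‖ ≤ ρ) :
    ∫ s in {s : Fin 4 → ℝ | s 3 ∈ Ico (0 : ℝ) 1 ∧ ‖initL s‖ ≤ ρ}, (B (initL s) : ℂ) * G (s 3) =
      ((∫ a, B a : ℝ) : ℂ) * ∫ t in (0 : ℝ)..1, G t := by
  have hmeas : MeasurableSet {s : Fin 4 → ℝ | s 3 ∈ Ico (0 : ℝ) 1 ∧ ‖initL s‖ ≤ ρ} :=
    ((measurable_pi_apply 3) measurableSet_Ico).inter
      (isClosed_le initL.continuous.norm continuous_const).measurableSet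
  rw [← integral_indicator hmeas]
  have h1 : ∀ s : Fin 4 → ℝ, {s : Fin 4 → ℝ | s 3 ∈ Ico (0 : ℝ) 1 ∧ ‖initL s‖ ≤ ρ}.indicator
      (fun s => (B (initL s) : ℂ) * G (s 3)) s
      = (fun z : ℝ × (Fin 3 → ℝ) => (Ico (0 : ℝ) 1).indicator G z.1 * (B z.2 : ℂ))
        (MeasurableEquiv.piFinSuccAbove (fun _ : Fin 4 => ℝ) (Fin.last 3) s) := by
    intro s
    have e1 : (MeasurableEquiv.piFinSuccAbove (fun _ : Fin 4 => ℝ) (Fin.last 3) s).1 = s 3 := rfl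
    have e2 : (MeasurableEquiv.piFinSuccAbove (fun _ : Fin 4 => ℝ) (Fin.last 3) s).2
        = initL s := by
      ext i
      have : (Fin.last 3).succAbove i = i.castSucc := Fin.succAbove_last_apply i
      simp only [MeasurableEquiv.piFinSuccAbove, initL_apply, ← this]
      rfl
    simp only [e1, e2, indicator_apply, mem_ofPred_eq]
    by_cases h3 : s 3 ∈ Ico (0 : ℝ) 1
    · by_cases hb : B (initL s) = 0
      · simp [hb]
      · simp [h3, hB _ hb, mul_comm]
    · simp [h3]
  simp_rw [h1]
  rw [(volume_preserving_piFinSuccAbove (fun _ : Fin 4 => ℝ) (Fin.last 3)).integral_comp'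
    (g := fun z : ℝ × (Fin 3 → ℝ) => (Ico (0 : ℝ) 1).indicator G z.1 * (B z.2 : ℂ)),
    Measure.volume_eq_prod,
    integral_prod_mul ((Ico (0 : ℝ) 1).indicator G) (fun a => (B a : ℂ)),
    integral_indicator measurableSet_Ico, integral_Ico_eq_integral_Ioc,
    ← intervalIntegral.integral_of_le zero_le_one, integral_complex_ofReal, mul_comm]

/-- Integration against an approximation `ε⁻³ B (Ψ / ε)` of the unit mass in `ℝ³`, pulled back by
`Ψ : ℝ⁴ → ℝ³`, tends to an integral over the curves that form the zero set of `Ψ` in the support of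
the integrand. -/
theorem tendsto_integral_comp_smul {κ : Type*} [Fintype κ] {Ψ : (Fin 4 → ℝ) → Fin 3 → ℝ}
    (hΨ : ContDiff ℝ ∞ Ψ) {c : κ → ℝ → Fin 4 → ℝ} {n : κ → Fin 3 → ℝ → Fin 4 → ℝ}
    (h : ∀ j, IsNormalFrame Ψ (c j) (n j))
    (hemb : ∀ i j, ∀ s ∈ Ico (0 : ℝ) 1, ∀ t ∈ Ico (0 : ℝ) 1, c i s = c j t → i = j ∧ s = t)
    {B : (Fin 3 → ℝ) → ℝ} (hB : Continuous B) (hBs : HasCompactSupport B)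
    {H : (Fin 4 → ℝ) → ℂ} (hH : Continuous H) (hHs : HasCompactSupport H)
    (hcover : ∀ y ∈ tsupport H, Ψ y = 0 → ∃ j t, c j t = y) :
    Tendsto (fun ε : ℝ => ((ε ^ 3)⁻¹ : ℂ) * ∫ y, (B (ε⁻¹ • Ψ y) : ℂ) * H y) (𝓝[>] 0)
      (𝓝 (∑ j, ((∫ a, B a : ℝ) : ℂ) * ∫ t in (0 : ℝ)..1,
        ((|Matrix.det (Matrix.of ![n j 0 t, n j 1 t, n j 2 t, deriv (c j) t])| : ℝ) : ℂ) *
          H (c j t))) := by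
  obtain ⟨C, hC⟩ := hBs.isCompact.isBounded.exists_norm_le
  have hC' : ∀ a, B a ≠ 0 → ‖a‖ ≤ C := fun a ha => hC a (subset_tsupport _ ha)
  obtain ⟨C₀, hC₀, hCB⟩ : ∃ C₀ > 0, ∀ a, B a ≠ 0 → ‖a‖ ≤ C₀ :=
    ⟨max C 1, by positivity, fun a ha => (hC' a ha).trans (le_max_left _ _)⟩
  set ρ : ℝ := 2 * C₀ with hρ
  set D : Set (Fin 4 → ℝ) := {s | s 3 ∈ Ico (0 : ℝ) 1 ∧ ‖initL s‖ ≤ ρ} with hD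
  set K : Set (Fin 4 → ℝ) := {s | s 3 ∈ Icc (0 : ℝ) 1 ∧ ‖initL s‖ ≤ ρ} with hK
  have hDmeas : MeasurableSet D :=
    ((measurable_pi_apply 3) measurableSet_Ico).inter
      (isClosed_le initL.continuous.norm continuous_const).measurableSet
  have hKcompact : IsCompact K := by
    refine Metric.isCompact_of_isClosed_isBounded ?_ ?_
    · exact (isClosed_Icc.preimage (continuous_apply 3)).inter
        (isClosed_le initL.continuous.norm continuous_const)
    · refine (Metric.isBounded_closedBall (x := (0 : Fin 4 → ℝ)) (r := max 1 ρ)).subset ?_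
      intro s hs
      rw [mem_closedBall_zero_iff]
      refine (pi_norm_le_iff_of_nonneg (by positivity)).2 fun k => ?_
      refine Fin.lastCases ?_ (fun i => ?_) k
      · refine le_max_of_le_left ?_
        rw [Real.norm_eq_abs, abs_le]
        exact ⟨by linarith [hs.1.1, show s (Fin.last 3) = s 3 from rfl], hs.1.2⟩
      · exact le_max_of_le_right ((norm_le_pi_norm (initL s) i).trans hs.2)
  have hDK : D ⊆ K := fun s hs => ⟨⟨hs.1.1, hs.1.2.le⟩, hs.2⟩
  have hDfin : volume D < ⊤ := (measure_mono hDK).trans_lt hKcompact.measure_lt_top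
  have hsm : ∀ j, ContDiff ℝ ∞ (tubeMap (c j) (n j)) := fun j =>
    contDiff_tubeMap (h j).smooth_curve (h j).smooth_frame
  obtain ⟨δ, hδ, hinj⟩ := exists_tubeMap_injective hΨ h hemb
  -- for small `ε` the part of the support of `H` on which the integrand lives is covered by tubes
  have hcov : ∀ᶠ ε in 𝓝 (0 : ℝ), ∀ y ∈ tsupport H, ‖Ψ y‖ ≤ C₀ * |ε| →
      ∃ j s, tubeMap (c j) (n j) s = y ∧ s 3 ∈ Ico (0 : ℝ) 1 ∧ ‖initL s‖ ≤ 2 * ‖Ψ y‖ := by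
    refine hHs.isCompact.eventually_forall_of_forall_eventually fun y hy => ?_
    by_cases hy0 : Ψ y = 0
    · obtain ⟨j, t, rfl⟩ := hcover y hy hy0
      have := (h j).eventually_exists_tubeMap hΨ t
      filter_upwards [continuous_snd.tendsto ((0 : ℝ), c j t) |>.eventually this] with z hz _
      exact ⟨j, hz⟩
    · have : ∀ᶠ z : ℝ × (Fin 4 → ℝ) in 𝓝 (0, y), C₀ * |z.1| < ‖Ψ z.2‖ := by
        refine ContinuousAt.eventually_lt (f := fun z : ℝ × (Fin 4 → ℝ) => C₀ * |z.1|)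
          (g := fun z : ℝ × (Fin 4 → ℝ) => ‖Ψ z.2‖) ?_ ?_ ?_
        · exact (continuous_const.mul continuous_fst.abs).continuousAt
        · exact (hΨ.continuous.comp continuous_snd).norm.continuousAt
        · simpa using hy0
      filter_upwards [this] with z hz hz'
      exact absurd hz' (not_le.2 hz)
  have hsmall : ∀ᶠ ε in 𝓝 (0 : ℝ), ρ * |ε| < δ := by
    have : ContinuousAt (fun ε : ℝ => ρ * |ε|) 0 := by fun_prop
    exact this.eventually_lt continuousAt_const (by simpa using hδ)
  -- the change of variables
  have hformula : ∀ᶠ ε : ℝ in 𝓝[>] (0 : ℝ),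
      (((ε : ℂ) ^ 3)⁻¹ : ℂ) * ∫ y, (B (ε⁻¹ • Ψ y) : ℂ) * H y =
      ∑ j, ∫ s in D, ((|(fderiv ℝ (tubeMap (c j) (n j)) (normalScale ε s)).det| : ℝ) : ℂ) *
        ((B (ε⁻¹ • Ψ (tubeMap (c j) (n j) (normalScale ε s))) : ℂ) *
          H (tubeMap (c j) (n j) (normalScale ε s))) := by
    filter_upwards [nhdsWithin_le_nhds hcov, nhdsWithin_le_nhds hsmall, self_mem_nhdsWithin]
      with ε hε1 hε2 hε0
    have hε0' : 0 < ε := hε0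
    rw [abs_of_pos hε0'] at hε1 hε2
    have hnD : ∀ s ∈ D, ‖initL (normalScale ε s)‖ < δ := fun s hs => by
      rw [initL_normalScale, norm_smul, Real.norm_eq_abs, abs_of_pos hε0']
      calc ε * ‖initL s‖ ≤ ε * ρ := by gcongr; exact hs.2
        _ = ρ * ε := mul_comm _ _
        _ < δ := hε2
    have h3D : ∀ s ∈ D, normalScale ε s 3 ∈ Ico (0 : ℝ) 1 := fun s hs => by
      rw [normalScale_three]; exact hs.1
    have hder : ∀ j s, HasFDerivAt (fun s => tubeMap (c j) (n j) (normalScale ε s))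
        ((fderiv ℝ (tubeMap (c j) (n j)) (normalScale ε s)).comp (normalScale ε)) s := fun j s =>
      ((hsm j).differentiable (by simp) _).hasFDerivAt.comp s (normalScale ε).hasFDerivAt
    have hTinj : ∀ j, InjOn (fun s => tubeMap (c j) (n j) (normalScale ε s)) D := by
      intro j s hs s' hs' heq
      have := (hinj j j _ _ (h3D s hs) (h3D s' hs') (hnD s hs) (hnD s' hs') heq).2
      refine ext_initL ?_ ?_
      · have h1 := congrArg initL this
        rw [initL_normalScale, initL_normalScale] at h1
        exact smul_right_injective _ hε0'.ne' h1
      · have h1 := congrFun this 3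
        rwa [normalScale_three, normalScale_three] at h1
    set A : κ → Set (Fin 4 → ℝ) := fun j => (fun s => tubeMap (c j) (n j) (normalScale ε s)) '' D
      with hA
    have hAmeas : ∀ j, MeasurableSet (A j) := fun j =>
      measurable_image_of_fderivWithin hDmeas (fun s _ => (hder j s).hasFDerivWithinAt) (hTinj j)
    have hAdisj : Pairwise (Function.onFun Disjoint A) := by
      intro j k hjk
      refine Set.disjoint_left.2 ?_
      rintro _ ⟨s, hs, rfl⟩ ⟨s', hs', heq⟩
      exact hjk (hinj j k _ _ (h3D s hs) (h3D s' hs') (hnD s hs) (hnD s' hs') heq.symm).1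
    have hint : Integrable fun y => (B (ε⁻¹ • Ψ y) : ℂ) * H y := by
      refine Continuous.integrable_of_hasCompactSupport ?_ hHs.mul_left
      exact (Complex.continuous_ofReal.comp
        (hB.comp (hΨ.continuous.const_smul ε⁻¹))).mul hH
    have hsupp : ∫ y, (B (ε⁻¹ • Ψ y) : ℂ) * H y = ∫ y in ⋃ j, A j, (B (ε⁻¹ • Ψ y) : ℂ) * H y := by
      refine (setIntegral_eq_integral_of_forall_compl_eq_zero fun y hy => ?_).symm
      by_contra hne
      refine hy ?_
      have hBne : B (ε⁻¹ • Ψ y) ≠ 0 := fun h0 => hne (by simp [h0])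
      have hHne : H y ≠ 0 := fun h0 => hne (by simp [h0])
      have h1 : ‖Ψ y‖ ≤ C₀ * ε := by
        have := hCB _ hBne
        rw [norm_smul, norm_inv, Real.norm_eq_abs, abs_of_pos hε0', inv_mul_le_iff₀ hε0'] at this
        linarith
      obtain ⟨j, s, hs, hs3, hsn⟩ := hε1 y (subset_tsupport _ hHne) h1
      refine mem_iUnion.2 ⟨j, normalScale ε⁻¹ s, ⟨?_, ?_⟩, ?_⟩
      · rw [normalScale_three]; exact hs3
      · rw [initL_normalScale, norm_smul, norm_inv, Real.norm_eq_abs, abs_of_pos hε0',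
          inv_mul_le_iff₀ hε0', hρ]
        linarith
      · have : normalScale ε (normalScale ε⁻¹ s) = s := by
          refine ext_initL ?_ ?_
          · rw [initL_normalScale, initL_normalScale, smul_inv_smul₀ hε0'.ne']
          · rw [normalScale_three, normalScale_three]
        simp only [this, hs]
    rw [hsupp, integral_iUnion_fintype hAmeas hAdisj fun j => hint.integrableOn, Finset.mul_sum]
    refine Finset.sum_congr rfl fun j _ => ?_
    rw [hA, integral_image_eq_integral_abs_det_fderiv_smul volume hDmeas
      (fun s _ => (hder j s).hasFDerivWithinAt) (hTinj j), ← integral_const_mul]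
    refine setIntegral_congr_fun hDmeas fun s _ => ?_
    have hdet : ((fderiv ℝ (tubeMap (c j) (n j)) (normalScale ε s)).comp (normalScale ε)).det =
        (fderiv ℝ (tubeMap (c j) (n j)) (normalScale ε s)).det * ε ^ 3 := by
      rw [← det_normalScale]
      exact LinearMap.det_comp _ _
    have hεne : (ε : ℂ) ≠ 0 := by exact_mod_cast hε0'.ne'
    simp only [hdet, abs_mul, abs_of_pos (pow_pos hε0' 3), Complex.real_smul, Complex.ofReal_mul,
      Complex.ofReal_pow]
    field_simp
  refine Tendsto.congr' (EventuallyEq.symm hformula) (tendsto_finsetSum _ fun j _ => ?_)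
  -- the limit of the integrals over the normal coordinates
  rw [← setIntegral_initL_mul B (fun t => ((|Matrix.det (Matrix.of ![n j 0 t, n j 1 t, n j 2 t,
    deriv (c j) t])| : ℝ) : ℂ) * H (c j t)) (ρ := ρ) fun a ha => (hCB a ha).trans (by linarith)]
  have hdetc : Continuous fun s => (fderiv ℝ (tubeMap (c j) (n j)) s).det :=
    ContinuousLinearMap.continuous_det.comp ((hsm j).continuous_fderiv (by simp))
  obtain ⟨M₁, hM₁⟩ := hKcompact.exists_bound_of_continuousOn hdetc.continuousOn
  obtain ⟨M₂, hM₂⟩ := hB.bounded_above_of_compact_support hBs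
  obtain ⟨M₃, hM₃⟩ := hH.bounded_above_of_compact_support hHs
  refine tendsto_integral_filter_of_dominated_convergence (fun _ => M₁ * (M₂ * M₃)) ?_ ?_ ?_ ?_
  · refine Eventually.of_forall fun ε => Continuous.aestronglyMeasurable ?_
    have hS := (normalScale ε).continuous
    have hT := (hsm j).continuous.comp hS
    exact (Complex.continuous_ofReal.comp (hdetc.comp hS).abs).mul
      ((Complex.continuous_ofReal.comp (hB.comp
        ((hΨ.continuous.comp hT).const_smul ε⁻¹))).mul (hH.comp hT))
  · filter_upwards [Ioo_mem_nhdsGT (zero_lt_one' ℝ)] with ε hε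
    rw [ae_restrict_iff' hDmeas]
    refine Eventually.of_forall fun s hs => ?_
    have hmem : normalScale ε s ∈ K := by
      refine ⟨?_, ?_⟩
      · rw [normalScale_three]; exact (hDK hs).1
      · rw [initL_normalScale, norm_smul, Real.norm_eq_abs, abs_of_pos hε.1]
        calc ε * ‖initL s‖ ≤ 1 * ‖initL s‖ := by gcongr; exact hε.2.le
          _ ≤ ρ := by rw [one_mul]; exact hs.2
    rw [norm_mul, norm_mul, Complex.norm_real, Complex.norm_real, norm_abs_eq_norm]
    gcongr
    · exact (norm_nonneg _).trans (hM₁ _ hmem)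
    · exact hM₁ _ hmem
    · exact (norm_nonneg _).trans (hM₂ 0)
    · exact hM₂ _
    · exact hM₃ _
  · exact integrableOn_const hDfin.ne
  · refine Eventually.of_forall fun s => ?_
    set p : Fin 4 → ℝ := normalScale 0 s with hp
    have hp0 : initL p = 0 := by rw [hp, initL_normalScale, zero_smul]
    have hp3 : p 3 = s 3 := normalScale_three 0 s
    have hSt : Tendsto (fun ε => normalScale ε s) (𝓝[>] 0) (𝓝 p) :=
      ((continuous_normalScale_apply s).tendsto 0).mono_left nhdsWithin_le_nhds
    have hlin : Tendsto (fun ε : ℝ => ε⁻¹ • Ψ (tubeMap (c j) (n j) (normalScale ε s))) (𝓝[>] 0)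
        (𝓝 (initL s)) := by
      have h1 := ((h j).hasStrictFDerivAt_comp_tubeMap hΨ hp0).hasFDerivAt
      have hS' : HasDerivAt (fun ε : ℝ => normalScale ε s)
          (s - Pi.single 3 (s 3)) (0 : ℝ) := by
        rw [hasDerivAt_pi]
        intro k
        refine Fin.lastCases ?_ (fun i => ?_) k
        · have e3 : (Fin.last 3 : Fin 4) = 3 := rfl
          simp only [e3, normalScale_three, Pi.sub_apply, Pi.single_eq_same, sub_self]
          exact hasDerivAt_const _ _
        · have hi : i.castSucc ≠ (3 : Fin 4) := (Fin.castSucc_lt_last i).ne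
          simp only [normalScale_castSucc, Pi.sub_apply, Pi.single_eq_of_ne hi, sub_zero]
          simpa using (hasDerivAt_id (0 : ℝ)).mul_const (s i.castSucc)
      have h2 := h1.comp_hasDerivAt (0 : ℝ) hS'
      have h3 : initL (s - Pi.single 3 (s 3)) = initL s := by
        ext i
        have hi : i.castSucc ≠ (3 : Fin 4) := (Fin.castSucc_lt_last i).ne
        simp [hi]
      rw [h3] at h2
      have h4 := h2.tendsto_slope_zero.mono_left (nhdsGT_le_nhdsNE (0 : ℝ))
      refine h4.congr fun ε => ?_
      have hz : Ψ (tubeMap (c j) (n j) p) = 0 := by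
        rw [tubeMap_of_initL_eq_zero hp0]; exact (h j).zero_curve _
      simp only [Function.comp_apply, zero_add, ← hp, hz, sub_zero]
    have hT : Tendsto (fun ε => tubeMap (c j) (n j) (normalScale ε s)) (𝓝[>] 0)
        (𝓝 (c j (s 3))) := by
      have := ((hsm j).continuous.tendsto p).comp hSt
      rwa [tubeMap_of_initL_eq_zero hp0, hp3] at this
    have hdt := (hdetc.tendsto p).comp hSt
    rw [det_fderiv_tubeMap (h j).smooth_curve (h j).smooth_frame hp0, hp3] at hdt
    have h1 := (Complex.continuous_ofReal.tendsto _).comp hdt.abs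
    have h2 := (Complex.continuous_ofReal.tendsto _).comp ((hB.tendsto _).comp hlin)
    have h3 := (hH.tendsto _).comp hT
    have h4 := h1.mul (h2.mul h3)
    refine (h4.congr fun ε => rfl).trans_eq ?_
    congr 1
    ring

/-! ### Frames dual to a defining map -/

theorem det_rows_four {A : Type*} [CommRing A] (a b c d : Fin 4 → A) :
    Matrix.det (Matrix.of ![a, b, c, d]) =
      a 0 * (b 1 * (c 2 * d 3 - c 3 * d 2) - b 2 * (c 1 * d 3 - c 3 * d 1)
        + b 3 * (c 1 * d 2 - c 2 * d 1))
      - a 1 * (b 0 * (c 2 * d 3 - c 3 * d 2) - b 2 * (c 0 * d 3 - c 3 * d 0)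
        + b 3 * (c 0 * d 2 - c 2 * d 0))
      + a 2 * (b 0 * (c 1 * d 3 - c 3 * d 1) - b 1 * (c 0 * d 3 - c 3 * d 0)
        + b 3 * (c 0 * d 1 - c 1 * d 0))
      - a 3 * (b 0 * (c 1 * d 2 - c 2 * d 1) - b 1 * (c 0 * d 2 - c 2 * d 0)
        + b 2 * (c 0 * d 1 - c 1 * d 0)) := by
  rw [Matrix.det_succ_row_zero, Fin.sum_univ_four]
  simp only [Matrix.det_fin_three, Matrix.submatrix_apply, Matrix.of_apply, Fin.succAbove]
  simp [Fin.lt_def]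
  ring

/-- Multiples of the rows `b` and `c` in the first row do not contribute to the determinant. -/
theorem det_rows_eq_of_combination {A : Type*} [CommRing A] (a b c d e : Fin 4 → A) (x y z : A) :
    Matrix.det (Matrix.of ![fun i => x * a i + y * b i + z * c i + e i, b, c, d]) =
      x * Matrix.det (Matrix.of ![a, b, c, d]) + Matrix.det (Matrix.of ![e, b, c, d]) := by
  simp only [det_rows_four]
  ring

theorem fderiv_apply_eq_sum {n : ℕ} {E : Type*} [NormedAddCommGroup E] [NormedSpace ℝ E]
    (g : (Fin n → ℝ) → E) (x v : Fin n → ℝ) :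
    fderiv ℝ g x v = ∑ i, v i • pderivAt g x i := by
  conv_lhs => rw [pi_eq_sum_univ' v]
  simp only [map_sum, map_smul, pderivAt]

theorem pderivAt_ofReal_comp {n : ℕ} {g : (Fin n → ℝ) → ℝ} (hg : ContDiff ℝ ∞ g)
    (x : Fin n → ℝ) (i : Fin n) :
    pderivAt (fun y => (g y : ℂ)) x i = ((pderivAt g x i : ℝ) : ℂ) := by
  unfold pderivAt
  have h : HasFDerivAt (fun y => (g y : ℂ)) (Complex.ofRealCLM.comp (fderiv ℝ g x)) x :=
    Complex.ofRealCLM.hasFDerivAt.comp x (hg.differentiable (by simp) x).hasFDerivAt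
  rw [h.fderiv]
  rfl

theorem contDiff_det {n : ℕ} {E : Type*} [NormedAddCommGroup E] [NormedSpace ℝ E]
    {M : E → Matrix (Fin n) (Fin n) ℝ} (hM : ∀ i j, ContDiff ℝ ∞ fun x => M x i j) :
    ContDiff ℝ ∞ fun x => (M x).det := by
  simp only [Matrix.det_apply']
  exact ContDiff.sum fun σ _ => contDiff_const.mul (contDiff_prod fun i _ => hM _ _)

theorem contDiff_matrix_inv {n : ℕ} {E : Type*} [NormedAddCommGroup E] [NormedSpace ℝ E]
    {M : E → Matrix (Fin n) (Fin n) ℝ} (hM : ∀ i j, ContDiff ℝ ∞ fun x => M x i j)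
    (hdet : ∀ x, (M x).det ≠ 0) (i j : Fin n) : ContDiff ℝ ∞ fun x => (M x)⁻¹ i j := by
  have h : ∀ x, (M x)⁻¹ i j = ((M x).det)⁻¹ * (M x).adjugate i j := fun x => by
    rw [Matrix.inv_def, Matrix.smul_apply, Ring.inverse_eq_inv', smul_eq_mul]
  simp only [h, Matrix.adjugate_apply]
  refine ((contDiff_det hM).inv hdet).mul (contDiff_det fun k l => ?_)
  by_cases hk : k = j
  · subst hk; simp only [Matrix.updateRow_self]; exact contDiff_const
  · simp only [Matrix.updateRow_ne hk]; exact hM k l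

/-- The map `(R, Re f, Im f) : ℝ⁴ → ℝ³`. -/
noncomputable def definingMap (R : (Fin 4 → ℝ) → ℝ) (f : (Fin 4 → ℝ) → ℂ) (y : Fin 4 → ℝ) :
    Fin 3 → ℝ :=
  ![R y, (f y).re, (f y).im]

/-- The matrix with rows `∇R, ∇Re f, ∇Im f` at `y` and `v`. -/
noncomputable def gradMatrix (R : (Fin 4 → ℝ) → ℝ) (f : (Fin 4 → ℝ) → ℂ) (y v : Fin 4 → ℝ) :
    Matrix (Fin 4) (Fin 4) ℝ :=
  Matrix.of ![pderivAt R y, pderivAt (fun y => (f y).re) y, pderivAt (fun y => (f y).im) y, v]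

section
variable {R : (Fin 4 → ℝ) → ℝ} {f : (Fin 4 → ℝ) → ℂ}

theorem contDiff_re (hf : ContDiff ℝ ∞ f) : ContDiff ℝ ∞ fun y => (f y).re :=
  Complex.reCLM.contDiff.comp hf

theorem contDiff_im (hf : ContDiff ℝ ∞ f) : ContDiff ℝ ∞ fun y => (f y).im :=
  Complex.imCLM.contDiff.comp hf

theorem fderiv_re (hf : ContDiff ℝ ∞ f) (y v : Fin 4 → ℝ) :
    fderiv ℝ (fun y => (f y).re) y v = (fderiv ℝ f y v).re := by
  have h : HasFDerivAt (fun y => (f y).re) (Complex.reCLM.comp (fderiv ℝ f y)) y :=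
    Complex.reCLM.hasFDerivAt.comp y (hf.differentiable (by simp) y).hasFDerivAt
  rw [h.fderiv]; rfl

theorem fderiv_im (hf : ContDiff ℝ ∞ f) (y v : Fin 4 → ℝ) :
    fderiv ℝ (fun y => (f y).im) y v = (fderiv ℝ f y v).im := by
  have h : HasFDerivAt (fun y => (f y).im) (Complex.imCLM.comp (fderiv ℝ f y)) y :=
    Complex.imCLM.hasFDerivAt.comp y (hf.differentiable (by simp) y).hasFDerivAt
  rw [h.fderiv]; rfl

theorem contDiff_definingMap (hR : ContDiff ℝ ∞ R) (hf : ContDiff ℝ ∞ f) :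
    ContDiff ℝ ∞ (definingMap R f) := by
  rw [contDiff_pi]
  intro i
  fin_cases i
  · exact hR
  · exact contDiff_re hf
  · exact contDiff_im hf

theorem fderiv_definingMap (hR : ContDiff ℝ ∞ R) (hf : ContDiff ℝ ∞ f) (y v : Fin 4 → ℝ) :
    fderiv ℝ (definingMap R f) y v =
      ![fderiv ℝ R y v, (fderiv ℝ f y v).re, (fderiv ℝ f y v).im] := by
  have h : HasFDerivAt (definingMap R f) (ContinuousLinearMap.pi
      ![fderiv ℝ R y, fderiv ℝ (fun y => (f y).re) y, fderiv ℝ (fun y => (f y).im) y]) y := by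
    rw [hasFDerivAt_pi]
    intro i
    fin_cases i
    · exact (hR.differentiable (by simp) y).hasFDerivAt
    · exact ((contDiff_re hf).differentiable (by simp) y).hasFDerivAt
    · exact ((contDiff_im hf).differentiable (by simp) y).hasFDerivAt
  rw [h.fderiv, ← fderiv_re hf, ← fderiv_im hf]
  ext i
  fin_cases i <;> rfl

theorem gradMatrix_mulVec (hf : ContDiff ℝ ∞ f) (y v w : Fin 4 → ℝ) :
    (gradMatrix R f y v).mulVec w =
      ![fderiv ℝ R y w, (fderiv ℝ f y w).re, (fderiv ℝ f y w).im, v ⬝ᵥ w] := by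
  rw [← fderiv_re hf, ← fderiv_im hf]
  simp only [fderiv_apply_eq_sum]
  ext i
  fin_cases i <;> simp [gradMatrix, Matrix.mulVec, dotProduct, mul_comm]

theorem mul_transpose_of (M : Matrix (Fin 4) (Fin 4) ℝ) (a b c d : Fin 4 → ℝ) :
    M * (Matrix.of ![a, b, c, d]).transpose =
      (Matrix.of ![M.mulVec a, M.mulVec b, M.mulVec c, M.mulVec d]).transpose := by
  ext i j
  fin_cases j <;> simp [Matrix.mul_apply, Matrix.mulVec, dotProduct]

/-- If `(ν, τ, a, b)` is a positive basis, where `ν` points to the side `R > 0`, `τ` is tangent to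
`{R = 0, f = 0}` and `a`, `b` are mapped to `1`, `i` by `df`, then `(∇R, ∇Re f, ∇Im f, τ)` is a
positive basis. -/
theorem det_gradMatrix_pos (hf : ContDiff ℝ ∞ f) {y τ ν a b : Fin 4 → ℝ} (hτ : τ ≠ 0)
    (hRτ : fderiv ℝ R y τ = 0) (hfτ : fderiv ℝ f y τ = 0) (hRν : 0 < fderiv ℝ R y ν)
    (hfν : fderiv ℝ f y ν = 0) (hfa : fderiv ℝ f y a = 1) (hfb : fderiv ℝ f y b = Complex.I)
    (hdet : 0 < Matrix.det (Matrix.of ![ν, τ, a, b])) : 0 < (gradMatrix R f y τ).det := by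
  have h1 : (gradMatrix R f y τ).det * Matrix.det (Matrix.of ![ν, a, b, τ]) =
      fderiv ℝ R y ν * (τ ⬝ᵥ τ) := by
    rw [← Matrix.det_transpose (Matrix.of ![ν, a, b, τ]), ← Matrix.det_mul, mul_transpose_of,
      Matrix.det_transpose]
    simp only [gradMatrix_mulVec hf, det_rows_four, hRτ, hfτ, hfν, hfa, hfb]
    simp
  have h2 : Matrix.det (Matrix.of ![ν, a, b, τ]) = Matrix.det (Matrix.of ![ν, τ, a, b]) := by
    simp only [det_rows_four]; ring
  have h3 : 0 < τ ⬝ᵥ τ := by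
    refine lt_of_le_of_ne (Finset.sum_nonneg fun i _ => mul_self_nonneg _) ?_
    intro h
    exact hτ (dotProduct_self_eq_zero.1 h.symm)
  rw [h2] at h1
  have h4 := mul_pos hRν h3
  rw [← h1] at h4
  exact pos_of_mul_pos_left h4 hdet.le

/-- The normal frame of a curve in `{R = 0, f = 0}` which is dual to `dR, dRe f, dIm f` and
orthogonal to the curve. -/
noncomputable def dualFrame (R : (Fin 4 → ℝ) → ℝ) (f : (Fin 4 → ℝ) → ℂ) (c : ℝ → Fin 4 → ℝ)
    (i : Fin 3) (t : ℝ) : Fin 4 → ℝ :=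
  fun k => (gradMatrix R f (c t) (deriv c t))⁻¹ k i.castSucc

theorem gradMatrix_mulVec_dualFrame {c : ℝ → Fin 4 → ℝ} {t : ℝ}
    (hdet : (gradMatrix R f (c t) (deriv c t)).det ≠ 0) (i : Fin 3) :
    (gradMatrix R f (c t) (deriv c t)).mulVec (dualFrame R f c i t) = Pi.single i.castSucc 1 := by
  have h := Matrix.mul_nonsing_inv _ (isUnit_iff_ne_zero.2 hdet)
  ext k
  have := congrFun (congrFun h k) i.castSucc
  rw [Matrix.mul_apply] at this
  simpa [Matrix.mulVec, dotProduct, dualFrame, Matrix.one_apply, Pi.single_apply] using this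

theorem contDiff_gradMatrix {c : ℝ → Fin 4 → ℝ} (hR : ContDiff ℝ ∞ R) (hf : ContDiff ℝ ∞ f)
    (hc : ContDiff ℝ ∞ c) (i j : Fin 4) :
    ContDiff ℝ ∞ fun t => gradMatrix R f (c t) (deriv c t) i j := by
  have hd : ContDiff ℝ ∞ (deriv c) := (contDiff_infty_iff_deriv.1 hc).2
  fin_cases i
  · exact (contDiff_pderivAt hR j).comp hc
  · exact (contDiff_pderivAt (contDiff_re hf) j).comp hc
  · exact (contDiff_pderivAt (contDiff_im hf) j).comp hc
  · exact (contDiff_apply ℝ ℝ j).comp hd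

theorem isNormalFrame_dualFrame {c : ℝ → Fin 4 → ℝ} (hR : ContDiff ℝ ∞ R)
    (hf : ContDiff ℝ ∞ f) (hc : ContDiff ℝ ∞ c) (hcp : Function.Periodic c 1)
    (hreg : ∀ t, deriv c t ≠ 0) (hRc : ∀ t, R (c t) = 0) (hfc : ∀ t, f (c t) = 0)
    (hdet : ∀ t, (gradMatrix R f (c t) (deriv c t)).det ≠ 0) :
    IsNormalFrame (definingMap R f) c (dualFrame R f c) where
  smooth_curve := hc
  periodic_curve := hcp
  regular_curve := hreg
  zero_curve t := by
    ext i
    fin_cases i <;> simp [definingMap, hRc, hfc]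
  smooth_frame i := by
    rw [contDiff_pi]
    exact fun k => contDiff_matrix_inv (contDiff_gradMatrix hR hf hc) hdet _ _
  periodic_frame i t := by
    have : deriv c (t + 1) = deriv c t := by
      rw [← deriv_comp_add_const]
      congr 1
      exact funext hcp
    unfold dualFrame
    rw [this, hcp t]
  dual i t := by
    have h1 := gradMatrix_mulVec_dualFrame (hdet t) i
    rw [gradMatrix_mulVec hf] at h1
    rw [fderiv_definingMap hR hf]
    ext k
    have := congrFun h1 k.castSucc
    fin_cases k <;> fin_cases i <;> simpa using this

/-- On the dual frame and the tangent vector `τ` of the curve, the form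
`dR ∧ dRe f ∧ dIm f ∧ dF` takes the value `dF(τ)`. -/
theorem det_dualFrame_mul {c : ℝ → Fin 4 → ℝ} {F : (Fin 4 → ℝ) → ℂ} {t : ℝ}
    (hR : ContDiff ℝ ∞ R) (hf : ContDiff ℝ ∞ f)
    (hRτ : fderiv ℝ R (c t) (deriv c t) = 0) (hfτ : fderiv ℝ f (c t) (deriv c t) = 0)
    (hreg : deriv c t ≠ 0) (hdet : 0 < (gradMatrix R f (c t) (deriv c t)).det) :
    ((|Matrix.det (Matrix.of ![dualFrame R f c 0 t, dualFrame R f c 1 t, dualFrame R f c 2 t,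
      deriv c t])| : ℝ) : ℂ) * Matrix.det (Matrix.of ![pderivAt (fun y => (R y : ℂ)) (c t),
        pderivAt (fun y => ((f y).re : ℂ)) (c t), pderivAt (fun y => ((f y).im : ℂ)) (c t),
        pderivAt F (c t)]) = fderiv ℝ F (c t) (deriv c t) := by
  set τ := deriv c t with hτ
  set N := gradMatrix R f (c t) τ with hN
  set Q : Matrix (Fin 4) (Fin 4) ℝ := Matrix.of ![dualFrame R f c 0 t, dualFrame R f c 1 t,
    dualFrame R f c 2 t, τ] with hQ
  have h3 : 0 < τ ⬝ᵥ τ := by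
    refine lt_of_le_of_ne (Finset.sum_nonneg fun i _ => mul_self_nonneg _) ?_
    intro h
    exact hreg (dotProduct_self_eq_zero.1 h.symm)
  have hNd : ∀ i, N.mulVec (dualFrame R f c i t) = Pi.single i.castSucc 1 := fun i =>
    gradMatrix_mulVec_dualFrame hdet.ne' i
  have hNτ : N.mulVec τ = ![0, 0, 0, τ ⬝ᵥ τ] := by
    rw [hN, gradMatrix_mulVec hf, hRτ, hfτ]; simp
  have hQpos : 0 < Q.det := by
    have h1 : N.det * Q.det = τ ⬝ᵥ τ := by
      rw [← Matrix.det_transpose Q, ← Matrix.det_mul, hQ, mul_transpose_of, Matrix.det_transpose,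
        hNd, hNd, hNd, hNτ, det_rows_four]
      simp [Fin.ext_iff]
    rw [← h1] at h3
    exact pos_of_mul_pos_right h3 hdet.le
  rw [abs_of_pos hQpos]
  have e1 : ((Q.det : ℝ) : ℂ) = (Q.transpose.map (algebraMap ℝ ℂ)).det := by
    rw [← Matrix.det_transpose Q]
    exact RingHom.map_det (algebraMap ℝ ℂ) Q.transpose
  rw [e1, mul_comm, ← Matrix.det_mul]
  set P : Matrix (Fin 4) (Fin 4) ℂ := Matrix.of ![pderivAt (fun y => (R y : ℂ)) (c t),
        pderivAt (fun y => ((f y).re : ℂ)) (c t), pderivAt (fun y => ((f y).im : ℂ)) (c t),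
        pderivAt F (c t)] with hP
  have hrow : ∀ k : Fin 3, ∀ j, P k.castSucc j = (N k.castSucc j : ℂ) := by
    intro k j
    fin_cases k
    · exact pderivAt_ofReal_comp hR _ _
    · exact pderivAt_ofReal_comp (contDiff_re hf) _ _
    · exact pderivAt_ofReal_comp (contDiff_im hf) _ _
  have hcols : ∀ j : Fin 4, (fun k => Q j k) =
      (![dualFrame R f c 0 t, dualFrame R f c 1 t, dualFrame R f c 2 t, τ] j) := fun j => rfl
  have hPQ : ∀ (k : Fin 3) (j : Fin 4), (P * Q.transpose.map (algebraMap ℝ ℂ)) k.castSucc j =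
      ((N.mulVec (Q j) k.castSucc : ℝ) : ℂ) := by
    intro k j
    simp [Matrix.mul_apply, hrow, Matrix.mulVec, dotProduct]
  have hPQ3 : (P * Q.transpose.map (algebraMap ℝ ℂ)) 3 3 = fderiv ℝ F (c t) τ := by
    rw [fderiv_apply_eq_sum, Matrix.mul_apply]
    refine Finset.sum_congr rfl fun i _ => ?_
    simp [hP, hQ, mul_comm]
  have hrep : P * Q.transpose.map (algebraMap ℝ ℂ) = Matrix.of
      ![Pi.single 0 1, Pi.single 1 1, Pi.single 2 1,
        (P * Q.transpose.map (algebraMap ℝ ℂ)) 3] := by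
    have hent : ∀ (k i : Fin 3), (P * Q.transpose.map (algebraMap ℝ ℂ)) k.castSucc i.castSucc =
        ((Pi.single i.castSucc (1 : ℝ) : Fin 4 → ℝ) k.castSucc : ℂ) := by
      intro k i
      rw [hPQ, ← hNd i]
      congr 2
      fin_cases i <;> rfl
    have hent3 : ∀ (k : Fin 3), (P * Q.transpose.map (algebraMap ℝ ℂ)) k.castSucc 3 = 0 := by
      intro k
      rw [hPQ, show Q 3 = τ from rfl, hNτ]
      fin_cases k <;> simp
    ext k j
    refine Fin.lastCases rfl (fun k => ?_) k
    refine Fin.lastCases ?_ (fun i => ?_) j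
    · refine (hent3 k).trans ?_
      fin_cases k <;> simp [Fin.ext_iff]
    · refine (hent k i).trans ?_
      fin_cases k <;> fin_cases i <;> simp [Fin.ext_iff]
  rw [hrep, det_rows_four, hPQ3]
  simp [Fin.ext_iff]

end

/-! ### Logarithmic variation along the boundary of a surface -/

/-- A smooth function with compact support which is equal to `χ / F` on `{R ≥ 0}`. -/
theorem exists_contDiff_quotient {R χ : (Fin 4 → ℝ) → ℝ} {F : (Fin 4 → ℝ) → ℂ}
    (hR : ContDiff ℝ ∞ R) (hF : ContDiff ℝ ∞ F) (hχ : ContDiff ℝ ∞ χ) (hχs : HasCompactSupport χ)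
    (hFne : ∀ y ∈ tsupport χ, 0 ≤ R y → F y ≠ 0) :
    ∃ G : (Fin 4 → ℝ) → ℂ, ContDiff ℝ ∞ G ∧ tsupport G ⊆ tsupport χ ∧
      ∀ y, 0 ≤ R y → G y = χ y / F y := by
  obtain ⟨δ, hδ, hZ⟩ : ∃ δ > 0, ∀ y ∈ tsupport χ, F y = 0 → R y < -δ := by
    have hcpt : IsCompact (tsupport χ ∩ {y | F y = 0}) :=
      hχs.isCompact.inter_right (isClosed_eq hF.continuous continuous_const)
    have hneg : ∀ y ∈ tsupport χ ∩ {y | F y = 0}, R y < 0 := fun y hy => by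
      by_contra h
      exact hFne y hy.1 (not_lt.1 h) hy.2
    have : ∀ᶠ δ in 𝓝 (0 : ℝ), ∀ y ∈ tsupport χ ∩ {y | F y = 0}, R y < -δ := by
      refine hcpt.eventually_forall_of_forall_eventually fun y hy => ?_
      exact ContinuousAt.eventually_lt (f := fun z : ℝ × (Fin 4 → ℝ) => R z.2)
        (g := fun z : ℝ × (Fin 4 → ℝ) => -z.1) (hR.continuous.comp continuous_snd).continuousAt
        continuous_fst.neg.continuousAt (by simpa using hneg y hy)
    obtain ⟨δ, h1, h2⟩ := ((this.filter_mono (nhdsWithin_le_nhds (s := Ioi 0))).and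
      self_mem_nhdsWithin).exists
    exact ⟨δ, h2, fun y hy hy0 => h1 y ⟨hy, hy0⟩⟩
  -- the cutoff is `1` on `{R ≥ 0}` and `0` near the zeros of `F` in the support of `χ`
  set η : (Fin 4 → ℝ) → ℝ := fun y => Real.smoothTransition (1 + R y / δ) with hη
  have hηs : ContDiff ℝ ∞ η :=
    Real.smoothTransition.contDiff.comp (contDiff_const.add (hR.div_const δ))
  refine ⟨fun y => ((η y * χ y : ℝ) : ℂ) / F y, ?_, ?_, ?_⟩
  · rw [contDiff_iff_contDiffAt]
    intro y
    by_cases hy : F y = 0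
    · have hzero : (fun y => ((η y * χ y : ℝ) : ℂ) / F y) =ᶠ[𝓝 y] fun _ => 0 := by
        by_cases hyχ : y ∈ tsupport χ
        · have h1 : ∀ᶠ z in 𝓝 y, R z < -δ :=
            (hR.continuous.tendsto y).eventually_lt_const (hZ y hyχ hy)
          filter_upwards [h1] with z hz
          have : η z = 0 := by
            refine Real.smoothTransition.zero_of_nonpos ?_
            have : R z / δ ≤ -1 := by rw [div_le_iff₀ hδ]; linarith
            linarith
          simp [this]
        · filter_upwards [(isClosed_tsupport χ).isOpen_compl.mem_nhds hyχ] with z hz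
          have : χ z = 0 := image_eq_zero_of_notMem_tsupport hz
          simp [this]
      exact contDiffAt_const.congr_of_eventuallyEq hzero
    · simp only [div_eq_mul_inv]
      exact (Complex.ofRealCLM.contDiff.comp (hηs.mul hχ)).contDiffAt.mul
        (hF.contDiffAt.inv hy)
  · refine closure_mono fun y hy => ?_
    intro h0
    refine hy ?_
    have : χ y = 0 := h0
    simp [this]
  · intro y hy
    have : η y = 1 := by
      refine Real.smoothTransition.one_of_one_le ?_
      have : 0 ≤ R y / δ := div_nonneg hy hδ.le
      linarith
    simp [this]

theorem det_rows_four_eq_zero_of_smul {A : Type*} [CommRing A] (b c d : Fin 4 → A) (x : A) :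
    Matrix.det (Matrix.of ![fun i => x * d i, b, c, d]) = 0 := by
  simp only [det_rows_four]
  ring

/-- The vanishing of the integral of the exact form
`d (β(R/ε) φ(Re f/ε) φ(Im f/ε) G) ∧ d Re f ∧ d Im f ∧ d F`, where `G = χ / F` on `{R ≥ 0}`. Only the
derivative of `β(R/ε)` contributes: the differentials of the next two factors are multiples of
`d Re f` and `d Im f`, and `dG ∧ dF = 0` where `χ` or `F` is locally constant. -/
theorem integral_exact_form_eq_zero {R χ : (Fin 4 → ℝ) → ℝ} {β φ : ℝ → ℝ}
    {f F G : (Fin 4 → ℝ) → ℂ} (hR : ContDiff ℝ ∞ R) (hf : ContDiff ℝ ∞ f) (hF : ContDiff ℝ ∞ F)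
    (hχ : ContDiff ℝ ∞ χ) (hχs : HasCompactSupport χ)
    (hG : ContDiff ℝ ∞ G) (hGs : tsupport G ⊆ tsupport χ)
    (hGF : ∀ y, 0 ≤ R y → G y = χ y / F y) (hFne : ∀ y ∈ tsupport χ, 0 ≤ R y → F y ≠ 0)
    (hβ : ContDiff ℝ ∞ β) (hβ0 : ∀ s ≤ 0, β s = 0) (hφ : ContDiff ℝ ∞ φ)
    {ε : ℝ} (hε : 0 < ε)
    (hlocal : ∀ y, 0 < R y → φ (ε⁻¹ * (f y).re) ≠ 0 → φ (ε⁻¹ * (f y).im) ≠ 0 →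
      fderiv ℝ χ y = 0 ∨ fderiv ℝ F y = 0) :
    ∫ y, ((deriv β (ε⁻¹ * R y) * (φ (ε⁻¹ * (f y).re) * φ (ε⁻¹ * (f y).im)) : ℝ) : ℂ) *
      (G y * Matrix.det (Matrix.of ![pderivAt (fun y => (R y : ℂ)) y,
        pderivAt (fun y => ((f y).re : ℂ)) y, pderivAt (fun y => ((f y).im : ℂ)) y,
        pderivAt F y])) = 0 := by
  have hr := contDiff_re hf
  have hi := contDiff_im hf
  have hofReal : ∀ {g : (Fin 4 → ℝ) → ℝ}, ContDiff ℝ ∞ g → ContDiff ℝ ∞ fun y => (g y : ℂ) :=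
    fun hg => Complex.ofRealCLM.contDiff.comp hg
  set b : (Fin 4 → ℝ) → ℝ := fun y => β (ε⁻¹ * R y) with hb
  set p : (Fin 4 → ℝ) → ℝ := fun y => φ (ε⁻¹ * (f y).re) with hp
  set q : (Fin 4 → ℝ) → ℝ := fun y => φ (ε⁻¹ * (f y).im) with hq
  have hbs : ContDiff ℝ ∞ b := hβ.comp (contDiff_const.mul hR)
  have hps : ContDiff ℝ ∞ p := hφ.comp (contDiff_const.mul hr)
  have hqs : ContDiff ℝ ∞ q := hφ.comp (contDiff_const.mul hi)
  set u : (Fin 4 → ℝ) → ℂ := fun y => (b y : ℂ) * ((p y : ℂ) * ((q y : ℂ) * G y)) with hu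
  have hus : ContDiff ℝ ∞ u :=
    (hofReal hbs).mul ((hofReal hps).mul ((hofReal hqs).mul hG))
  have hGc : HasCompactSupport G := hχs.mono' (subset_closure.trans hGs)
  have huc : HasCompactSupport u := by
    refine hGc.mono fun y hy h0 => hy ?_
    simp [hu, h0]
  have hchain : ∀ {ψ : ℝ → ℝ} {g : (Fin 4 → ℝ) → ℝ}, ContDiff ℝ ∞ ψ → ContDiff ℝ ∞ g →
      ∀ y i, pderivAt (fun y => ((ψ (ε⁻¹ * g y) : ℝ) : ℂ)) y i =
        ((ε⁻¹ * deriv ψ (ε⁻¹ * g y) : ℝ) : ℂ) * pderivAt (fun y => (g y : ℂ)) y i := by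
    intro ψ g hψ hg y i
    rw [pderivAt_ofReal_comp (g := fun y => ψ (ε⁻¹ * g y)) (hψ.comp (contDiff_const.mul hg)),
      pderivAt_ofReal_comp hg]
    have h1 : HasFDerivAt (fun y => ψ (ε⁻¹ * g y))
        (deriv ψ (ε⁻¹ * g y) • (ε⁻¹ • fderiv ℝ g y)) y :=
      ((hψ.differentiable (by simp) _).hasDerivAt).comp_hasFDerivAt y
        ((hg.differentiable (by simp) y).hasFDerivAt.const_mul ε⁻¹)
    unfold pderivAt
    rw [h1.fderiv]
    simp only [smul_apply, smul_eq_mul]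
    push_cast
    ring
  have key := integral_det_pderivAt_eq_zero hus huc (hofReal hr) (hofReal hi) hF
  have hpu : ∀ y, pderivAt u y = fun i =>
      (((ε⁻¹ * deriv β (ε⁻¹ * R y) : ℝ) : ℂ) * (p y * q y * G y)) *
        pderivAt (fun y => (R y : ℂ)) y i +
      (((ε⁻¹ * deriv φ (ε⁻¹ * (f y).re) : ℝ) : ℂ) * (b y * q y * G y)) *
        pderivAt (fun y => ((f y).re : ℂ)) y i +
      (((ε⁻¹ * deriv φ (ε⁻¹ * (f y).im) : ℝ) : ℂ) * (b y * p y * G y)) *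
        pderivAt (fun y => ((f y).im : ℂ)) y i +
      (b y * p y * q y : ℂ) * pderivAt G y i := by
    intro y
    funext i
    rw [hu, pderivAt_mul (hofReal hbs) ((hofReal hps).mul ((hofReal hqs).mul hG)),
      pderivAt_mul (hofReal hps) ((hofReal hqs).mul hG), pderivAt_mul (hofReal hqs) hG,
      hchain hβ hR, hchain hφ hr, hchain hφ hi]
    ring
  -- `dG` is a multiple of `dF` where the cutoffs do not vanish
  have hlast : ∀ y, Matrix.det (Matrix.of ![fun i => (b y * p y * q y : ℂ) * pderivAt G y i,
      pderivAt (fun y => ((f y).re : ℂ)) y, pderivAt (fun y => ((f y).im : ℂ)) y,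
        pderivAt F y]) = 0 := by
    intro y
    have hzero : (b y * p y * q y : ℂ) = 0 → Matrix.det (Matrix.of
      ![fun i => (b y * p y * q y : ℂ) * pderivAt G y i,
      pderivAt (fun y => ((f y).re : ℂ)) y, pderivAt (fun y => ((f y).im : ℂ)) y,
        pderivAt F y]) = 0 := fun h => by
      refine Matrix.det_eq_zero_of_row_eq_zero 0 fun j => ?_
      simp [h]
    by_cases hRy : 0 < R y
    swap
    · refine hzero ?_
      have : b y = 0 := hβ0 _ (mul_nonpos_of_nonneg_of_nonpos (by positivity) (not_lt.1 hRy))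
      simp [this]
    by_cases hpy : p y = 0
    · exact hzero (by simp [hpy])
    by_cases hqy : q y = 0
    · exact hzero (by simp [hqy])
    rcases hlocal y hRy hpy hqy with h | h
    · by_cases hyχ : y ∈ tsupport χ
      · have hFy := hFne y hyχ hRy.le
        have hev : (fun y => G y * F y) =ᶠ[𝓝 y] fun y => (χ y : ℂ) := by
          filter_upwards [hR.continuous.continuousAt.eventually (lt_mem_nhds hRy),
            hF.continuous.continuousAt.eventually_ne hFy] with z hz1 hz2
          rw [hGF z (le_of_lt hz1), div_mul_cancel₀ _ hz2]
        have hd : ∀ i, G y * pderivAt F y i + pderivAt G y i * F y = 0 := by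
          intro i
          rw [← pderivAt_mul hG hF]
          have : pderivAt (fun y => G y * F y) y i = pderivAt (fun y => (χ y : ℂ)) y i := by
            unfold pderivAt; rw [hev.fderiv_eq]
          rw [this, pderivAt_ofReal_comp hχ]
          simp [pderivAt, h]
        have : (fun i => (b y * p y * q y : ℂ) * pderivAt G y i) =
            fun i => (-(b y * p y * q y * G y / F y) : ℂ) * pderivAt F y i := by
          funext i
          have h1 : pderivAt G y i = -(G y * pderivAt F y i) / F y := by
            rw [eq_div_iff hFy]; linear_combination hd i
          rw [h1]; ring
        rw [this]
        exact det_rows_four_eq_zero_of_smul _ _ _ _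
      · have : fderiv ℝ G y = 0 := by
          have : G =ᶠ[𝓝 y] fun _ => 0 := by
            filter_upwards [(isClosed_tsupport χ).isOpen_compl.mem_nhds hyχ] with z hz
            exact image_eq_zero_of_notMem_tsupport fun h => hz (hGs h)
          rw [this.fderiv_eq]; simp
        refine Matrix.det_eq_zero_of_row_eq_zero 0 fun j => ?_
        simp [pderivAt, this]
    · refine Matrix.det_eq_zero_of_row_eq_zero 3 fun j => ?_
      simp [pderivAt, h]
  have hcongr : ∀ y, Matrix.det (Matrix.of ![pderivAt u y,
      pderivAt (fun y => ((f y).re : ℂ)) y, pderivAt (fun y => ((f y).im : ℂ)) y,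
        pderivAt F y]) = (ε : ℂ)⁻¹ *
      (((deriv β (ε⁻¹ * R y) * (φ (ε⁻¹ * (f y).re) * φ (ε⁻¹ * (f y).im)) : ℝ) : ℂ) *
      (G y * Matrix.det (Matrix.of ![pderivAt (fun y => (R y : ℂ)) y,
        pderivAt (fun y => ((f y).re : ℂ)) y, pderivAt (fun y => ((f y).im : ℂ)) y,
        pderivAt F y]))) := by
    intro y
    rw [hpu, det_rows_eq_of_combination, hlast, add_zero]
    simp only [hp, hq]
    push_cast
    ring
  simp_rw [hcongr] at key
  rw [integral_const_mul] at key
  refine (mul_eq_zero.1 key).resolve_left ?_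
  exact inv_ne_zero (by exact_mod_cast hε.ne')

/-- Let `c` be the disjoint closed curves that form the intersection of `{f = 0}` with `{R = 0}`
inside the support of `χ`, oriented in a coherent way. If `F` has no zeros and `χ` is locally
constant near `{f = 0}` in the support of `χ` and in `{R ≥ 0}`, except where `F` is locally
constant, then the total logarithmic variation of `F` along the curves is zero: it is the integral
of the closed form `d log F` over the boundary of the surface `{f = 0, R ≥ 0}`. -/
theorem sum_integral_logDeriv_eq_zero {κ : Type*} [Fintype κ] {R χ : (Fin 4 → ℝ) → ℝ}
    {f F : (Fin 4 → ℝ) → ℂ} (hR : ContDiff ℝ ∞ R) (hf : ContDiff ℝ ∞ f) (hF : ContDiff ℝ ∞ F)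
    (hχ : ContDiff ℝ ∞ χ) (hχs : HasCompactSupport χ) {c : κ → ℝ → Fin 4 → ℝ}
    (hc : ∀ j, ContDiff ℝ ∞ (c j)) (hcp : ∀ j, Function.Periodic (c j) 1)
    (hreg : ∀ j t, deriv (c j) t ≠ 0)
    (hemb : ∀ i j, ∀ s ∈ Ico (0 : ℝ) 1, ∀ t ∈ Ico (0 : ℝ) 1, c i s = c j t → i = j ∧ s = t)
    (hRc : ∀ j t, R (c j t) = 0) (hfc : ∀ j t, f (c j t) = 0)
    (hor : ∀ j t, ∃ ν a b, 0 < fderiv ℝ R (c j t) ν ∧ fderiv ℝ f (c j t) ν = 0 ∧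
      fderiv ℝ f (c j t) a = 1 ∧ fderiv ℝ f (c j t) b = Complex.I ∧
      0 < Matrix.det (Matrix.of ![ν, deriv (c j) t, a, b]))
    (hχc : ∀ j t, χ (c j t) = 1)
    (hcover : ∀ y ∈ tsupport χ, R y = 0 → f y = 0 → ∃ j t, c j t = y)
    (hFne : ∀ y ∈ tsupport χ, 0 ≤ R y → F y ≠ 0)
    (hlocal : ∃ ε₀ > 0, ∀ y, 0 ≤ R y → ‖f y‖ ≤ ε₀ → fderiv ℝ χ y = 0 ∨ fderiv ℝ F y = 0) :
    ∑ j, ∫ t in (0 : ℝ)..1, deriv (fun t => F (c j t)) t / F (c j t) = 0 := by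
  obtain ⟨G, hG, hGs, hGF⟩ := exists_contDiff_quotient hR hF hχ hχs hFne
  have hRτ : ∀ j t, fderiv ℝ R (c j t) (deriv (c j) t) = 0 := fun j t => by
    have h1 : HasDerivAt (R ∘ c j) _ t := ((hR.differentiable (by simp) _).hasFDerivAt
      (x := c j t)).comp_hasDerivAt t ((hc j).differentiable (by simp) t).hasDerivAt
    rw [show R ∘ c j = fun _ => 0 from funext (hRc j)] at h1
    exact h1.unique (hasDerivAt_const t 0)
  have hfτ : ∀ j t, fderiv ℝ f (c j t) (deriv (c j) t) = 0 := fun j t => by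
    have h1 : HasDerivAt (f ∘ c j) _ t := ((hf.differentiable (by simp) _).hasFDerivAt
      (x := c j t)).comp_hasDerivAt t ((hc j).differentiable (by simp) t).hasDerivAt
    rw [show f ∘ c j = fun _ => 0 from funext (hfc j)] at h1
    exact h1.unique (hasDerivAt_const t 0)
  have hdet : ∀ j t, 0 < (gradMatrix R f (c j t) (deriv (c j) t)).det := fun j t => by
    obtain ⟨ν, a, b, h1, h2, h3, h4, h5⟩ := hor j t
    exact det_gradMatrix_pos hf (hreg j t) (hRτ j t) (hfτ j t) h1 h2 h3 h4 h5
  have hframe : ∀ j, IsNormalFrame (definingMap R f) (c j) (dualFrame R f (c j)) := fun j =>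
    isNormalFrame_dualFrame hR hf (hc j) (hcp j) (hreg j) (hRc j) (hfc j) fun t => (hdet j t).ne'
  have hΨ := contDiff_definingMap hR hf
  -- a mass supported in `s > 0` in the first coordinate
  set β : ℝ → ℝ := Real.smoothTransition with hβdef
  have hβ : ContDiff ℝ ∞ β := Real.smoothTransition.contDiff
  have hβ0 : ∀ s ≤ 0, β s = 0 := fun s hs => Real.smoothTransition.zero_of_nonpos hs
  have hβ1 : ∀ s, 1 ≤ s → β s = 1 := fun s hs => Real.smoothTransition.one_of_one_le hs
  have hβ'c : Continuous (deriv β) := hβ.continuous_deriv (by simp)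
  have hβ's : HasCompactSupport (deriv β) := by
    refine HasCompactSupport.intro (isCompact_Icc (a := (0 : ℝ)) (b := 1)) fun s hs => ?_
    rcases not_and_or.1 hs with h | h
    · have : β =ᶠ[𝓝 s] fun _ => 0 := by
        filter_upwards [gt_mem_nhds (not_le.1 h)] with z hz using hβ0 z (le_of_lt hz)
      rw [this.deriv_eq]; simp
    · have : β =ᶠ[𝓝 s] fun _ => 1 := by
        filter_upwards [lt_mem_nhds (not_le.1 h)] with z hz using hβ1 z (le_of_lt hz)
      rw [this.deriv_eq]; simp
  let φb : ContDiffBump (0 : ℝ) := ⟨1, 2, by norm_num, by norm_num⟩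
  set φ : ℝ → ℝ := fun x => φb x with hφdef
  have hφ : ContDiff ℝ ∞ φ := φb.contDiff
  have hφs : HasCompactSupport φ := φb.hasCompactSupport
  set B : (Fin 3 → ℝ) → ℝ := fun b => deriv β (b 0) * (φ (b 1) * φ (b 2)) with hB
  have hBc : Continuous B :=
    (hβ'c.comp (continuous_apply 0)).mul ((hφ.continuous.comp (continuous_apply 1)).mul
      (hφ.continuous.comp (continuous_apply 2)))
  have hBs : HasCompactSupport B := by
    refine HasCompactSupport.intro (isCompact_univ_pi (s := ![tsupport (deriv β), tsupport φ,
      tsupport φ]) fun i => ?_) fun b hb => ?_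
    · fin_cases i
      · exact hβ's
      · exact hφs
      · exact hφs
    · by_contra h0
      refine hb fun i _ => ?_
      have h1 : deriv β (b 0) ≠ 0 := fun h => h0 (by simp [hB, h])
      have h2 : φ (b 1) ≠ 0 := fun h => h0 (by simp [hB, h])
      have h3 : φ (b 2) ≠ 0 := fun h => h0 (by simp [hB, h])
      fin_cases i
      · exact subset_tsupport _ h1
      · exact subset_tsupport _ h2
      · exact subset_tsupport _ h3
  have hBint : ∫ b, B b ≠ 0 := by
    have hmono : Monotone β := Real.smoothTransition.monotone
    obtain ⟨s, hs, hs'⟩ := exists_deriv_eq_slope β zero_lt_one hβ.continuous.continuousOn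
      (hβ.differentiable (by simp)).differentiableOn
    have hs1 : deriv β s ≠ 0 := by
      rw [hs', hβ1 1 le_rfl, hβ0 0 le_rfl]; norm_num
    have hφ0 : φ 0 ≠ 0 := (φb.pos_of_mem_ball (by simp [φb])).ne'
    refine ((hBc.integral_pos_of_hasCompactSupport_nonneg_nonzero hBs (x := ![s, 0, 0])
      (fun b => ?_) ?_)).ne'
    · exact mul_nonneg (hmono.deriv_nonneg) (mul_nonneg φb.nonneg φb.nonneg)
    · simp [hB, hs1, hφ0]
  -- the form `d R ∧ d Re f ∧ d Im f ∧ d F`, multiplied by `χ / F`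
  set H : (Fin 4 → ℝ) → ℂ := fun y => G y * Matrix.det (Matrix.of
    ![pderivAt (fun y => (R y : ℂ)) y, pderivAt (fun y => ((f y).re : ℂ)) y,
      pderivAt (fun y => ((f y).im : ℂ)) y, pderivAt F y]) with hH
  have hHc : Continuous H := by
    have hofReal : ∀ {g : (Fin 4 → ℝ) → ℝ}, ContDiff ℝ ∞ g → ContDiff ℝ ∞ fun y => (g y : ℂ) :=
      fun hg => Complex.ofRealCLM.contDiff.comp hg
    have h1 : ∀ i, Continuous fun y => pderivAt (fun y => (R y : ℂ)) y i := fun i =>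
      (contDiff_pderivAt (hofReal hR) i).continuous
    have h2 : ∀ i, Continuous fun y => pderivAt (fun y => ((f y).re : ℂ)) y i := fun i =>
      (contDiff_pderivAt (hofReal (contDiff_re hf)) i).continuous
    have h3 : ∀ i, Continuous fun y => pderivAt (fun y => ((f y).im : ℂ)) y i := fun i =>
      (contDiff_pderivAt (hofReal (contDiff_im hf)) i).continuous
    have h4 : ∀ i, Continuous fun y => pderivAt F y i := fun i =>
      (contDiff_pderivAt hF i).continuous
    refine hG.continuous.mul (Continuous.matrix_det (continuous_matrix fun i j => ?_))
    fin_cases i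
    · exact h1 j
    · exact h2 j
    · exact h3 j
    · exact h4 j
  have hHG : tsupport H ⊆ tsupport χ := by
    have h1 : Function.support H ⊆ Function.support G := fun y hy h0 => hy (by simp [hH, h0])
    exact (closure_mono h1).trans hGs
  have hHs : HasCompactSupport H := hχs.mono' (subset_closure.trans hHG)
  have hlim := tendsto_integral_comp_smul hΨ hframe hemb hBc hBs hHc hHs fun y hy hy0 => by
    have h0 := congrFun hy0 0
    have h1 := congrFun hy0 1
    have h2 := congrFun hy0 2
    exact hcover y (hHG hy) h0 (Complex.ext h1 h2)
  have hzero : ∀ᶠ ε : ℝ in 𝓝[>] 0,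
      (((ε : ℂ) ^ 3)⁻¹ : ℂ) * ∫ y, (B (ε⁻¹ • definingMap R f y) : ℂ) * H y = 0 := by
    obtain ⟨ε₀, hε₀, hloc⟩ := hlocal
    filter_upwards [Ioo_mem_nhdsGT (show (0 : ℝ) < ε₀ / 4 by positivity)] with ε hε
    refine mul_eq_zero_of_right _ ?_
    have hsmall : ∀ x : ℝ, φ (ε⁻¹ * x) ≠ 0 → |x| ≤ ε₀ / 2 := fun x hx => by
      have h1 : ε⁻¹ * x ∈ Metric.ball (0 : ℝ) 2 := by
        have : ε⁻¹ * x ∈ Function.support φ := hx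
        rwa [hφdef, φb.support_eq] at this
      rw [mem_ball_zero_iff, Real.norm_eq_abs, abs_mul, abs_inv, abs_of_pos hε.1,
        inv_mul_lt_iff₀ hε.1] at h1
      linarith [hε.2]
    exact integral_exact_form_eq_zero hR hf hF hχ hχs hG hGs hGF hFne hβ hβ0 hφ hε.1
      fun y hy h1 h2 => hloc y hy.le <| by
        have := Complex.norm_le_abs_re_add_abs_im (f y)
        linarith [hsmall _ h1, hsmall _ h2]
  have hlim0 := tendsto_nhds_unique hlim (tendsto_const_nhds.congr' (EventuallyEq.symm hzero))
  rw [← Finset.mul_sum] at hlim0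
  have hsum := (mul_eq_zero.1 hlim0).resolve_left (by exact_mod_cast hBint)
  rw [← hsum]
  refine Finset.sum_congr rfl fun j _ => ?_
  refine intervalIntegral.integral_congr fun t _ => ?_
  simp only [hH]
  rw [mul_left_comm, det_dualFrame_mul hR hf (hRτ j t) (hfτ j t) (hreg j t) (hdet j t),
    hGF _ (hRc j t).ge, hχc]
  have h1 : HasDerivAt (fun t => F (c j t)) _ t := ((hF.differentiable (by simp) _).hasFDerivAt
      (x := c j t)).comp_hasDerivAt t ((hc j).differentiable (by simp) t).hasDerivAt
  rw [h1.deriv]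
  push_cast
  ring

/-! ### Sections of families of idempotents -/

section
variable {E : Type*} [NormedAddCommGroup E] [NormedSpace ℝ E]
  {H : Type*} [NormedAddCommGroup H] [NormedSpace ℂ H]

theorem norm_add_smul_sub_sub (p y : E) {τ : ℝ} (hτ : 0 ≤ τ) :
    ‖p + τ • (y - p) - p‖ = τ * ‖y - p‖ := by
  rw [add_sub_cancel_left, norm_smul, Real.norm_of_nonneg hτ]

variable [FiniteDimensional ℝ E]

/-- A family of idempotents on the complement of a point which is constant far away has a
continuous nonvanishing section. The section is transported from infinity along rays; a short step
of the transport is the application of the idempotent at the new point, which is injective on the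
range of a nearby idempotent. -/
theorem exists_continuousOn_apply_ne_zero {p : E} {Q : E → H →L[ℂ] H}
    (hQ : ContinuousOn Q {p}ᶜ) (hidem : ∀ y ≠ p, ∀ u, Q y (Q y u) = Q y u) {R₀ δ : ℝ}
    (hδ : 0 < δ) {Q₀ : H →L[ℂ] H} (hfar : ∀ y, R₀ ≤ ‖y - p‖ → Q y = Q₀) {v : H} (hv : v ≠ 0)
    (hQv : Q₀ v = v) :
    ∃ w : E → H, ContinuousOn w {p}ᶜ ∧ (∃ R₁, ∀ y, R₁ ≤ ‖y - p‖ → w y = v) ∧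
      ∀ y, δ ≤ ‖y - p‖ → Q y (w y) ≠ 0 := by
  have hTcont : Continuous fun z : ℝ × E => p + z.1 • (z.2 - p) := by fun_prop
  obtain ⟨τ, hτ1, hτ⟩ : ∃ τ : ℝ, 1 < τ ∧
      ∀ y, δ ≤ ‖y - p‖ → ‖Q y - Q (p + τ • (y - p))‖ < 1 := by
    set K : Set E := {y | δ ≤ ‖y - p‖ ∧ ‖y - p‖ ≤ R₀} with hK
    have hKc : IsCompact K := by
      refine Metric.isCompact_of_isClosed_isBounded ?_ ?_
      · exact (isClosed_le continuous_const (continuous_id.sub continuous_const).norm).inter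
          (isClosed_le (continuous_id.sub continuous_const).norm continuous_const)
      · refine (Metric.isBounded_closedBall (x := p) (r := R₀)).subset fun y hy => ?_
        rw [mem_closedBall_iff_norm]; exact hy.2
    have hev : ∀ᶠ τ in 𝓝 (1 : ℝ), ∀ y ∈ K, ‖Q y - Q (p + τ • (y - p))‖ < 1 := by
      refine hKc.eventually_forall_of_forall_eventually fun y hy => ?_
      have hyp : y ≠ p := fun h => by
        have := hy.1
        rw [h, sub_self, norm_zero] at this
        linarith
      have hc : ContinuousAt Q y := hQ.continuousAt (isOpen_compl_singleton.mem_nhds hyp)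
      have h1 : ContinuousAt (fun z : ℝ × E => Q z.2) (1, y) :=
        ContinuousAt.comp (x := ((1 : ℝ), y)) (f := Prod.snd) hc continuous_snd.continuousAt
      have h2 : ContinuousAt (fun z : ℝ × E => Q (p + z.1 • (z.2 - p))) (1, y) := by
        refine ContinuousAt.comp (x := ((1 : ℝ), y)) (g := Q)
          (f := fun z : ℝ × E => p + z.1 • (z.2 - p)) ?_ hTcont.continuousAt
        simpa using hc
      refine (h1.sub h2).norm.eventually_lt continuousAt_const ?_
      simp
    obtain ⟨τ, h1, h2⟩ := ((hev.filter_mono (nhdsWithin_le_nhds (s := Ioi 1))).and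
      self_mem_nhdsWithin).exists
    refine ⟨τ, h2, fun y hy => ?_⟩
    by_cases hyR : ‖y - p‖ ≤ R₀
    · exact h1 y ⟨hy, hyR⟩
    · have hτ0 : (1 : ℝ) < τ := h2
      have hlt : R₀ < ‖y - p‖ := not_le.1 hyR
      rw [hfar y hlt.le, hfar (p + τ • (y - p)), sub_self, norm_zero]
      · exact one_pos
      · rw [norm_add_smul_sub_sub _ _ (by linarith)]
        nlinarith [norm_nonneg (y - p)]
  have hτ0 : 0 < τ := by linarith
  have hmaps : ∀ y ∈ ({p}ᶜ : Set E), p + τ • (y - p) ∈ ({p}ᶜ : Set E) := fun y hy h => by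
    have h1 : τ • (y - p) = 0 := by simpa using h
    exact hy (sub_eq_zero.1 ((smul_eq_zero.1 h1).resolve_left hτ0.ne'))
  have hT : ContinuousOn (fun y => p + τ • (y - p)) {p}ᶜ := by fun_prop
  -- `m` transport steps give a section that does not vanish at distance at least `R₀ / τ ^ m`
  have step : ∀ m : ℕ, ∃ w : E → H, ContinuousOn w {p}ᶜ ∧ (∃ R₁, ∀ y, R₁ ≤ ‖y - p‖ → w y = v) ∧
      ∀ y, δ ≤ ‖y - p‖ → R₀ ≤ τ ^ m * ‖y - p‖ → Q y (w y) ≠ 0 := by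
    intro m
    induction m with
    | zero =>
      refine ⟨fun _ => v, continuousOn_const, ⟨0, fun _ _ => rfl⟩, fun y _ hy => ?_⟩
      rw [pow_zero, one_mul] at hy
      rw [hfar y hy, hQv]
      exact hv
    | succ m ih =>
      obtain ⟨w, hw, ⟨R₁, hR₁⟩, hne⟩ := ih
      refine ⟨fun y => Q (p + τ • (y - p)) (w (p + τ • (y - p))), ?_, ?_, ?_⟩
      · exact (hQ.comp hT hmaps).clm_apply (hw.comp hT hmaps)
      · refine ⟨max (max R₀ R₁) 0, fun y hy => ?_⟩
        have h0 : 0 ≤ ‖y - p‖ := norm_nonneg _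
        have h1 : ‖y - p‖ ≤ τ * ‖y - p‖ := by nlinarith
        have h2 : R₀ ≤ ‖p + τ • (y - p) - p‖ := by
          rw [norm_add_smul_sub_sub _ _ hτ0.le]
          exact ((le_max_left _ _).trans (le_max_left _ _)).trans (hy.trans h1)
        have h3 : R₁ ≤ ‖p + τ • (y - p) - p‖ := by
          rw [norm_add_smul_sub_sub _ _ hτ0.le]
          exact ((le_max_right _ _).trans (le_max_left _ _)).trans (hy.trans h1)
        simp only [hfar _ h2, hR₁ _ h3, hQv]
      · intro y hy hym h0
        have hyp : y ≠ p := fun h => by rw [h, sub_self, norm_zero] at hy; linarith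
        have h1 : ‖y - p‖ ≤ τ * ‖y - p‖ := by nlinarith [norm_nonneg (y - p)]
        set z := p + τ • (y - p) with hz
        set u := Q z (w z) with hu
        have hune : u ≠ 0 := by
          refine hne z ?_ ?_
          · rw [hz, norm_add_smul_sub_sub _ _ hτ0.le]; exact hy.trans h1
          · rw [hz, norm_add_smul_sub_sub _ _ hτ0.le]
            calc R₀ ≤ τ ^ (m + 1) * ‖y - p‖ := hym
              _ = τ ^ m * (τ * ‖y - p‖) := by ring
        have hzu : Q z u = u := hidem z (hmaps y hyp) _
        have h2 : ‖u‖ ≤ ‖Q y - Q z‖ * ‖u‖ := by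
          calc ‖u‖ = ‖(Q y - Q z) u‖ := by
                rw [sub_apply, hzu, h0, zero_sub, norm_neg]
            _ ≤ _ := ContinuousLinearMap.le_opNorm _ _
        have h3 := hτ y hy
        nlinarith [norm_pos_iff.2 hune]
  obtain ⟨m, hm⟩ := pow_unbounded_of_one_lt (R₀ / δ) hτ1
  obtain ⟨w, hw, hR, hne⟩ := step m
  refine ⟨w, hw, hR, fun y hy => hne y hy ?_⟩
  rw [div_lt_iff₀ hδ] at hm
  exact hm.le.trans (by gcongr)

/-- A smooth version of `exists_continuousOn_apply_ne_zero`, on a closed set that does not contain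
a neighbourhood of the point. -/
theorem exists_contDiff_apply_ne_zero {p : E} {Q : E → H →L[ℂ] H}
    (hQ : ContinuousOn Q {p}ᶜ) (hidem : ∀ y ≠ p, ∀ u, Q y (Q y u) = Q y u) {R₀ δ : ℝ}
    (hδ : 0 < δ) {Q₀ : H →L[ℂ] H} (hfar : ∀ y, R₀ ≤ ‖y - p‖ → Q y = Q₀) {v : H} (hv : v ≠ 0)
    (hQv : Q₀ v = v) {M : Set E} (hM : IsClosed M) (hMδ : ∀ y ∈ M, δ ≤ ‖y - p‖) :
    ∃ w : E → H, ContDiff ℝ ∞ w ∧ (∃ R₁, ∀ y, R₁ < ‖y - p‖ → w y = v) ∧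
      ∀ y ∈ M, Q y (w y) ≠ 0 := by
  obtain ⟨w₀, hw₀, ⟨R₁, hR₁⟩, hne⟩ := exists_continuousOn_apply_ne_zero hQ hidem hδ hfar hv hQv
  have hMne : ∀ y ∈ M, y ≠ p := fun y hy h => by
    have := hMδ y hy
    rw [h, sub_self, norm_zero] at this
    linarith
  -- the condition on the values is convex and locally solvable by constants, so that a partition of
  -- unity gives a smooth solution
  set t : E → Set H := fun y => {u | (y ∈ M → u ∈ Q y ⁻¹' Metric.ball (Q y (w₀ y)) ‖Q y (w₀ y)‖) ∧
    (R₁ < ‖y - p‖ → u = v)} with ht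
  have hconv : ∀ y, Convex ℝ (t y) := by
    intro y
    have h1 : Convex ℝ {u : H | y ∈ M → u ∈ Q y ⁻¹' Metric.ball (Q y (w₀ y)) ‖Q y (w₀ y)‖} := by
      by_cases hy : y ∈ M
      · simp only [hy, true_imp_iff]
        exact (convex_ball _ _).linear_preimage ((Q y).toLinearMap.restrictScalars ℝ)
      · simp only [hy, false_imp_iff]
        exact convex_univ
    have h2 : Convex ℝ {u : H | R₁ < ‖y - p‖ → u = v} := by
      by_cases hy : R₁ < ‖y - p‖
      · simp only [hy, true_imp_iff]
        exact convex_singleton v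
      · simp only [hy, false_imp_iff]
        exact convex_univ
    exact h1.inter h2
  have hloc : ∀ y, ∃ u : H, ∀ᶠ z in 𝓝 y, u ∈ t z := by
    intro y
    have hgood : y ∈ M → ∀ᶠ z in 𝓝 y, z ∈ M →
        w₀ y ∈ Q z ⁻¹' Metric.ball (Q z (w₀ z)) ‖Q z (w₀ z)‖ := by
      intro hy
      have hnh : ({p}ᶜ : Set E) ∈ 𝓝 y := isOpen_compl_singleton.mem_nhds (hMne y hy)
      have hcQ : ContinuousAt Q y := hQ.continuousAt hnh
      have hcw : ContinuousAt w₀ y := hw₀.continuousAt hnh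
      have h1 : ContinuousAt (fun z => ‖Q z (w₀ y) - Q z (w₀ z)‖) y :=
        ((hcQ.clm_apply continuousAt_const).sub (hcQ.clm_apply hcw)).norm
      have h2 : ContinuousAt (fun z => ‖Q z (w₀ z)‖) y := (hcQ.clm_apply hcw).norm
      filter_upwards [h1.eventually_lt h2
        (by simpa using hne y (hMδ y hy))] with z hz _
      rw [mem_preimage, mem_ball_iff_norm]
      exact hz
    by_cases hyR : R₁ ≤ ‖y - p‖
    · refine ⟨v, ?_⟩
      by_cases hy : y ∈ M
      · filter_upwards [hgood hy] with z hz
        rw [hR₁ y hyR] at hz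
        exact ⟨hz, fun _ => rfl⟩
      · filter_upwards [hM.isOpen_compl.mem_nhds hy] with z hz
        exact ⟨fun h => absurd h hz, fun _ => rfl⟩
    · have hnear : ∀ᶠ z in 𝓝 y, ‖z - p‖ < R₁ :=
        (show ContinuousAt (fun z => ‖z - p‖) y by fun_prop).eventually_lt continuousAt_const
          (not_le.1 hyR)
      by_cases hy : y ∈ M
      · refine ⟨w₀ y, ?_⟩
        filter_upwards [hgood hy, hnear] with z hz hz'
        exact ⟨hz, fun h => absurd h hz'.not_gt⟩
      · refine ⟨v, ?_⟩
        filter_upwards [hM.isOpen_compl.mem_nhds hy] with z hz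
        exact ⟨fun h => absurd h hz, fun _ => rfl⟩
  obtain ⟨g, hg⟩ := exists_contMDiffMap_forall_mem_convex_of_local_const (n := ⊤)
    (modelWithCornersSelf ℝ E) hconv hloc
  refine ⟨g, g.contMDiff.contDiff, ⟨R₁, fun y hy => (hg y).2 hy⟩, fun y hy h0 => ?_⟩
  have := (hg y).1 hy
  rw [mem_preimage, h0, mem_ball_iff_norm, zero_sub, norm_neg] at this
  exact lt_irrefl _ this

end

/-! ### Parallel projections of affine algebraic curves -/

/-- The root `t` nearest to `t₀`: the value at `t₀` is the product of the leading coefficient and of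
the differences of `t₀` with the roots. -/
theorem Polynomial.exists_root_pow_le (q : Polynomial ℂ) (t₀ : ℂ) (hq : 0 < q.natDegree) :
    ∃ t, q.IsRoot t ∧ ‖q.leadingCoeff‖ * ‖t₀ - t‖ ^ q.natDegree ≤ ‖q.eval t₀‖ := by
  have hq0 : q ≠ 0 := fun h => by simp [h] at hq
  have hsplit := IsAlgClosed.splits q
  have hcard : Multiset.card q.roots = q.natDegree := hsplit.natDegree_eq_card_roots.symm
  have hmul : ∀ s : Multiset ℂ, ∀ ρ : ℝ, 0 ≤ ρ → (∀ t ∈ s, ρ ≤ ‖t₀ - t‖) →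
      ρ ^ Multiset.card s ≤ ‖(s.map fun t => t₀ - t).prod‖ := by
    intro s ρ hρ
    induction s using Multiset.induction with
    | empty => simp
    | cons a s ih =>
      intro h
      rw [Multiset.card_cons, Multiset.map_cons, Multiset.prod_cons, norm_mul, pow_succ, mul_comm]
      exact mul_le_mul (h a (Multiset.mem_cons_self a s))
        (ih fun t ht => h t (Multiset.mem_cons_of_mem ht)) (by positivity) (norm_nonneg _)
  obtain ⟨t, ht, hmin⟩ : ∃ t ∈ q.roots, ∀ t' ∈ q.roots, ‖t₀ - t‖ ≤ ‖t₀ - t'‖ := by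
    have hne : q.roots.toFinset.Nonempty := by
      rw [Finset.nonempty_iff_ne_empty, ne_eq, Multiset.toFinset_eq_empty,
        ← Multiset.card_eq_zero, hcard]
      exact hq.ne'
    obtain ⟨t, ht, h⟩ := Finset.exists_min_image _ (fun t => ‖t₀ - t‖) hne
    exact ⟨t, Multiset.mem_toFinset.1 ht, fun t' ht' => h t' (Multiset.mem_toFinset.2 ht')⟩
  refine ⟨t, (Polynomial.mem_roots hq0).1 ht, ?_⟩
  have h1 := hmul q.roots _ (norm_nonneg _) hmin
  rw [hcard] at h1
  have h2 : q.eval t₀ = q.leadingCoeff * (q.roots.map fun t => t₀ - t).prod := by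
    conv_lhs => rw [hsplit.eq_prod_roots]
    simp [Polynomial.eval_multiset_prod]
  rw [h2, norm_mul]
  gcongr

/-- In suitable affine coordinates `p = z e + s v`, a polynomial in two variables has a nonzero
constant leading coefficient as a polynomial in `s`. -/
theorem exists_coordinates_leadingCoeff_const (f : MvPolynomial (Fin 2) ℂ)
    (hf : 0 < f.totalDegree) :
    ∃ (e v : Fin 2 → ℂ) (G : Polynomial (Polynomial ℂ)) (a : ℂ), e 0 * v 1 - e 1 * v 0 = 1 ∧
      a ≠ 0 ∧ G.natDegree ≤ f.totalDegree ∧ G.coeff f.totalDegree = Polynomial.C a ∧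
      ∀ z s : ℂ, (G.map (Polynomial.evalRingHom z)).eval s =
        MvPolynomial.eval (fun i => z * e i + s * v i) f := by
  set d := f.totalDegree with hd
  have hhom : MvPolynomial.homogeneousComponent d f ≠ 0 := by
    have hsupp : f.support.Nonempty := by
      rw [MvPolynomial.support_nonempty]
      rintro rfl
      simp [hd] at hf
    obtain ⟨m, hm, hm'⟩ := Finset.exists_mem_eq_sup f.support hsupp
      (fun s => (Finsupp.toMultiset s).card)
    intro h0
    have h1 := congrArg (MvPolynomial.coeff m) h0
    rw [MvPolynomial.coeff_homogeneousComponent, MvPolynomial.coeff_zero, if_pos] at h1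
    · exact (MvPolynomial.mem_support_iff.1 hm) h1
    · rw [hd, MvPolynomial.totalDegree_eq, hm', Finsupp.card_toMultiset, Finsupp.degree]
      rfl
  obtain ⟨v, hv⟩ : ∃ v, MvPolynomial.eval v (MvPolynomial.homogeneousComponent d f) ≠ 0 := by
    by_contra! h
    exact hhom (MvPolynomial.funext fun v => by rw [h v, map_zero])
  have hv0 : v ≠ 0 := by
    rintro rfl
    refine hv ?_
    rw [MvPolynomial.eval_zero, MvPolynomial.constantCoeff_eq,
      MvPolynomial.coeff_homogeneousComponent, if_neg]
    simpa using hf.ne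
  obtain ⟨e, he⟩ : ∃ e : Fin 2 → ℂ, e 0 * v 1 - e 1 * v 0 = 1 := by
    by_cases h1 : v 1 = 0
    · have h0 : v 0 ≠ 0 := fun h0 => hv0 (by ext i; fin_cases i <;> simp [h0, h1])
      exact ⟨![0, -(v 0)⁻¹], by simp [h0]⟩
    · exact ⟨![(v 1)⁻¹, 0], by simp [h1]⟩
  set l : Fin 2 → Polynomial (Polynomial ℂ) := fun i =>
    Polynomial.C (Polynomial.X * Polynomial.C (e i)) + Polynomial.X *
      Polynomial.C (Polynomial.C (v i)) with hl
  have hldeg : ∀ i, (l i).natDegree ≤ 1 := fun i => by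
    simp only [hl]
    compute_degree
  have hlcoeff : ∀ i, (l i).coeff 1 = Polynomial.C (v i) := fun i => by
    simp [hl, Polynomial.coeff_C]
  set G := MvPolynomial.eval₂ (Polynomial.C.comp Polynomial.C) l f with hG
  have hGsum : G = ∑ m ∈ f.support, Polynomial.C (Polynomial.C (MvPolynomial.coeff m f)) *
      (l 0 ^ m 0 * l 1 ^ m 1) := by
    rw [hG, MvPolynomial.eval₂_eq']
    simp [Fin.prod_univ_two]
  have hmd : ∀ m ∈ f.support, m 0 + m 1 ≤ d := fun m hm => by
    have := MvPolynomial.le_totalDegree hm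
    rwa [Finsupp.sum_fintype _ _ (fun _ => rfl), Fin.sum_univ_two] at this
  have hpow : ∀ (i : Fin 2) (k : ℕ), (l i ^ k).natDegree ≤ k := fun i k => by
    have := Polynomial.natDegree_pow_le_of_le k (hldeg i)
    simpa using this
  have hmul : ∀ m : Fin 2 →₀ ℕ, (l 0 ^ m 0 * l 1 ^ m 1).natDegree ≤ m 0 + m 1 := fun m =>
    Polynomial.natDegree_mul_le_of_le (hpow 0 _) (hpow 1 _)
  refine ⟨e, v, G, MvPolynomial.eval v (MvPolynomial.homogeneousComponent d f), he, hv, ?_, ?_, ?_⟩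
  · rw [hGsum]
    refine Polynomial.natDegree_sum_le_of_forall_le _ _ fun m hm => ?_
    exact (Polynomial.natDegree_C_mul_le _ _).trans ((hmul m).trans (hmd m hm))
  · rw [hGsum, Polynomial.finsetSum_coeff, MvPolynomial.homogeneousComponent_apply, map_sum,
      map_sum, Finset.sum_filter]
    refine Finset.sum_congr rfl fun m hm => ?_
    have hdeg : Finsupp.degree m = m 0 + m 1 := by
      rw [Finsupp.degree_eq_sum, Fin.sum_univ_two]
    rw [Polynomial.coeff_C_mul]
    split_ifs with h
    · rw [hdeg] at h
      have h1 : ∀ (i : Fin 2) (k : ℕ), (l i ^ k).coeff k = Polynomial.C (v i) ^ k := fun i k => by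
        have := Polynomial.coeff_pow_of_natDegree_le (m := k) (hldeg i)
        rwa [mul_one, hlcoeff] at this
      rw [← h, Polynomial.coeff_mul_add_eq_of_natDegree_le (hpow 0 _) (hpow 1 _), h1, h1,
        MvPolynomial.eval_monomial, Finsupp.prod_fintype _ _ (fun i => pow_zero _),
        Fin.prod_univ_two]
      simp
    · rw [Polynomial.coeff_eq_zero_of_natDegree_lt, mul_zero]
      rw [hdeg] at h
      exact (hmul m).trans_lt (lt_of_le_of_ne (hmd m hm) h)
  · intro z s
    have hom : ((Polynomial.evalRingHom s).comp ((Polynomial.mapRingHom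
        (Polynomial.evalRingHom z)))).comp (MvPolynomial.eval₂Hom
          (Polynomial.C.comp Polynomial.C) l) =
        (MvPolynomial.eval fun i => z * e i + s * v i) := by
      refine MvPolynomial.ringHom_ext (fun r => ?_) fun i => ?_
      · simp
      · simp [hl]
        ring
    exact RingHom.congr_fun hom f

/-- The linear form on `ℂ²` that vanishes on the vector `v`. -/
def parallelForm (v : Fin 2 → ℂ) (y : C2) : ℂ := y 0 * v 1 - y 1 * v 0

theorem continuous_parallelForm (v : Fin 2 → ℂ) : Continuous (parallelForm v) := by
  unfold parallelForm; fun_prop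

theorem continuous_eval (f : MvPolynomial (Fin 2) ℂ) :
    Continuous fun y : C2 => MvPolynomial.eval y.ofLp f :=
  (MvPolynomial.continuous_eval f).comp (by fun_prop)

theorem isClosed_zeroSet (f : MvPolynomial (Fin 2) ℂ) : IsClosed (zeroSet f) :=
  isClosed_eq (continuous_eval f) continuous_const

/-- A suitable parallel projection of an affine algebraic curve to a line is open and proper: the
points of the curve over `z` are the roots of a polynomial whose leading coefficient does not depend
on `z`. -/
theorem exists_parallelForm_open_proper (f : MvPolynomial (Fin 2) ℂ) (hf : 0 < f.totalDegree) :
    ∃ e v : Fin 2 → ℂ, e 0 * v 1 - e 1 * v 0 = 1 ∧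
      (∀ p ∈ zeroSet f, ∀ N ∈ 𝓝 p, parallelForm v '' (zeroSet f ∩ N) ∈ 𝓝 (parallelForm v p)) ∧
      ∀ C : ℝ, Bornology.IsBounded {y ∈ zeroSet f | ‖parallelForm v y‖ ≤ C} := by
  obtain ⟨e, v, G, a, hev, ha, hGdeg, hGcoeff, hGeval⟩ :=
    exists_coordinates_leadingCoeff_const f hf
  set d := f.totalDegree with hd
  set q : ℂ → Polynomial ℂ := fun z => G.map (Polynomial.evalRingHom z) with hq
  have hqcoeff : ∀ z k, (q z).coeff k = (G.coeff k).eval z := fun z k => by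
    simp [hq, Polynomial.coeff_map]
  have hqd : ∀ z, (q z).coeff d = a := fun z => by rw [hqcoeff, hGcoeff, Polynomial.eval_C]
  have hqdeg : ∀ z, (q z).natDegree = d := fun z =>
    le_antisymm (Polynomial.natDegree_map_le.trans hGdeg)
      (Polynomial.le_natDegree_of_ne_zero (by rw [hqd]; exact ha))
  have hqlead : ∀ z, (q z).leadingCoeff = a := fun z => by
    rw [Polynomial.leadingCoeff, hqdeg, hqd]
  have hq0 : ∀ z, q z ≠ 0 := fun z h => ha (by rw [← hqd z, h, Polynomial.coeff_zero])
  set E : C2 := WithLp.toLp 2 e with hE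
  set V : C2 := WithLp.toLp 2 v with hV
  set μ : C2 → ℂ := fun y => e 0 * y 1 - e 1 * y 0 with hμ
  have hrep : ∀ y : C2, parallelForm v y • E + μ y • V = y := fun y => by
    ext i
    fin_cases i
    · simp [parallelForm, hμ, hE, hV]
      linear_combination y 0 * hev
    · simp [parallelForm, hμ, hE, hV]
      linear_combination y 1 * hev
  have hlam : ∀ z s : ℂ, parallelForm v (z • E + s • V) = z := fun z s => by
    simp [parallelForm, hE, hV]
    linear_combination z * hev
  have hqe : ∀ z s : ℂ, (q z).eval s = MvPolynomial.eval (z • E + s • V).ofLp f := fun z s => by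
    rw [hq, hGeval]
    rfl
  refine ⟨e, v, hev, ?_, ?_⟩
  · intro p hp N hN
    obtain ⟨η, hη, hball⟩ := Metric.mem_nhds_iff.1 hN
    obtain ⟨ρ, hρ, hρη⟩ : ∃ ρ > 0, ρ * ‖E‖ + ρ * ‖V‖ < η := by
      refine ⟨η / (‖E‖ + ‖V‖ + 1), by positivity, ?_⟩
      rw [← mul_add, div_mul_eq_mul_div, div_lt_iff₀ (by positivity)]
      nlinarith [norm_nonneg E, norm_nonneg V]
    have hcont : Continuous fun z : ℂ => ‖(q z).eval (μ p)‖ := by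
      simp only [hqe]
      exact ((continuous_eval f).comp (by fun_prop)).norm
    have h0 : ‖(q (parallelForm v p)).eval (μ p)‖ = 0 := by
      rw [hqe, hrep, norm_eq_zero]; exact hp
    have hsmall : ∀ᶠ z in 𝓝 (parallelForm v p), ‖(q z).eval (μ p)‖ < ‖a‖ * ρ ^ d := by
      refine (hcont.tendsto _).eventually_lt_const ?_
      rw [h0]
      have := norm_pos_iff.2 ha
      positivity
    filter_upwards [hsmall, Metric.ball_mem_nhds _ hρ] with z hz hzρ
    obtain ⟨t, ht, hle⟩ := (q z).exists_root_pow_le (μ p) (by rw [hqdeg]; exact hf)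
    rw [hqlead, hqdeg] at hle
    have hlt : ‖μ p - t‖ < ρ := by
      have := lt_of_mul_lt_mul_left (hle.trans_lt hz) (norm_nonneg a)
      exact lt_of_pow_lt_pow_left₀ d hρ.le this
    refine ⟨z • E + t • V, ⟨?_, hball ?_⟩, hlam z t⟩
    · have : (q z).eval t = 0 := ht
      rw [hqe] at this
      exact this
    · rw [mem_ball_iff_norm]
      have e1 : z • E + t • V - p = (z - parallelForm v p) • E + (t - μ p) • V := by
        conv_lhs => rw [← hrep p]
        module
      rw [e1]
      refine (norm_add_le _ _).trans_lt (lt_of_le_of_lt ?_ hρη)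
      rw [norm_smul, norm_smul, norm_sub_rev t]
      rw [mem_ball_iff_norm] at hzρ
      gcongr
  · intro C
    obtain ⟨K, hK⟩ : ∃ K : ℝ, ∀ z : ℂ, ‖z‖ ≤ C → ∀ k ∈ Finset.range d, ‖(q z).coeff k‖ ≤ K := by
      have hb : ∀ k, ∃ K : ℝ, ∀ z ∈ Metric.closedBall (0 : ℂ) C, ‖(q z).coeff k‖ ≤ K := fun k => by
        simp only [hqcoeff]
        exact (isCompact_closedBall (0 : ℂ) C).exists_bound_of_continuousOn
          (G.coeff k).continuous.continuousOn
      choose K hK using hb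
      refine ⟨∑ k ∈ Finset.range d, |K k|, fun z hz k hk => ?_⟩
      exact ((hK k z (mem_closedBall_zero_iff.2 hz)).trans (le_abs_self _)).trans
        (Finset.single_le_sum (f := fun k => |K k|) (fun _ _ => abs_nonneg _) hk)
    have hroot : ∀ z t : ℂ, ‖z‖ ≤ C → (q z).eval t = 0 → ‖t‖ ≤ |K| / ‖a‖ + 1 := by
      intro z t hz ht
      have h1 := Polynomial.IsRoot.norm_lt_cauchyBound (hq0 z) (a := t) ht
      refine (show (‖t‖ : ℝ) ≤ (q z).cauchyBound from ?_).trans ?_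
      · exact_mod_cast h1.le
      · rw [Polynomial.cauchyBound, hqlead, hqdeg, NNReal.coe_add, NNReal.coe_div,
          NNReal.coe_one, coe_nnnorm]
        gcongr
        have : (Finset.range d).sup (fun k => ‖(q z).coeff k‖₊) ≤ ‖K‖₊ := by
          refine Finset.sup_le fun k hk => ?_
          rw [← NNReal.coe_le_coe, coe_nnnorm, coe_nnnorm, Real.norm_eq_abs]
          exact (hK z hz k hk).trans (le_abs_self _)
        exact_mod_cast this
    refine isBounded_iff_forall_norm_le.2 ⟨C * ‖E‖ + (|K| / ‖a‖ + 1) * ‖V‖, ?_⟩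
    rintro y ⟨hy, hyC⟩
    have ht : (q (parallelForm v y)).eval (μ y) = 0 := by
      rw [hqe, hrep]; exact hy
    have := hroot _ _ hyC ht
    calc ‖y‖ = ‖parallelForm v y • E + μ y • V‖ := by rw [hrep]
      _ ≤ ‖parallelForm v y • E‖ + ‖μ y • V‖ := norm_add_le _ _
      _ ≤ _ := by
        rw [norm_smul, norm_smul]
        gcongr

/-! ### Smooth balls -/

/-- `R` is a smooth function on `ℂ²` which is negative in the interior of the ball `B`, positive
outside of `B`, and which in the coordinates of the ball is `|x|² - 1` to first order along the
boundary. -/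
structure SmoothBall.IsBoundaryDefining (B : SmoothBall) (R : C2 → ℝ) : Prop where
  smooth : ContDiff ℝ ∞ R
  neg_iff : ∀ y, R y < 0 ↔ y ∈ B.Φ '' Metric.ball 0 1
  zero_iff : ∀ y, R y = 0 ↔ y ∈ B.boundary
  fderiv_apply : ∀ x ∈ S3, ∀ u, fderiv ℝ R (B.Φ x) (fderiv ℝ B.Φ x u) = 2 * realInner x u

theorem hasFDerivAt_norm_sq_C2 (x : C2) : ∃ L : C2 →L[ℝ] ℝ,
    HasFDerivAt (fun x : C2 => ‖x‖ ^ 2) L x ∧ ∀ u, L u = 2 * realInner x u := by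
  refine ⟨_, (hasStrictFDerivAt_norm_sq x).hasFDerivAt, fun u => ?_⟩
  have h : inner ℝ x u = (inner ℂ x u).re := by
    simp only [PiLp.inner_apply, Fin.sum_univ_two, Complex.add_re]
    rfl
  simp [realInner, h]

theorem contDiff_norm_sq_C2 : ContDiff ℝ ∞ fun x : C2 => ‖x‖ ^ 2 := contDiff_norm_sq ℝ

namespace SmoothBall
variable (B : SmoothBall)

theorem contDiffAt {x : C2} (hx : x ∈ Metric.closedBall (0 : C2) 1) : ContDiffAt ℝ ∞ B.Φ x := by
  obtain ⟨U, hU, hsub, hΦ⟩ := B.smooth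
  exact hΦ.contDiffAt (hU.mem_nhds (hsub hx))

theorem differentiableAt {x : C2} (hx : x ∈ Metric.closedBall (0 : C2) 1) :
    DifferentiableAt ℝ B.Φ x :=
  (B.contDiffAt hx).differentiableAt (by simp)

theorem continuousOn : ContinuousOn B.Φ (Metric.closedBall 0 1) := fun _ hx =>
  (B.contDiffAt hx).continuousAt.continuousWithinAt

theorem isCompact_carrier : IsCompact B.carrier :=
  (isCompact_closedBall (0 : C2) 1).image_of_continuousOn B.continuousOn

theorem S3_subset_closedBall : S3 ⊆ Metric.closedBall 0 1 := Metric.sphere_subset_closedBall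

theorem exists_equiv_of_det_ne_zero {Φ : C2 → C2} {x : C2} (h : (fderiv ℝ Φ x).det ≠ 0) :
    ∃ L : C2 ≃L[ℝ] C2, (L : C2 →L[ℝ] C2) = fderiv ℝ Φ x :=
  ⟨(LinearMap.equivOfDetNeZero (fderiv ℝ Φ x).toLinearMap h).toContinuousLinearEquiv, by
    ext1 v; rfl⟩

/-- The embedding of a ball is an embedding of a slightly larger open ball. -/
theorem exists_larger_ball : ∃ r > (1 : ℝ), InjOn B.Φ (Metric.ball 0 r) ∧
    (∀ x ∈ Metric.ball (0 : C2) r, ContDiffAt ℝ ∞ B.Φ x) ∧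
    ∀ x ∈ Metric.ball (0 : C2) r, (fderiv ℝ B.Φ x).det ≠ 0 := by
  obtain ⟨U, hU, hsub, hΦ⟩ := B.smooth
  have hcf : ContinuousOn (fun x => (fderiv ℝ B.Φ x).det) U :=
    ContinuousLinearMap.continuous_det.comp_continuousOn
      (hΦ.continuousOn_fderiv_of_isOpen hU (by simp))
  have hopen : IsOpen (U ∩ {x | (fderiv ℝ B.Φ x).det ≠ 0}) :=
    hcf.isOpen_inter_preimage hU isOpen_ne
  obtain ⟨t, ht, hinj⟩ := B.injOn.exists_mem_nhdsSet (isCompact_closedBall (0 : C2) 1)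
    (fun x hx => (B.contDiffAt hx).continuousAt) fun x hx => by
      obtain ⟨L, hL⟩ := exists_equiv_of_det_ne_zero (B.det_pos x hx).ne'
      have hs := (B.contDiffAt hx).hasStrictFDerivAt (by simp)
      rw [← hL] at hs
      exact ⟨_, (hs.toOpenPartialHomeomorph _).open_source.mem_nhds
        hs.mem_toOpenPartialHomeomorph_source, (hs.toOpenPartialHomeomorph _).injOn⟩
  obtain ⟨δ, hδ, hth⟩ := (isCompact_closedBall (0 : C2) 1).exists_thickening_subset_open
    (isOpen_interior.inter hopen) (subset_inter (subset_interior_iff_mem_nhdsSet.2 ht)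
      fun x hx => ⟨hsub hx, (B.det_pos x hx).ne'⟩)
  rw [thickening_closedBall hδ zero_le_one] at hth
  refine ⟨δ + 1, by linarith, ?_, ?_, ?_⟩
  · exact hinj.mono fun x hx => interior_subset (hth hx).1
  · exact fun x hx => hΦ.contDiffAt (hU.mem_nhds (hth hx).2.1)
  · exact fun x hx => (hth hx).2.2

/-- The function `|x|² - 1` in the coordinates of a larger ball, made constant far from the ball. -/
theorem exists_isBoundaryDefining : ∃ R, B.IsBoundaryDefining R := by
  obtain ⟨r, hr, hinj, hsm, hdet⟩ := B.exists_larger_ball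
  set D : Set C2 := Metric.ball 0 r with hD
  have hDopen : IsOpen D := Metric.isOpen_ball
  set Ψ := Function.invFunOn B.Φ D with hΨ
  have hΨmem : ∀ y ∈ B.Φ '' D, Ψ y ∈ D := fun y hy => Function.invFunOn_mem hy
  have hΨeq : ∀ y ∈ B.Φ '' D, B.Φ (Ψ y) = y := fun y hy => Function.invFunOn_eq hy
  have hΨΦ : ∀ x ∈ D, Ψ (B.Φ x) = x := fun x hx =>
    hinj (hΨmem _ (mem_image_of_mem _ hx)) hx (hΨeq _ (mem_image_of_mem _ hx))
  have hloc : ∀ x ∈ D, B.Φ '' D ∈ 𝓝 (B.Φ x) ∧ ContDiffAt ℝ ∞ Ψ (B.Φ x) := by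
    intro x hx
    obtain ⟨L, hL⟩ := exists_equiv_of_det_ne_zero (hdet x hx)
    have hd : HasFDerivAt B.Φ (L : C2 →L[ℝ] C2) x := by
      rw [hL]; exact ((hsm x hx).differentiableAt (by simp)).hasFDerivAt
    have hs : HasStrictFDerivAt B.Φ (L : C2 →L[ℝ] C2) x := by
      rw [hL]; exact (hsm x hx).hasStrictFDerivAt (by simp)
    have hmap := hs.map_nhds_eq_of_equiv
    have hO : B.Φ '' D ∈ 𝓝 (B.Φ x) := by
      rw [← hmap]; exact image_mem_map (hDopen.mem_nhds hx)
    refine ⟨hO, ((hsm x hx).to_localInverse hd (by simp)).congr_of_eventuallyEq ?_⟩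
    have h1 := hs.eventually_right_inverse
    have h2 : ∀ᶠ z in 𝓝 (B.Φ x), hs.localInverse B.Φ L x z ∈ D := by
      have := hs.localInverse_tendsto
      exact this (hDopen.mem_nhds hx)
    filter_upwards [hO, h1, h2] with z hz1 hz2 hz3
    exact hinj (hΨmem z hz1) hz3 ((hΨeq z hz1).trans hz2.symm)
  -- `σ` is the identity up to `a` and constant beyond `2 a`, so that `σ (‖x‖ ^ 2 - 1)` is constant
  -- near the boundary of the larger ball
  set a : ℝ := (r ^ 2 - 1) / 3 with ha
  have ha0 : 0 < a := by rw [ha]; nlinarith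
  have hra : r ^ 2 - 1 = 3 * a := by rw [ha]; ring
  set T : ℝ → ℝ := fun s => Real.smoothTransition ((s - a) / a) with hT
  set σ : ℝ → ℝ := fun s => s * (1 - T s) + a * T s with hσ
  have hTs : ContDiff ℝ ∞ T :=
    Real.smoothTransition.contDiff.comp ((contDiff_id.sub contDiff_const).div_const a)
  have hσs : ContDiff ℝ ∞ σ :=
    (contDiff_id.mul (contDiff_const.sub hTs)).add (contDiff_const.mul hTs)
  have hσ1 : ∀ s ≤ a, σ s = s := fun s hs => by
    have : T s = 0 := Real.smoothTransition.zero_of_nonpos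
      (div_nonpos_of_nonpos_of_nonneg (by linarith) ha0.le)
    simp [hσ, this]
  have hσ2 : ∀ s, 2 * a ≤ s → σ s = a := fun s hs => by
    have : T s = 1 := Real.smoothTransition.one_of_one_le (by
      rw [le_div_iff₀ ha0]; linarith)
    simp [hσ, this]
  have hσ3 : ∀ s, 0 < s → 0 < σ s := fun s hs => by
    have h1 : 0 ≤ T s := Real.smoothTransition.nonneg _
    have h2 : T s ≤ 1 := Real.smoothTransition.le_one _
    rcases h1.eq_or_lt with h | h
    · simp only [hσ, ← h]; linarith
    · have := mul_pos ha0 h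
      have := mul_nonneg hs.le (sub_nonneg.2 h2)
      simp only [hσ]; linarith
  classical
  set R₀ : C2 → ℝ := fun y => if y ∈ B.Φ '' D then ‖Ψ y‖ ^ 2 - 1 else 3 * a with hR₀
  have hR₀Φ : ∀ x ∈ D, R₀ (B.Φ x) = ‖x‖ ^ 2 - 1 := fun x hx => by
    simp only [hR₀, if_pos (mem_image_of_mem B.Φ hx), hΨΦ x hx]
  have hsub : Metric.closedBall (0 : C2) 1 ⊆ D := Metric.closedBall_subset_ball hr
  have hσ0 : ∀ s, σ s < 0 ↔ s < 0 := fun s => by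
    rcases lt_trichotomy s 0 with h | h | h
    · rw [hσ1 s (by linarith)]
    · rw [hσ1 s (by linarith)]
    · exact ⟨fun h' => absurd (hσ3 s h) h'.not_gt, fun h' => absurd h h'.not_gt⟩
  have hσ00 : ∀ s, σ s = 0 ↔ s = 0 := fun s => by
    rcases lt_trichotomy s 0 with h | h | h
    · rw [hσ1 s (by linarith)]
    · rw [hσ1 s (by linarith)]
    · exact ⟨fun h' => absurd h' (hσ3 s h).ne', fun h' => absurd h' h.ne'⟩
  have hRs : ContDiff ℝ ∞ fun y => σ (R₀ y) := by
    rw [contDiff_iff_contDiffAt]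
    intro y
    by_cases hy : y ∈ B.Φ '' D
    · obtain ⟨x, hx, rfl⟩ := hy
      obtain ⟨hO, hΨs⟩ := hloc x hx
      have : ContDiffAt ℝ ∞ R₀ (B.Φ x) := by
        have h1 : ContDiffAt ℝ ∞ (fun y => ‖Ψ y‖ ^ 2 - 1) (B.Φ x) :=
          (contDiff_norm_sq_C2.contDiffAt.comp (B.Φ x) hΨs).sub contDiffAt_const
        refine h1.congr_of_eventuallyEq ?_
        filter_upwards [hO] with z hz
        simp only [hR₀, if_pos hz]
      exact hσs.contDiffAt.comp _ this
    · have hK : IsCompact (B.Φ '' {x | ‖x‖ ^ 2 ≤ 1 + 2 * a}) := by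
        have hKD : {x : C2 | ‖x‖ ^ 2 ≤ 1 + 2 * a} ⊆ D := fun x hx => by
          have hx' : ‖x‖ ^ 2 ≤ 1 + 2 * a := hx
          rw [hD, mem_ball_zero_iff]
          refine lt_of_pow_lt_pow_left₀ 2 (by linarith) ?_
          linarith
        refine IsCompact.image_of_continuousOn ?_ fun x hx =>
          (hsm x (hKD hx)).continuousAt.continuousWithinAt
        refine Metric.isCompact_of_isClosed_isBounded
          (isClosed_le (continuous_norm.pow 2) continuous_const) (Metric.isBounded_ball.subset hKD)
      have hyK : y ∉ B.Φ '' {x | ‖x‖ ^ 2 ≤ 1 + 2 * a} := by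
        rintro ⟨x, hx, rfl⟩
        refine hy (mem_image_of_mem _ ?_)
        have hx' : ‖x‖ ^ 2 ≤ 1 + 2 * a := hx
        rw [hD, mem_ball_zero_iff]
        refine lt_of_pow_lt_pow_left₀ 2 (by linarith) ?_
        linarith
      have hev : (fun y => σ (R₀ y)) =ᶠ[𝓝 y] fun _ => a := by
        filter_upwards [hK.isClosed.isOpen_compl.mem_nhds hyK] with z hz
        refine hσ2 _ ?_
        by_cases hzD : z ∈ B.Φ '' D
        · simp only [hR₀, if_pos hzD]
          by_contra hlt
          refine hz ⟨Ψ z, ?_, hΨeq z hzD⟩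
          have : ‖Ψ z‖ ^ 2 - 1 < 2 * a := not_le.1 hlt
          show ‖Ψ z‖ ^ 2 ≤ 1 + 2 * a
          linarith
        · simp only [hR₀, if_neg hzD]; linarith
      exact contDiffAt_const.congr_of_eventuallyEq hev
  refine ⟨fun y => σ (R₀ y), hRs, fun y => ?_, fun y => ?_, fun x hx u => ?_⟩
  · rw [hσ0]
    by_cases hy : y ∈ B.Φ '' D
    · obtain ⟨x, hx, rfl⟩ := hy
      rw [hR₀Φ x hx]
      constructor
      · intro h
        refine mem_image_of_mem _ ?_
        rw [mem_ball_zero_iff]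
        nlinarith [norm_nonneg x]
      · rintro ⟨x', hx', he⟩
        have : x' = x := hinj (hsub (Metric.ball_subset_closedBall hx')) hx he
        subst this
        rw [mem_ball_zero_iff] at hx'
        nlinarith [norm_nonneg x']
    · simp only [hR₀, if_neg hy]
      constructor
      · intro h; linarith
      · rintro ⟨x', hx', rfl⟩
        exact absurd (mem_image_of_mem _ (hsub (Metric.ball_subset_closedBall hx'))) hy
  · rw [hσ00]
    by_cases hy : y ∈ B.Φ '' D
    · obtain ⟨x, hx, rfl⟩ := hy
      rw [hR₀Φ x hx]
      constructor
      · intro h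
        refine mem_image_of_mem _ ?_
        rw [S3, mem_sphere_zero_iff_norm]
        nlinarith [norm_nonneg x]
      · rintro ⟨x', hx', he⟩
        have : x' = x := hinj (hsub (S3_subset_closedBall hx')) hx he
        subst this
        rw [S3, mem_sphere_zero_iff_norm] at hx'
        rw [hx']; norm_num
    · simp only [hR₀, if_neg hy]
      constructor
      · intro h; linarith
      · rintro ⟨x', hx', rfl⟩
        exact absurd (mem_image_of_mem _ (hsub (S3_subset_closedBall hx'))) hy
  · have hxD : x ∈ D := hsub (S3_subset_closedBall hx)
    have hx1 : ‖x‖ = 1 := by rwa [S3, mem_sphere_zero_iff_norm] at hx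
    obtain ⟨L, hL, hLu⟩ := hasFDerivAt_norm_sq_C2 x
    have h1 : HasFDerivAt (fun z => σ (R₀ (B.Φ z))) L x := by
      refine (hL.sub_const 1).congr_of_eventuallyEq ?_
      have hnear : ∀ᶠ z : C2 in 𝓝 x, ‖z‖ ^ 2 - 1 < a := by
        refine (((continuous_norm.pow 2).sub continuous_const).tendsto x).eventually_lt_const ?_
        simp only [Pi.sub_apply, Pi.pow_apply, hx1]; linarith
      filter_upwards [hDopen.mem_nhds hxD, hnear] with z hz hz'
      rw [hR₀Φ z hz, hσ1 _ hz'.le]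
    have h2 : HasFDerivAt (fun z => σ (R₀ (B.Φ z))) _ x :=
      ((hRs.differentiable (by simp) (B.Φ x)).hasFDerivAt).comp x
        (B.differentiableAt (S3_subset_closedBall hx)).hasFDerivAt
    have h3 := h2.unique h1
    rw [← hLu, ← h3]
    rfl

variable {B} {R : C2 → ℝ}

theorem IsBoundaryDefining.le_zero_iff (hR : B.IsBoundaryDefining R) (y : C2) :
    R y ≤ 0 ↔ y ∈ B.carrier := by
  rw [le_iff_lt_or_eq, hR.neg_iff, hR.zero_iff, carrier, boundary, ← mem_union, ← image_union, S3,
    Metric.ball_union_sphere]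

/-- The complement of the interior of the ball is a retract of the complement of its centre. -/
theorem IsBoundaryDefining.exists_retraction (hR : B.IsBoundaryDefining R) :
    ∃ ρ : C2 → C2, ContinuousOn ρ {B.Φ 0}ᶜ ∧ (∀ y, 0 ≤ R y → ρ y = y) ∧
      ∀ y ≠ B.Φ 0, 0 ≤ R (ρ y) := by
  set D : Set C2 := Metric.closedBall 0 1 with hD
  set Ψ := Function.invFunOn B.Φ D with hΨ
  have hΨmem : ∀ y ∈ B.carrier, Ψ y ∈ D := fun y hy => Function.invFunOn_mem hy
  have hΨeq : ∀ y ∈ B.carrier, B.Φ (Ψ y) = y := fun y hy => Function.invFunOn_eq hy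
  have hΨΦ : ∀ x ∈ D, Ψ (B.Φ x) = x := fun x hx =>
    B.injOn (hΨmem _ (mem_image_of_mem _ hx)) hx (hΨeq _ (mem_image_of_mem _ hx))
  have hΨc : ContinuousOn Ψ B.carrier := by
    rw [continuousOn_iff_isClosed]
    intro t ht
    refine ⟨B.Φ '' (D ∩ t), ?_, ?_⟩
    · exact (((isCompact_closedBall (0 : C2) 1).inter_right ht).image_of_continuousOn
        (B.continuousOn.mono inter_subset_left)).isClosed
    · ext y
      constructor
      · rintro ⟨hy, hyc⟩
        exact ⟨⟨Ψ y, ⟨hΨmem y hyc, hy⟩, hΨeq y hyc⟩, hyc⟩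
      · rintro ⟨⟨x, ⟨hx, hxt⟩, rfl⟩, hyc⟩
        refine ⟨?_, hyc⟩
        rw [mem_preimage, hΨΦ x hx]; exact hxt
  have hΨ0 : ∀ y ∈ B.carrier, y ≠ B.Φ 0 → Ψ y ≠ 0 := fun y hy hne h => hne (by
    rw [← h, hΨeq y hy])
  -- the radial projection to the boundary in the coordinates of the ball
  set N : C2 → C2 := fun y => B.Φ ((‖Ψ y‖⁻¹ : ℝ) • Ψ y) with hN
  have hNmem : ∀ y ∈ B.carrier, y ≠ B.Φ 0 → ((‖Ψ y‖⁻¹ : ℝ) • Ψ y) ∈ S3 := fun y hy hne => by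
    rw [S3, mem_sphere_zero_iff_norm, norm_smul, norm_inv, norm_norm,
      inv_mul_cancel₀ (norm_ne_zero_iff.2 (hΨ0 y hy hne))]
  have hNc : ContinuousOn N (B.carrier ∩ {B.Φ 0}ᶜ) := by
    refine B.continuousOn.comp ?_ fun y hy => S3_subset_closedBall (hNmem y hy.1 hy.2)
    have h1 : ContinuousOn Ψ (B.carrier ∩ {B.Φ 0}ᶜ) := hΨc.mono inter_subset_left
    exact (h1.norm.inv₀ fun y hy => norm_ne_zero_iff.2 (hΨ0 y hy.1 hy.2)).smul h1
  have hNid : ∀ y, R y = 0 → N y = y := fun y hy => by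
    obtain ⟨x, hx, rfl⟩ := (hR.zero_iff y).1 hy
    have hx1 : ‖x‖ = 1 := by rwa [S3, mem_sphere_zero_iff_norm] at hx
    simp only [hN, hΨΦ x (S3_subset_closedBall hx), hx1, inv_one, one_smul]
  classical
  refine ⟨fun y => if 0 ≤ R y then y else N y, ?_, fun y hy => if_pos hy, fun y hy => ?_⟩
  · intro y hy
    refine ContinuousAt.continuousWithinAt ?_
    rw [← continuousWithinAt_univ]
    have huniv : (univ : Set C2) = {y | 0 ≤ R y} ∪ B.carrier := by
      ext z
      simp only [mem_univ, mem_union, true_iff, ← hR.le_zero_iff]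
      exact le_total (0 : ℝ) (R z)
    rw [huniv, continuousWithinAt_union]
    constructor
    · by_cases hRy : 0 ≤ R y
      · refine continuousWithinAt_id.congr (fun z hz => if_pos hz) (if_pos hRy)
      · refine continuousWithinAt_of_notMem_closure ?_
        rw [(isClosed_le continuous_const hR.smooth.continuous).closure_eq]
        exact hRy
    · by_cases hyc : y ∈ B.carrier
      · have h1 : ContinuousWithinAt N B.carrier y := by
          refine (hNc y ⟨hyc, hy⟩).mono_of_mem_nhdsWithin ?_
          exact inter_mem_nhdsWithin _ (isOpen_compl_singleton.mem_nhds hy)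
        have hcongr : ∀ z ∈ B.carrier, (if 0 ≤ R z then z else N z) = N z := fun z hz => by
          split_ifs with h
          · exact (hNid z (le_antisymm ((hR.le_zero_iff z).2 hz) h)).symm
          · rfl
        exact h1.congr hcongr (hcongr y hyc)
      · refine continuousWithinAt_of_notMem_closure ?_
        rw [B.isCompact_carrier.isClosed.closure_eq]
        exact hyc
  · simp only
    split_ifs with h
    · exact h
    · have hyc : y ∈ B.carrier := (hR.le_zero_iff y).1 (le_of_lt (not_le.1 h))
      refine ((hR.zero_iff _).2 ?_).ge
      exact mem_image_of_mem _ (hNmem y hyc hy)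

end SmoothBall

/-! ### The complex orientation of `ℂ²` -/

/-- The real coordinates `(Re z₀, Im z₀, Re z₁, Im z₁)` on `ℂ²`. -/
noncomputable def realCoords : C2 ≃L[ℝ] (Fin 4 → ℝ) :=
  LinearEquiv.toContinuousLinearEquiv
    { toFun := fun v => ![(v 0).re, (v 0).im, (v 1).re, (v 1).im]
      invFun := fun x => !₂[(⟨x 0, x 1⟩ : ℂ), (⟨x 2, x 3⟩ : ℂ)]
      map_add' := fun v w => by ext i; fin_cases i <;> simp
      map_smul' := fun a v => by ext i; fin_cases i <;> simp
      left_inv := fun v => by ext i; fin_cases i <;> simp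
      right_inv := fun x => by ext i; fin_cases i <;> simp }

theorem realCoords_apply (v : C2) :
    realCoords v = ![(v 0).re, (v 0).im, (v 1).re, (v 1).im] := rfl

theorem det4_eq (a b c d : C2) : det4 a b c d =
    Matrix.det (Matrix.of ![realCoords a, realCoords b, realCoords c, realCoords d]) := by
  unfold det4
  congr 2
  ext i j
  fin_cases i <;> rfl

theorem det4_eq_basis_det (v : Fin 4 → C2) : det4 (v 0) (v 1) (v 2) (v 3) =
    (Module.Basis.ofEquivFun realCoords.toLinearEquiv).det v := by
  rw [det4_eq, Module.Basis.det_apply, ← Matrix.det_transpose]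
  congr 1
  ext i j
  fin_cases j <;> simp [Module.Basis.toMatrix_apply]

theorem det4_map (A : C2 →L[ℝ] C2) (a b c d : C2) :
    det4 (A a) (A b) (A c) (A d) = A.det * det4 a b c d := by
  have h := (Module.Basis.ofEquivFun realCoords.toLinearEquiv).det_comp A.toLinearMap ![a, b, c, d]
  rw [← det4_eq_basis_det, ← det4_eq_basis_det] at h
  exact h

theorem det4_smul_add (s : ℝ) (x u a b c : C2) :
    det4 (s • x + u) a b c = s * det4 x a b c + det4 u a b c := by
  have h := det_rows_eq_of_combination (realCoords x) (realCoords a) (realCoords b) (realCoords c)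
    (realCoords u) s 0 0
  simp only [det4_eq]
  rw [← h]
  congr 2
  ext i j
  fin_cases i <;> simp

/-- Four vectors orthogonal to a nonzero vector are linearly dependent. -/
theorem det4_eq_zero {x a b c d : C2} (hx : x ≠ 0) (ha : realInner x a = 0)
    (hb : realInner x b = 0) (hc : realInner x c = 0) (hd : realInner x d = 0) :
    det4 a b c d = 0 := by
  rw [det4_eq]
  refine Matrix.exists_mulVec_eq_zero_iff.1 ⟨realCoords x, fun h => hx ?_, ?_⟩
  · exact realCoords.injective (h.trans (map_zero _).symm)
  · have hin : ∀ u, realInner x u = realCoords u ⬝ᵥ realCoords x := fun u => by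
      simp [realInner, realCoords_apply, PiLp.inner_apply, Fin.sum_univ_two, dotProduct,
        Fin.sum_univ_four]
      ring
    ext i
    fin_cases i
    · exact (hin a).symm.trans ha
    · exact (hin b).symm.trans hb
    · exact (hin c).symm.trans hc
    · exact (hin d).symm.trans hd

/-- If `τ` spans the kernel of the complex functional `(p, q)`, if `(p, q)` does not vanish on `a`
and takes `b` to `i` times its value on `a`, then `(-iτ, τ, a, b)` is a positive basis. -/
theorem det4_pos {p q : ℂ} {τ a b : C2} (hτ : τ ≠ 0) (hpτ : p * τ 0 + q * τ 1 = 0)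
    (ha : p * a 0 + q * a 1 ≠ 0) (hb : p * b 0 + q * b 1 = Complex.I * (p * a 0 + q * a 1)) :
    0 < det4 (-(Complex.I • τ)) τ a b := by
  -- the functionals `(p, q)` and `det_ℂ (τ, ·)` have the same kernel
  have hker : ∀ x : C2, p * x 0 + q * x 1 = 0 ↔ τ 0 * x 1 - τ 1 * x 0 = 0 := by
    intro x
    have h0 : τ 0 * (p * x 0 + q * x 1) = q * (τ 0 * x 1 - τ 1 * x 0) := by
      linear_combination x 0 * hpτ
    have h1 : τ 1 * (p * x 0 + q * x 1) = -p * (τ 0 * x 1 - τ 1 * x 0) := by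
      linear_combination x 1 * hpτ
    constructor
    · intro h
      rw [h, mul_zero] at h0 h1
      rcases mul_eq_zero.1 h0.symm with hq | h2
      · rcases mul_eq_zero.1 h1.symm with hp | h2
        · exact absurd (by rw [hq, neg_eq_zero.1 hp]; ring) ha
        · exact h2
      · exact h2
    · intro h
      rw [h, mul_zero] at h0 h1
      by_contra hne
      refine hτ ?_
      ext i
      fin_cases i
      · exact (mul_eq_zero.1 h0).resolve_right hne
      · exact (mul_eq_zero.1 h1).resolve_right hne
  have hD : τ 0 * a 1 - τ 1 * a 0 ≠ 0 := fun h => ha ((hker a).2 h)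
  have hDb : τ 0 * b 1 - τ 1 * b 0 = Complex.I * (τ 0 * a 1 - τ 1 * a 0) := by
    have h := (hker (b - Complex.I • a)).1 (by
      simp only [PiLp.sub_apply, PiLp.smul_apply, smul_eq_mul]
      linear_combination hb)
    simp only [PiLp.sub_apply, PiLp.smul_apply, smul_eq_mul] at h
    linear_combination h
  -- the determinant is the imaginary part of a Hermitian product of the values of `det_ℂ (τ, ·)`
  have hkey : det4 (-(Complex.I • τ)) τ a b =
      ((starRingEnd ℂ) (τ 0 * a 1 - τ 1 * a 0) * (τ 0 * b 1 - τ 1 * b 0)).im := by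
    rw [det4_eq, det_rows_four]
    simp [realCoords_apply]
    ring
  have h2 : (starRingEnd ℂ) (τ 0 * a 1 - τ 1 * a 0) *
      (Complex.I * (τ 0 * a 1 - τ 1 * a 0)) =
      Complex.I * (Complex.normSq (τ 0 * a 1 - τ 1 * a 0) : ℂ) := by
    rw [Complex.normSq_eq_conj_mul_self]; ring
  rw [hkey, hDb, h2]
  simpa using Complex.normSq_pos.2 hD

/-! ### The differential of a polynomial -/

/-- The complex differential of a polynomial as a continuous linear functional. -/
noncomputable def polyFDeriv (f : MvPolynomial (Fin 2) ℂ) (p : C2) : C2 →L[ℂ] ℂ :=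
  ∑ i, MvPolynomial.eval p.ofLp (MvPolynomial.pderiv i f) • EuclideanSpace.proj i

theorem polyFDeriv_apply (f : MvPolynomial (Fin 2) ℂ) (p w : C2) :
    polyFDeriv f p w = polyDiff f p w := by
  simp [polyFDeriv, polyDiff]

theorem hasFDerivAt_eval (f : MvPolynomial (Fin 2) ℂ) (p : C2) :
    HasFDerivAt (fun y : C2 => MvPolynomial.eval y.ofLp f) (polyFDeriv f p) p := by
  induction f using MvPolynomial.induction_on with
  | C a =>
    have h : polyFDeriv (MvPolynomial.C a) p = 0 := by
      ext1 w; simp [polyFDeriv]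
    rw [h]
    simpa using hasFDerivAt_const a p
  | add f g hf hg =>
    have h : polyFDeriv (f + g) p = polyFDeriv f p + polyFDeriv g p := by
      ext1 w; simp [polyFDeriv, add_mul]; ring
    rw [h]
    simp only [map_add]
    exact hf.add hg
  | mul_X f n hf =>
    have hX : HasFDerivAt (fun y : C2 => y n) (EuclideanSpace.proj n : C2 →L[ℂ] ℂ) p :=
      (EuclideanSpace.proj n : C2 →L[ℂ] ℂ).hasFDerivAt
    have h : polyFDeriv (f * MvPolynomial.X n) p =
        MvPolynomial.eval p.ofLp f • (EuclideanSpace.proj n : C2 →L[ℂ] ℂ) +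
          p n • polyFDeriv f p := by
      ext1 w
      fin_cases n <;> simp [polyFDeriv, MvPolynomial.pderiv_X, Pi.single_apply] <;> ring
    rw [h]
    simp only [map_mul, MvPolynomial.eval_X]
    exact hf.mul hX

theorem contDiff_eval (f : MvPolynomial (Fin 2) ℂ) :
    ContDiff ℝ ∞ fun y : C2 => MvPolynomial.eval y.ofLp f := by
  have h : ContDiff ℂ ∞ fun y : C2 => MvPolynomial.eval y.ofLp f := by
    induction f using MvPolynomial.induction_on with
    | C a => simpa using contDiff_const
    | add f g hf hg => simpa using hf.add hg
    | mul_X f n hf =>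
      have hX : ContDiff ℂ ∞ fun y : C2 => y n := (EuclideanSpace.proj n : C2 →L[ℂ] ℂ).contDiff
      simpa using hf.mul hX
  exact h.restrict_scalars ℝ

theorem fderiv_eval_apply (f : MvPolynomial (Fin 2) ℂ) (p w : C2) :
    fderiv ℝ (fun y : C2 => MvPolynomial.eval y.ofLp f) p w = polyDiff f p w := by
  rw [((hasFDerivAt_eval f p).restrictScalars ℝ).fderiv, ← polyFDeriv_apply]
  rfl

/-- The kernel of the differential of `f` at a smooth point of the curve is a complex line. -/
theorem eq_smul_of_polyDiff_eq_zero {f : MvPolynomial (Fin 2) ℂ} {p τ w : C2} (hτ : τ ≠ 0)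
    (hfτ : polyDiff f p τ = 0) (hf : ∃ a, polyDiff f p a ≠ 0) (hw : polyDiff f p w = 0) :
    ∃ z : ℂ, w = z • τ := by
  obtain ⟨a, ha⟩ := hf
  simp only [polyDiff, Fin.sum_univ_two] at *
  set P := MvPolynomial.eval p.ofLp (MvPolynomial.pderiv 0 f)
  set Q := MvPolynomial.eval p.ofLp (MvPolynomial.pderiv 1 f)
  have h0 : P * (τ 0 * w 1 - τ 1 * w 0) = 0 := by linear_combination w 1 * hfτ - τ 1 * hw
  have h1 : Q * (τ 0 * w 1 - τ 1 * w 0) = 0 := by linear_combination τ 0 * hw - w 0 * hfτ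
  have hD : τ 0 * w 1 - τ 1 * w 0 = 0 := by
    rcases mul_eq_zero.1 h0 with hP | h
    · rcases mul_eq_zero.1 h1 with hQ | h
      · exact absurd (by rw [hP, hQ]; ring) ha
      · exact h
    · exact h
  by_cases hτ0 : τ 0 = 0
  · have hτ1 : τ 1 ≠ 0 := fun h => hτ (by ext i; fin_cases i; exacts [hτ0, h])
    refine ⟨w 1 / τ 1, ?_⟩
    ext i
    fin_cases i
    · have : τ 1 * w 0 = 0 := by linear_combination w 1 * hτ0 - hD
      simpa [hτ0] using (mul_eq_zero.1 this).resolve_left hτ1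
    · simp [hτ1]
  · refine ⟨w 0 / τ 0, ?_⟩
    ext i
    fin_cases i
    · simp [hτ0]
    · simp only [PiLp.smul_apply, smul_eq_mul, Fin.mk_one]
      field_simp
      linear_combination hD

/-! ### The curve near the link -/

namespace OrientedLink
variable {ι : Type*} (L : OrientedLink ι) (B : SmoothBall)

/-- The image of the `j`-th component of `L` in the boundary of the ball. -/
noncomputable def curve (j : ι) (t : ℝ) : C2 := B.Φ (L.γ j t)

/-- The velocity of the image of the `j`-th component of `L` in the boundary of the ball. -/
noncomputable def velocity (j : ι) (t : ℝ) : C2 :=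
  fderiv ℝ B.Φ (L.γ j t) (deriv (L.γ j) t)

theorem mem_closedBall (j : ι) (t : ℝ) : L.γ j t ∈ Metric.closedBall (0 : C2) 1 :=
  SmoothBall.S3_subset_closedBall (L.mem_S3 j t)

theorem contDiff_curve (j : ι) : ContDiff ℝ ∞ (L.curve B j) := by
  rw [contDiff_iff_contDiffAt]
  exact fun t => (B.contDiffAt (L.mem_closedBall j t)).comp t (L.smooth j).contDiffAt

theorem periodic_curve (j : ι) : Function.Periodic (L.curve B j) 1 := fun t => by
  simp only [curve, L.periodic j t]

theorem hasDerivAt_curve (j : ι) (t : ℝ) : HasDerivAt (L.curve B j) (L.velocity B j t) t :=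
  (B.differentiableAt (L.mem_closedBall j t)).hasFDerivAt.comp_hasDerivAt t
    ((L.smooth j).differentiable (by simp) t).hasDerivAt

theorem velocity_ne_zero (j : ι) (t : ℝ) : L.velocity B j t ≠ 0 := by
  obtain ⟨A, hA⟩ := SmoothBall.exists_equiv_of_det_ne_zero
    (B.det_pos _ (L.mem_closedBall j t)).ne'
  have : L.velocity B j t = A (deriv (L.γ j) t) := by rw [velocity, ← hA]; rfl
  rw [this]
  exact A.map_ne_zero_iff.2 (L.regular j t)

variable {L B} {f : MvPolynomial (Fin 2) ℂ} {R : C2 → ℝ}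

theorem IsCutBy.curve_mem (h : L.IsCutBy f B) (j : ι) (t : ℝ) : L.curve B j t ∈ zeroSet f :=
  (h.image.subset (mem_image_of_mem _ (mem_iUnion.2 ⟨j, mem_range_self t⟩))).1

theorem IsCutBy.exists_curve_eq (h : L.IsCutBy f B) {y : C2} (hy : y ∈ zeroSet f)
    (hyB : y ∈ B.boundary) : ∃ j t, L.curve B j t = y := by
  obtain ⟨x, hx, rfl⟩ := h.image.superset ⟨hy, hyB⟩
  obtain ⟨j, t, rfl⟩ := mem_iUnion.1 hx
  exact ⟨j, t, rfl⟩

theorem IsCutBy.polyDiff_velocity (h : L.IsCutBy f B) (j : ι) (t : ℝ) :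
    polyDiff f (L.curve B j t) (L.velocity B j t) = 0 := by
  have h1 := ((hasFDerivAt_eval f (L.curve B j t)).restrictScalars ℝ).comp_hasDerivAt t
    (L.hasDerivAt_curve B j t)
  have h2 : HasDerivAt (fun s => MvPolynomial.eval (L.curve B j s).ofLp f) 0 t := by
    have : (fun s => MvPolynomial.eval (L.curve B j s).ofLp f) = fun _ => 0 :=
      funext fun s => h.curve_mem j s
    rw [this]; exact hasDerivAt_const t 0
  rw [← polyFDeriv_apply]
  exact h1.unique h2

theorem IsCutBy.exists_polyDiff_ne_zero (h : L.IsCutBy f B) (j : ι) (t : ℝ) :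
    ∃ w, polyDiff f (L.curve B j t) w ≠ 0 :=
  (h.transverse _ (L.mem_S3 j t) (h.curve_mem j t)).1

end OrientedLink

namespace SmoothBall.IsBoundaryDefining
variable {ι : Type*} {L : OrientedLink ι} {B : SmoothBall}
  {f : MvPolynomial (Fin 2) ℂ} {R : C2 → ℝ}

theorem curve_eq_zero (hR : B.IsBoundaryDefining R) (L : OrientedLink ι) (j : ι) (t : ℝ) :
    R (L.curve B j t) = 0 :=
  (hR.zero_iff _).2 (mem_image_of_mem _ (L.mem_S3 j t))

theorem fderiv_velocity (hR : B.IsBoundaryDefining R) (L : OrientedLink ι) (j : ι) (t : ℝ) :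
    fderiv ℝ R (L.curve B j t) (L.velocity B j t) = 0 := by
  have h1 := (hR.smooth.differentiable (by simp) (L.curve B j t)).hasFDerivAt.comp_hasDerivAt t
    (L.hasDerivAt_curve B j t)
  have h2 : HasDerivAt (fun s => R (L.curve B j s)) 0 t := by
    have : (fun s => R (L.curve B j s)) = fun _ => 0 :=
      funext fun s => hR.curve_eq_zero L j s
    rw [this]; exact hasDerivAt_const t 0
  exact h1.unique h2

/-- The vector `-iτ` points out of the ball. -/
theorem fderiv_neg_I_smul_velocity (hR : B.IsBoundaryDefining R) (h : L.IsCutBy f B) (j : ι)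
    (t : ℝ) : 0 < fderiv ℝ R (L.curve B j t) (-(Complex.I • L.velocity B j t)) := by
  obtain ⟨u, hu, he⟩ := h.orientation j t
  rw [OrientedLink.velocity, ← he, OrientedLink.curve, hR.fderiv_apply _ (L.mem_S3 j t)]
  linarith

/-- Close to a point of the link the part of the curve outside of the ball is connected: it is a
half disc in the coordinates given by `R`, `f` and a coordinate along the link. -/
theorem exists_nhds_isPreconnected (hR : B.IsBoundaryDefining R) (h : L.IsCutBy f B) (j : ι)
    (t : ℝ) {W : Set C2} (hW : W ∈ 𝓝 (L.curve B j t)) : ∃ N ⊆ W, N ∈ 𝓝 (L.curve B j t) ∧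
      IsPreconnected (zeroSet f ∩ N ∩ {y | 0 < R y}) ∧
      (zeroSet f ∩ N ∩ {y | 0 < R y}).Nonempty := by
  set q := L.curve B j t with hq
  set τ := L.velocity B j t with hτ
  have hτ0 : τ ≠ 0 := L.velocity_ne_zero B j t
  set X : C2 → ℝ × ℂ × ℝ := fun y => (R y, MvPolynomial.eval y.ofLp f, innerSL ℝ τ y) with hX
  set X' : C2 →L[ℝ] ℝ × ℂ × ℝ := (fderiv ℝ R q).prod
    (((polyFDeriv f q).restrictScalars ℝ).prod (innerSL ℝ τ)) with hX'
  have hXs : ContDiff ℝ ∞ X :=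
    hR.smooth.prodMk ((contDiff_eval f).prodMk (innerSL ℝ τ).contDiff)
  have hXd : HasFDerivAt X X' q :=
    (hR.smooth.differentiable (by simp) q).hasFDerivAt.prodMk
      (((hasFDerivAt_eval f q).restrictScalars ℝ).prodMk (innerSL ℝ τ).hasFDerivAt)
  have hinj : Function.Injective X' := by
    rw [injective_iff_map_eq_zero]
    intro w hw
    have hw1 : fderiv ℝ R q w = 0 := congrArg Prod.fst hw
    have hw2 : polyDiff f q w = 0 := by
      rw [← polyFDeriv_apply]; exact congrArg (fun z => z.2.1) hw
    have hw3 : innerSL ℝ τ w = 0 := congrArg (fun z => z.2.2) hw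
    obtain ⟨z, hz⟩ := eq_smul_of_polyDiff_eq_zero hτ0 (h.polyDiff_velocity j t)
      (h.exists_polyDiff_ne_zero j t) hw2
    have hz' : w = z.re • τ + (-z.im) • (-(Complex.I • τ)) := by
      rw [hz]
      ext i
      simp only [PiLp.smul_apply, PiLp.add_apply, PiLp.neg_apply, smul_eq_mul, Complex.real_smul]
      conv_lhs => rw [← Complex.re_add_im z]
      push_cast
      ring
    have him : z.im = 0 := by
      rw [hz', map_add, map_smul, map_smul, hR.fderiv_velocity L j t, smul_zero, zero_add,
        smul_eq_mul] at hw1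
      simpa using (mul_eq_zero.1 hw1).resolve_right (hR.fderiv_neg_I_smul_velocity h j t).ne'
    have hre : z.re = 0 := by
      rw [hz', him, neg_zero, zero_smul, add_zero, map_smul, smul_eq_mul] at hw3
      refine (mul_eq_zero.1 hw3).resolve_right ?_
      rw [innerSL_apply_apply, real_inner_self_eq_norm_sq]
      exact pow_ne_zero 2 (norm_ne_zero_iff.2 hτ0)
    rw [hz', hre, him]; simp
  have hfin : Module.finrank ℝ C2 = Module.finrank ℝ (ℝ × ℂ × ℝ) := by
    rw [realCoords.toLinearEquiv.finrank_eq]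
    simp
  set E : C2 ≃L[ℝ] ℝ × ℂ × ℝ :=
    (LinearMap.linearEquivOfInjective X'.toLinearMap hinj hfin).toContinuousLinearEquiv with hE
  have hEX : (E : C2 →L[ℝ] ℝ × ℂ × ℝ) = X' := by ext1 v; rfl
  have hs : HasStrictFDerivAt X (E : C2 →L[ℝ] ℝ × ℂ × ℝ) q := by
    rw [hEX, ← hXd.fderiv]; exact hXs.contDiffAt.hasStrictFDerivAt (by simp)
  set e := hs.toOpenPartialHomeomorph X with he
  have heX : ∀ y, e y = X y := fun y => rfl
  have hqs : q ∈ e.source := hs.mem_toOpenPartialHomeomorph_source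
  have hsymm : e.symm (X q) = q := e.left_inv hqs
  have hnear : e.target ∩ e.symm ⁻¹' W ∈ 𝓝 (X q) := by
    refine inter_mem (e.open_target.mem_nhds (e.map_source hqs)) ?_
    refine (e.continuousAt_symm (e.map_source hqs)).preimage_mem_nhds ?_
    rw [heX, hsymm]; exact hW
  obtain ⟨ε, hε, hball⟩ := Metric.mem_nhds_iff.1 hnear
  have hXq : X q = (0, 0, (X q).2.2) := by
    refine Prod.ext (hR.curve_eq_zero L j t) (Prod.ext (h.curve_mem j t) rfl)
  set H : Set (ℝ × ℂ × ℝ) := Metric.ball (X q) ε ∩ {z | 0 < z.1 ∧ z.2.1 = 0} with hH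
  have hHconv : Convex ℝ H := by
    refine (convex_ball _ _).inter ?_
    intro z hz w hw a b ha hb hab
    refine ⟨?_, ?_⟩
    · have h1 := hz.1; have h2 := hw.1
      show 0 < a * z.1 + b * w.1
      rcases ha.eq_or_lt with rfl | ha'
      · have : b = 1 := by linarith
        rw [this]; linarith
      · have := mul_pos ha' h1
        have := mul_nonneg hb h2.le
        linarith
    · show a • z.2.1 + b • w.2.1 = 0
      rw [hz.2, hw.2]; simp
  have heq : zeroSet f ∩ (e.symm '' Metric.ball (X q) ε) ∩ {y | 0 < R y} = e.symm '' H := by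
    ext y
    constructor
    · rintro ⟨⟨hy, z, hz, rfl⟩, hyR⟩
      have hzz : X (e.symm z) = z := e.right_inv (hball hz).1
      refine ⟨z, ⟨hz, ?_, ?_⟩, rfl⟩
      · rw [← hzz]; exact hyR
      · rw [← hzz]; exact hy
    · rintro ⟨z, ⟨hz, hz1, hz2⟩, rfl⟩
      have hzz : X (e.symm z) = z := e.right_inv (hball hz).1
      refine ⟨⟨?_, z, hz, rfl⟩, ?_⟩
      · rw [← hzz] at hz2; exact hz2
      · rw [← hzz] at hz1; exact hz1
  refine ⟨e.symm '' Metric.ball (X q) ε, ?_, ?_, ?_, ?_⟩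
  · rintro _ ⟨z, hz, rfl⟩
    exact (hball hz).2
  · have := e.symm.image_mem_nhds (x := X q) (e.map_source hqs) (Metric.ball_mem_nhds _ hε)
    rwa [hsymm] at this
  · rw [heq]
    refine hHconv.isPreconnected.image _ ?_
    exact e.continuousOn_symm.mono fun z hz => (hball hz.1).1
  · rw [heq]
    refine Nonempty.image _ ⟨(ε / 2, 0, (X q).2.2), ?_, half_pos hε, rfl⟩
    rw [Metric.mem_ball, hXq, Prod.dist_eq, Prod.dist_eq]
    simp [abs_of_pos hε, hε]

end SmoothBall.IsBoundaryDefining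

/-! ### The curve outside of the ball -/

theorem zeroSet_mul (f g : MvPolynomial (Fin 2) ℂ) : zeroSet (f * g) = zeroSet f ∪ zeroSet g := by
  ext y
  simp [zeroSet]

theorem polyDiff_mul {f g : MvPolynomial (Fin 2) ℂ} {p : C2} (hp : p ∈ zeroSet f) (w : C2) :
    polyDiff (f * g) p w = MvPolynomial.eval p.ofLp g * polyDiff f p w := by
  have hp' : MvPolynomial.eval p.ofLp f = 0 := hp
  simp only [polyDiff, Fin.sum_univ_two, Derivation.leibniz, smul_eq_mul, map_add, map_mul, hp']
  ring

theorem SmoothBall.boundary_subset (B : SmoothBall) : B.boundary ⊆ B.carrier :=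
  image_mono SmoothBall.S3_subset_closedBall

/-- A link cut by a curve `A` is also cut by the union of `A` with a curve outside of the ball. -/
theorem OrientedLink.IsCutBy.mul {ι : Type*} {L : OrientedLink ι} {f g : MvPolynomial (Fin 2) ℂ}
    {B : SmoothBall} (h : L.IsCutBy f B) (hg : ∀ y ∈ B.carrier, y ∉ zeroSet g) :
    L.IsCutBy (f * g) B where
  nonconstant := by
    have hf0 : f ≠ 0 := by
      rintro rfl
      simpa using h.nonconstant
    have hg0 : g ≠ 0 := by
      rintro rfl
      refine hg (B.Φ 0) (mem_image_of_mem _ (by simp)) ?_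
      simp [zeroSet]
    rw [MvPolynomial.totalDegree_mul_of_isDomain hf0 hg0]
    exact Nat.add_pos_left h.nonconstant _
  transverse := by
    intro x hx hxz
    have hgx : B.Φ x ∉ zeroSet g := hg _ (B.boundary_subset (mem_image_of_mem _ hx))
    have hxf : B.Φ x ∈ zeroSet f := by
      rw [zeroSet_mul] at hxz
      exact hxz.resolve_right hgx
    obtain ⟨⟨w, hw⟩, u, hu, hxu⟩ := h.transverse x hx hxf
    refine ⟨⟨w, ?_⟩, u, ?_, hxu⟩
    · rw [polyDiff_mul hxf]
      exact mul_ne_zero hgx hw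
    · rw [polyDiff_mul hxf, hu, mul_zero]
  image := by
    rw [h.image, zeroSet_mul, union_inter_distrib_right]
    refine (union_eq_self_of_subset_right ?_).symm
    rintro y ⟨hy, hyB⟩
    exact absurd hy (hg y (B.boundary_subset hyB))
  orientation := h.orientation

/-- The polynomial defining the line on which `parallelForm v` takes the value `c`. -/
noncomputable def linePoly (v : Fin 2 → ℂ) (c : ℂ) : MvPolynomial (Fin 2) ℂ :=
  MvPolynomial.X 0 * MvPolynomial.C (v 1) - MvPolynomial.X 1 * MvPolynomial.C (v 0) -
    MvPolynomial.C c

theorem mem_zeroSet_linePoly {v : Fin 2 → ℂ} {c : ℂ} {y : C2} :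
    y ∈ zeroSet (linePoly v c) ↔ parallelForm v y = c := by
  simp [zeroSet, linePoly, parallelForm, sub_eq_zero]

theorem isPreconnected_line {e v : Fin 2 → ℂ} (hev : e 0 * v 1 - e 1 * v 0 = 1) (c : ℂ) :
    IsPreconnected {y : C2 | parallelForm v y = c} ∧ {y : C2 | parallelForm v y = c}.Nonempty := by
  have heq : {y : C2 | parallelForm v y = c} =
      range fun s : ℂ => (!₂[c * e 0 + s * v 0, c * e 1 + s * v 1] : C2) := by
    ext y
    constructor
    · intro hy
      have hy' : y 0 * v 1 - y 1 * v 0 = c := hy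
      refine ⟨e 0 * y 1 - e 1 * y 0, ?_⟩
      ext i
      fin_cases i
      · show c * e 0 + (e 0 * y 1 - e 1 * y 0) * v 0 = y 0
        linear_combination y 0 * hev - e 0 * hy'
      · show c * e 1 + (e 0 * y 1 - e 1 * y 0) * v 1 = y 1
        linear_combination y 1 * hev - e 1 * hy'
    · rintro ⟨s, rfl⟩
      show _ * v 1 - _ * v 0 = c
      simp only [Matrix.cons_val_zero, Matrix.cons_val_one]
      linear_combination c * hev
  rw [heq]
  refine ⟨isPreconnected_range ?_, range_nonempty _⟩
  refine (PiLp.continuous_toLp 2 _).comp (continuous_pi fun i => ?_)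
  fin_cases i
  · exact continuous_const.add (continuous_id.mul continuous_const)
  · exact continuous_const.add (continuous_id.mul continuous_const)

theorem isPreconnected_norm_gt {C : ℝ} (hC : 0 < C) : IsPreconnected {z : ℂ | C < ‖z‖} := by
  have heq : {z : ℂ | C < ‖z‖} = Complex.exp '' {z : ℂ | Real.log C < z.re} := by
    ext z
    constructor
    · intro hz
      have hz0 : z ≠ 0 := norm_pos_iff.1 (hC.trans hz)
      refine ⟨Complex.log z, ?_, Complex.exp_log hz0⟩
      show _ < (Complex.log z).re
      rw [Complex.log_re]
      exact Real.log_lt_log hC hz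
    · rintro ⟨w, hw, rfl⟩
      show C < ‖Complex.exp w‖
      rw [Complex.norm_exp]
      exact (Real.log_lt_iff_lt_exp hC).1 hw
  rw [heq]
  exact (convex_halfSpace_re_gt _).isPreconnected.image _ Complex.continuous_exp.continuousOn

/-- An affine algebraic curve has no compact relatively open subset. -/
theorem eq_empty_of_isCompact_of_isClosed_diff {f : MvPolynomial (Fin 2) ℂ}
    (hf : 0 < f.totalDegree) {T : Set C2} (hT : T ⊆ zeroSet f) (hc : IsCompact T)
    (hcl : IsClosed (zeroSet f \ T)) : T = ∅ := by
  by_contra hne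
  obtain ⟨e, v, -, hopen, -⟩ := exists_parallelForm_open_proper f hf
  have hcomp : IsCompact (parallelForm v '' T) := hc.image (continuous_parallelForm v)
  have hop : IsOpen (parallelForm v '' T) := by
    rw [isOpen_iff_mem_nhds]
    rintro _ ⟨p, hp, rfl⟩
    refine mem_of_superset (hopen p (hT hp) (zeroSet f \ T)ᶜ
      (hcl.isOpen_compl.mem_nhds fun h => h.2 hp)) (image_mono ?_)
    rintro y ⟨hy, hy'⟩
    by_contra hyT
    exact hy' ⟨hy, hyT⟩
  have huniv := IsClopen.eq_univ ⟨hcomp.isClosed, hop⟩ ((nonempty_iff_ne_empty.2 hne).image _)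
  rw [huniv] at hcomp
  exact noncompact_univ ℂ hcomp

section
variable {f : MvPolynomial (Fin 2) ℂ} {B : SmoothBall} {v : Fin 2 → ℂ} {C : ℝ} {c : ℂ}
  {O₁ O₂ : Set C2}

/-- A part of `A \ B` whose projection misses one value outside of the projection of the ball
lies over a bounded set: over the complement of a disc the projection of this part is both open
and closed. -/
theorem norm_parallelForm_le_of_notMem_image
    (hopen : ∀ p ∈ zeroSet f, ∀ N ∈ 𝓝 p, parallelForm v '' (zeroSet f ∩ N) ∈ 𝓝 (parallelForm v p))
    (hproper : ∀ C, Bornology.IsBounded {y ∈ zeroSet f | ‖parallelForm v y‖ ≤ C})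
    (hC : 0 < C) (hB : ∀ y ∈ B.carrier, ‖parallelForm v y‖ ≤ C) (hc : C < ‖c‖)
    (hO₁ : IsOpen O₁) (hO₂ : IsOpen O₂) (hcov : zeroSet f \ B.carrier ⊆ O₁ ∪ O₂)
    (hdisj : (zeroSet f \ B.carrier) ∩ (O₁ ∩ O₂) = ∅)
    (hmiss : ∀ y ∈ O₁, y ∈ zeroSet f \ B.carrier → parallelForm v y ≠ c) :
    ∀ y ∈ (zeroSet f \ B.carrier) ∩ O₁, ‖parallelForm v y‖ ≤ C := by
  set U := (zeroSet f \ B.carrier) ∩ O₁ with hU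
  set Z := {z : ℂ | C < ‖z‖} with hZ
  have hZo : IsOpen Z := isOpen_lt continuous_const continuous_norm
  set G₁ := parallelForm v '' U ∩ Z with hG₁
  set G₂ := Z \ parallelForm v '' U with hG₂
  have ho₁ : IsOpen G₁ := by
    refine IsOpen.inter ?_ hZo
    rw [isOpen_iff_mem_nhds]
    rintro _ ⟨p, hp, rfl⟩
    refine mem_of_superset (hopen p hp.1.1 (O₁ ∩ B.carrierᶜ)
      ((hO₁.inter B.isCompact_carrier.isClosed.isOpen_compl).mem_nhds ⟨hp.2, hp.1.2⟩))
      (image_mono ?_)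
    rintro y ⟨hy, hy1, hy2⟩
    exact ⟨⟨hy, hy2⟩, hy1⟩
  have ho₂ : IsOpen G₂ := by
    rw [isOpen_iff_mem_nhds]
    rintro z ⟨hz, hzU⟩
    have hz' : C < ‖z‖ := hz
    set T := {y ∈ zeroSet f | ‖parallelForm v y‖ ≤ ‖z‖ + 1} ∩
      ({y | (C + ‖z‖) / 2 ≤ ‖parallelForm v y‖} ∩ O₂ᶜ) with hT
    have hcn : Continuous fun y => ‖parallelForm v y‖ := (continuous_parallelForm v).norm
    have hTc : IsCompact T := by
      refine Metric.isCompact_of_isClosed_isBounded ?_ ((hproper _).subset inter_subset_left)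
      exact ((isClosed_zeroSet f).inter (isClosed_le hcn continuous_const)).inter
        ((isClosed_le continuous_const hcn).inter hO₂.isClosed_compl)
    have hTU : T ⊆ U := by
      rintro y ⟨⟨hy, -⟩, hy1, hy2⟩
      have hy1' : (C + ‖z‖) / 2 ≤ ‖parallelForm v y‖ := hy1
      have hyB : y ∉ B.carrier := fun hyB => by linarith [hB y hyB]
      exact ⟨⟨hy, hyB⟩, (hcov ⟨hy, hyB⟩).resolve_right hy2⟩
    have hzT : z ∉ parallelForm v '' T := fun h => hzU (image_mono hTU h)
    have hnear : {w : ℂ | (C + ‖z‖) / 2 < ‖w‖ ∧ ‖w‖ < ‖z‖ + 1} ∈ 𝓝 z := by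
      refine IsOpen.mem_nhds ((isOpen_lt continuous_const continuous_norm).inter
        (isOpen_lt continuous_norm continuous_const)) ⟨?_, ?_⟩
      · show (C + ‖z‖) / 2 < ‖z‖
        linarith
      · show ‖z‖ < ‖z‖ + 1
        linarith
    filter_upwards [hnear, (hTc.image (continuous_parallelForm v)).isClosed.isOpen_compl.mem_nhds
      hzT, hZo.mem_nhds hz] with w hw hwT hwZ
    refine ⟨hwZ, ?_⟩
    rintro ⟨y, hy, rfl⟩
    refine hwT (mem_image_of_mem _ ⟨⟨hy.1.1, hw.2.le⟩, hw.1.le, fun hyO => ?_⟩)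
    exact notMem_empty y (hdisj ▸ ⟨hy.1, hy.2, hyO⟩)
  intro y hy
  by_contra hlt
  have hyZ : parallelForm v y ∈ Z := not_le.1 hlt
  obtain ⟨z, -, hz1, hz2⟩ := isPreconnected_norm_gt hC G₁ G₂ ho₁ ho₂
    (fun z hz => by
      by_cases h : z ∈ parallelForm v '' U
      · exact Or.inl ⟨h, hz⟩
      · exact Or.inr ⟨hz, h⟩)
    ⟨_, hyZ, mem_image_of_mem _ hy, hyZ⟩
    ⟨c, hc, hc, by
      rintro ⟨y, hy, rfl⟩
      exact hmiss y hy.2 hy.1 rfl⟩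
  exact hz2.2 hz1.1

end

/-- If `L` is not a strong `ℂ`-boundary, the part of the curve outside of the ball falls into two
closed pieces, one of them compact, and both reach the ball. The union of the curve with a line that
avoids the ball cuts the same link, so it is disconnected outside of the ball, and a piece without
the line is bounded. -/
theorem OrientedLink.IsCutBy.exists_decomposition {ι : Type*} {L : OrientedLink ι}
    {f : MvPolynomial (Fin 2) ℂ} {B : SmoothBall} {R : C2 → ℝ} (h : L.IsCutBy f B)
    (hR : B.IsBoundaryDefining R) (hL : ¬ L.IsStrongCBoundary) :
    ∃ K₀ K₁ : Set C2, IsCompact K₀ ∧ IsClosed K₁ ∧ Disjoint K₀ K₁ ∧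
      K₀ ∪ K₁ = zeroSet f ∩ {y | 0 ≤ R y} ∧ (∃ j t, L.curve B j t ∈ K₀) ∧
      ∃ j t, L.curve B j t ∈ K₁ := by
  obtain ⟨e, v, hev, hopen, hproper⟩ := exists_parallelForm_open_proper f h.nonconstant
  obtain ⟨C, hC, hBC⟩ : ∃ C > 0, ∀ y ∈ B.carrier, ‖parallelForm v y‖ ≤ C := by
    obtain ⟨C, hC⟩ := B.isCompact_carrier.exists_bound_of_continuousOn
      (continuous_parallelForm v).continuousOn
    exact ⟨max C 1, by positivity, fun y hy => (hC y hy).trans (le_max_left _ _)⟩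
  set c : ℂ := ((C + 1 : ℝ) : ℂ) with hc
  have hcC : C < ‖c‖ := by
    rw [hc, Complex.norm_real, Real.norm_of_nonneg (by linarith)]; linarith
  set ℓ := {y : C2 | parallelForm v y = c} with hℓ
  have hℓz : zeroSet (linePoly v c) = ℓ := by
    ext y; exact mem_zeroSet_linePoly
  have hℓB : ∀ y ∈ B.carrier, y ∉ ℓ := fun y hy hyℓ => by
    have h1 : parallelForm v y = c := hyℓ
    have := hBC y hy
    rw [h1] at this
    linarith
  obtain ⟨hℓc, y₀, hy₀⟩ := isPreconnected_line hev c
  have hcut := h.mul (g := linePoly v c) (by rwa [hℓz])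
  have hnot : ¬ IsPreconnected ((zeroSet f ∪ ℓ) \ B.carrier) := fun hpre => by
    refine hL ⟨_, B, hcut, ?_⟩
    rw [zeroSet_mul, hℓz]
    exact ⟨⟨y₀, Or.inr hy₀, fun hB => hℓB _ hB hy₀⟩, hpre⟩
  -- the two open sets of a separation can be exchanged so that the line lies in the second one
  obtain ⟨O₁, O₂, hO₁, hO₂, hcov, hne, hdisj, hℓ1⟩ : ∃ O₁ O₂ : Set C2, IsOpen O₁ ∧ IsOpen O₂ ∧
      (zeroSet f ∪ ℓ) \ B.carrier ⊆ O₁ ∪ O₂ ∧ (((zeroSet f ∪ ℓ) \ B.carrier) ∩ O₁).Nonempty ∧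
      ((zeroSet f ∪ ℓ) \ B.carrier) ∩ (O₁ ∩ O₂) = ∅ ∧ ℓ ∩ O₁ = ∅ := by
    unfold IsPreconnected at hnot
    push Not at hnot
    obtain ⟨O₁, O₂, hO₁, hO₂, hcov, hne1, hne2, hdisj⟩ := hnot
    have hℓsub : ℓ ⊆ (zeroSet f ∪ ℓ) \ B.carrier := fun y hy => ⟨Or.inr hy, fun hB => hℓB _ hB hy⟩
    rcases (ℓ ∩ O₁).eq_empty_or_nonempty with h1 | h1
    · exact ⟨O₁, O₂, hO₁, hO₂, hcov, hne1, hdisj, h1⟩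
    · rcases (ℓ ∩ O₂).eq_empty_or_nonempty with h2 | h2
      · exact ⟨O₂, O₁, hO₂, hO₁, hcov.trans (union_comm O₁ O₂).subset, hne2,
          by rwa [inter_comm O₂], h2⟩
      · obtain ⟨y, hy, hyO⟩ := hℓc O₁ O₂ hO₁ hO₂ (hℓsub.trans hcov) h1 h2
        exact absurd hdisj (nonempty_iff_ne_empty.1 ⟨y, hℓsub hy, hyO⟩)
  have hsub : zeroSet f \ B.carrier ⊆ (zeroSet f ∪ ℓ) \ B.carrier :=
    sdiff_subset_sdiff_left subset_union_left
  have hcov' := hsub.trans hcov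
  have hdisj' : (zeroSet f \ B.carrier) ∩ (O₁ ∩ O₂) = ∅ :=
    subset_empty_iff.1 ((inter_subset_inter_left _ hsub).trans hdisj.subset)
  set U := (zeroSet f \ B.carrier) ∩ O₁ with hU
  set V := (zeroSet f \ B.carrier) ∩ O₂ with hV
  have hUne : U.Nonempty := by
    obtain ⟨y, ⟨hy | hy, hyB⟩, hyO⟩ := hne
    · exact ⟨y, ⟨hy, hyB⟩, hyO⟩
    · exact absurd hℓ1 (nonempty_iff_ne_empty.1 ⟨y, hy, hyO⟩)
  have hUC := norm_parallelForm_le_of_notMem_image hopen hproper hC hBC hcC hO₁ hO₂ hcov' hdisj'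
    fun y hyO _ hyc => absurd hℓ1 (nonempty_iff_ne_empty.1 ⟨y, hyc, hyO⟩)
  have hRcont := hR.smooth.continuous
  have hpos : ∀ y, y ∉ B.carrier ↔ 0 < R y := fun y => by
    rw [← hR.le_zero_iff, not_le]
  have hAB : zeroSet f \ B.carrier = zeroSet f ∩ {y | 0 < R y} := by
    ext y; exact and_congr_right fun _ => hpos y
  have hclosedA : IsClosed (zeroSet f ∩ {y | 0 ≤ R y}) :=
    (isClosed_zeroSet f).inter (isClosed_le continuous_const hRcont)
  have hABsub : zeroSet f \ B.carrier ⊆ zeroSet f ∩ {y | 0 ≤ R y} := fun y hy =>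
    ⟨hy.1, ((hpos y).1 hy.2).le⟩
  have hUsub : closure U ⊆ zeroSet f ∩ {y | 0 ≤ R y} :=
    closure_minimal (inter_subset_left.trans hABsub) hclosedA
  have hVsub : closure V ⊆ zeroSet f ∩ {y | 0 ≤ R y} :=
    closure_minimal (inter_subset_left.trans hABsub) hclosedA
  have hUcomp : IsCompact (closure U) :=
    ((hproper C).subset fun y hy => ⟨hy.1.1, hUC y hy⟩).isCompact_closure
  have hUV : zeroSet f \ B.carrier = U ∪ V := by
    rw [hU, hV, ← inter_union_distrib_left, inter_eq_left.2 hcov']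
  have hcurve : ∀ y ∈ zeroSet f, R y = 0 → ∃ j t, L.curve B j t = y := fun y hy hRy =>
    h.exists_curve_eq hy ((hR.zero_iff y).1 hRy)
  have hunion : closure U ∪ closure V = zeroSet f ∩ {y | 0 ≤ R y} := by
    refine subset_antisymm (union_subset hUsub hVsub) ?_
    rintro y ⟨hy, hRy⟩
    rw [← closure_union, ← hUV]
    rcases (show 0 ≤ R y from hRy).eq_or_lt with hRy | hRy
    · obtain ⟨j, t, rfl⟩ := hcurve y hy hRy.symm
      rw [mem_closure_iff_nhds]
      intro W hW
      obtain ⟨N, hNW, -, -, z, ⟨hz, hzN⟩, hzR⟩ := hR.exists_nhds_isPreconnected h j t hW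
      exact ⟨z, hNW hzN, hz, (hpos z).2 hzR⟩
    · exact subset_closure ⟨hy, (hpos y).2 hRy⟩
  have hdisjoint : Disjoint (closure U) (closure V) := by
    rw [Set.disjoint_left]
    intro y hyU hyV
    obtain ⟨hy, hRy⟩ := hUsub hyU
    rcases (show 0 ≤ R y from hRy).eq_or_lt with hRy | hRy
    · obtain ⟨j, t, rfl⟩ := hcurve y hy hRy.symm
      obtain ⟨N, -, hN, hpre, -⟩ := hR.exists_nhds_isPreconnected h j t univ_mem
      obtain ⟨a, haN, haU⟩ := mem_closure_iff_nhds.1 hyU N hN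
      obtain ⟨b, hbN, hbV⟩ := mem_closure_iff_nhds.1 hyV N hN
      have hNs : zeroSet f ∩ N ∩ {y | 0 < R y} ⊆ zeroSet f \ B.carrier := fun z hz =>
        ⟨hz.1.1, (hpos z).2 hz.2⟩
      obtain ⟨z, hz, hzO⟩ := hpre O₁ O₂ hO₁ hO₂ (hNs.trans hcov')
        ⟨a, ⟨⟨haU.1.1, haN⟩, (hpos a).1 haU.1.2⟩, haU.2⟩
        ⟨b, ⟨⟨hbV.1.1, hbN⟩, (hpos b).1 hbV.1.2⟩, hbV.2⟩
      exact notMem_empty z (hdisj' ▸ ⟨hNs hz, hzO⟩)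
    · rcases hcov' ⟨hy, (hpos y).2 hRy⟩ with hyO | hyO
      · obtain ⟨b, hbO, hbV⟩ := mem_closure_iff_nhds.1 hyV O₁ (hO₁.mem_nhds hyO)
        exact notMem_empty b (hdisj' ▸ ⟨hbV.1, hbO, hbV.2⟩)
      · obtain ⟨a, haO, haU⟩ := mem_closure_iff_nhds.1 hyU O₂ (hO₂.mem_nhds hyO)
        exact notMem_empty a (hdisj' ▸ ⟨haU.1, haU.2, haO⟩)
  refine ⟨closure U, closure V, hUcomp, isClosed_closure, hdisjoint, hunion, ?_, ?_⟩
  · -- otherwise `closure U` would be a compact relatively open subset of the curve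
    by_contra hno
    have hno' : ∀ y ∈ closure U, R y ≠ 0 := fun y hy hRy => by
      obtain ⟨j, t, rfl⟩ := hcurve y (hUsub hy).1 hRy
      exact hno ⟨j, t, hy⟩
    have hdiff : zeroSet f \ closure U = (zeroSet f ∩ B.carrier) ∪ closure V := by
      ext y
      constructor
      · rintro ⟨hy, hyU⟩
        by_cases hyB : y ∈ B.carrier
        · exact Or.inl ⟨hy, hyB⟩
        · exact Or.inr ((hunion.superset (hABsub ⟨hy, hyB⟩)).resolve_left hyU)
      · rintro (⟨hy, hyB⟩ | hyV)
        · refine ⟨hy, fun hyU => hno' y hyU ?_⟩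
          exact le_antisymm ((hR.le_zero_iff y).2 hyB) (hUsub hyU).2
        · exact ⟨(hVsub hyV).1, fun hyU => hdisjoint.notMem_of_mem_left hyU hyV⟩
    have := eq_empty_of_isCompact_of_isClosed_diff h.nonconstant (fun y hy => (hUsub hy).1) hUcomp
      (hdiff ▸ ((isClosed_zeroSet f).inter B.isCompact_carrier.isClosed).union isClosed_closure)
    exact hUne.ne_empty (subset_empty_iff.1 (subset_closure.trans this.subset))
  · -- otherwise the rest of the curve would be a compact relatively open subset
    by_contra hno
    have hno' : ∀ y ∈ closure V, R y ≠ 0 := fun y hy hRy => by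
      obtain ⟨j, t, rfl⟩ := hcurve y (hVsub hy).1 hRy
      exact hno ⟨j, t, hy⟩
    have hdiff : zeroSet f \ ((zeroSet f ∩ B.carrier) ∪ closure U) = closure V := by
      ext y
      constructor
      · rintro ⟨hy, hyU⟩
        have hyB : y ∉ B.carrier := fun hyB => hyU (Or.inl ⟨hy, hyB⟩)
        exact (hunion.superset (hABsub ⟨hy, hyB⟩)).resolve_left fun h => hyU (Or.inr h)
      · intro hyV
        refine ⟨(hVsub hyV).1, ?_⟩
        rintro (⟨-, hyB⟩ | hyU)
        · exact hno' y hyV (le_antisymm ((hR.le_zero_iff y).2 hyB) (hVsub hyV).2)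
        · exact hdisjoint.notMem_of_mem_left hyU hyV
    have := eq_empty_of_isCompact_of_isClosed_diff h.nonconstant
      (union_subset inter_subset_left fun y hy => (hUsub hy).1)
      ((B.isCompact_carrier.inter_left (isClosed_zeroSet f)).union hUcomp)
      (hdiff ▸ isClosed_closure)
    exact hUne.ne_empty (subset_empty_iff.1
      ((subset_closure.trans subset_union_right).trans this.subset))

/-! ### A function vanishing on one piece of the curve -/

theorem exists_contDiff_one_nhdsSet_zero_nhdsSet {E : Type*} [NormedAddCommGroup E]
    [NormedSpace ℝ E] [FiniteDimensional ℝ E] {K₀ K₁ : Set E} (hK₀ : IsClosed K₀)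
    (hK₁ : IsClosed K₁) (hd : Disjoint K₀ K₁) :
    ∃ χ : E → ℝ, ContDiff ℝ ∞ χ ∧ (∀ᶠ y in 𝓝ˢ K₀, χ y = 1) ∧ (∀ᶠ y in 𝓝ˢ K₁, χ y = 0) ∧
      ∀ y, χ y ∈ Icc (0 : ℝ) 1 := by
  obtain ⟨χ, h0, h1, h⟩ := exists_contMDiffMap_zero_one_nhds_of_isClosed
    (modelWithCornersSelf ℝ E) hK₁ hK₀ hd.symm (n := ⊤)
  exact ⟨χ, χ.contMDiff.contDiff, h1, h0, h⟩

theorem notMem_tsupport_of_nhdsSet {E : Type*} [TopologicalSpace E] {χ : E → ℝ} {K : Set E}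
    (h : ∀ᶠ y in 𝓝ˢ K, χ y = 0) {y : E} (hy : y ∈ K) : y ∉ tsupport χ := by
  rw [notMem_tsupport_iff_eventuallyEq]
  exact (eventually_nhdsSet_iff_forall.1 h) y hy

/-- The endomorphism of `ℂ²` with matrix `!![a, b; c, d]`. -/
noncomputable def matrixCLM (a b c d : ℂ) : ℂ × ℂ →L[ℂ] ℂ × ℂ :=
  a • (ContinuousLinearMap.fst ℂ ℂ ℂ).prod 0 + b • (ContinuousLinearMap.snd ℂ ℂ ℂ).prod 0 +
    c • (0 : ℂ × ℂ →L[ℂ] ℂ).prod (ContinuousLinearMap.fst ℂ ℂ ℂ) +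
    d • (0 : ℂ × ℂ →L[ℂ] ℂ).prod (ContinuousLinearMap.snd ℂ ℂ ℂ)

theorem matrixCLM_apply (a b c d : ℂ) (u : ℂ × ℂ) :
    matrixCLM a b c d u = (a * u.1 + b * u.2, c * u.1 + d * u.2) := by
  simp [matrixCLM]

theorem continuous_matrixCLM {X : Type*} [TopologicalSpace X] {a b c d : X → ℂ}
    (ha : Continuous a) (hb : Continuous b) (hc : Continuous c) (hd : Continuous d) :
    Continuous fun y => matrixCLM (a y) (b y) (c y) (d y) := by
  unfold matrixCLM
  fun_prop

open ComplexConjugate in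
/-- If the zero set of `f` outside of the interior of a ball is the disjoint union of a compact
set `K₀` and a closed set `K₁`, some smooth function `F` is a nonzero multiple of `f` along `K₀`,
does not vanish elsewhere outside of the interior of the ball, and is `1` far away.

With cutoff functions `χ` and `χ₂` and `α = χ₂ |f|² + 1 - χ₂`, the matrix with rows `(α, χ f)` and
`(χ f̄, χ²)` has rank one, and divided by its trace it is a family `P` of idempotents. If `P w` does
not vanish for some smooth `w`, then `F = α w₁ + χ f w₂` vanishes along `K₀` only. Such `w` exists
because the family extends to the complement of the centre of the ball. -/
theorem SmoothBall.IsBoundaryDefining.exists_contDiff_vanishing_on {B : SmoothBall}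
    {R : C2 → ℝ} (hR : B.IsBoundaryDefining R) {f : C2 → ℂ} (hf : ContDiff ℝ ∞ f)
    {K₀ K₁ : Set C2} (hK₀ : IsCompact K₀) (hK₁ : IsClosed K₁) (hd : Disjoint K₀ K₁)
    (hK : K₀ ∪ K₁ = {y | f y = 0} ∩ {y | 0 ≤ R y}) :
    ∃ F k : C2 → ℂ, ContDiff ℝ ∞ F ∧ ContDiff ℝ ∞ k ∧ (∃ r, ∀ y, r < ‖y‖ → F y = 1) ∧
      (∀ y, 0 ≤ R y → F y = 0 → y ∈ K₀) ∧ ∀ y ∈ K₀, k y ≠ 0 ∧ F =ᶠ[𝓝 y] fun z => f z * k z := by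
  obtain ⟨r₀, hr₀⟩ := hK₀.isBounded.subset_ball 0
  obtain ⟨χ, hχ, hχ1, hχ0, hχI⟩ := exists_contDiff_one_nhdsSet_zero_nhdsSet (K₀ := K₀)
    (K₁ := K₁ ∪ (Metric.ball 0 r₀)ᶜ) hK₀.isClosed
    (hK₁.union Metric.isOpen_ball.isClosed_compl)
    (disjoint_union_right.2 ⟨hd, disjoint_compl_right_iff_subset.2 hr₀⟩)
  obtain ⟨χ₂, hχ₂, hχ₂1, hχ₂0, hχ₂I⟩ := exists_contDiff_one_nhdsSet_zero_nhdsSet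
    (K₀ := tsupport χ) (K₁ := K₁ ∪ (Metric.ball 0 r₀)ᶜ) (isClosed_tsupport χ)
    (hK₁.union Metric.isOpen_ball.isClosed_compl)
    (Set.disjoint_left.2 fun y hy hy' => notMem_tsupport_of_nhdsSet hχ0 hy' hy)
  have hχ₂χ : ∀ y, χ y ≠ 0 → χ₂ y = 1 := fun y hy =>
    hχ₂1.self_of_nhdsSet y (subset_tsupport χ hy)
  -- `α = |f|²` where `χ ≠ 0`, which makes the determinant of the matrix vanish
  set α : C2 → ℝ := fun y => χ₂ y * ‖f y‖ ^ 2 + (1 - χ₂ y) with hα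
  have hαs : ContDiff ℝ ∞ α := (hχ₂.mul (hf.norm_sq ℝ)).add (contDiff_const.sub hχ₂)
  have hα0 : ∀ y, 0 ≤ α y := fun y =>
    add_nonneg (mul_nonneg (hχ₂I y).1 (sq_nonneg _)) (sub_nonneg.2 (hχ₂I y).2)
  have hαχ : ∀ y, χ y ≠ 0 → (α y : ℂ) = f y * conj (f y) := fun y hy => by
    simp only [hα, hχ₂χ y hy]
    rw [Complex.mul_conj, Complex.normSq_eq_norm_sq]
    norm_num
  set D : C2 → ℝ := fun y => α y + χ y ^ 2 with hD
  have hDs : ContDiff ℝ ∞ D := hαs.add (hχ.pow 2)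
  have hDpos : ∀ y, 0 ≤ R y → 0 < D y := by
    intro y hy
    refine (add_nonneg (hα0 y) (sq_nonneg _)).lt_of_ne' fun h0 => ?_
    have h1 : χ y = 0 := by
      have := hα0 y
      have h2 := sq_nonneg (χ y)
      exact pow_eq_zero_iff (two_ne_zero) |>.1 (by linarith)
    have h2 : χ₂ y * ‖f y‖ ^ 2 + (1 - χ₂ y) = 0 := by
      have h3 : α y + χ y ^ 2 = 0 := h0
      rw [h1] at h3
      simpa using h3
    have h3 := mul_nonneg (hχ₂I y).1 (sq_nonneg ‖f y‖)
    have h4 := (hχ₂I y).2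
    have h5 : χ₂ y = 1 := by linarith
    have h6 : f y = 0 := by
      rw [h5] at h2
      simpa using h2
    rcases hK.superset ⟨h6, hy⟩ with h | h
    · rw [hχ1.self_of_nhdsSet y h] at h1
      exact one_ne_zero h1
    · rw [hχ₂0.self_of_nhdsSet y (Or.inl h)] at h5
      exact zero_ne_one h5
  set P : C2 → (ℂ × ℂ →L[ℂ] ℂ × ℂ) := fun y => ((D y : ℂ)⁻¹) •
    matrixCLM (α y) (χ y * f y) (χ y * conj (f y)) (χ y ^ 2) with hP
  have hPapply : ∀ y u, P y u = ((D y : ℂ)⁻¹ * (α y * u.1 + χ y * f y * u.2),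
      (D y : ℂ)⁻¹ * (χ y * conj (f y) * u.1 + χ y ^ 2 * u.2)) := fun y u => by
    simp only [hP, smul_apply, matrixCLM_apply, Prod.smul_mk, smul_eq_mul]
  have hPcont : ContinuousOn P {y | 0 ≤ R y} := by
    have hof : Continuous fun y => (χ y : ℂ) := Complex.continuous_ofReal.comp hχ.continuous
    have haf : Continuous fun y => (α y : ℂ) := Complex.continuous_ofReal.comp hαs.continuous
    have hcf : Continuous fun y => conj (f y) := Complex.continuous_conj.comp hf.continuous
    have h1 : ContinuousOn (fun y => (D y : ℂ)⁻¹) {y | 0 ≤ R y} :=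
      ContinuousOn.inv₀ (Complex.continuous_ofReal.comp hDs.continuous).continuousOn
        fun y hy => Complex.ofReal_ne_zero.2 (hDpos y hy).ne'
    exact h1.smul (continuous_matrixCLM haf (hof.mul hf.continuous) (hof.mul hcf)
      (hof.pow 2)).continuousOn
  have hPidem : ∀ y, 0 ≤ R y → ∀ u, P y (P y u) = P y u := by
    intro y hy u
    have hD0 : (D y : ℂ) ≠ 0 := Complex.ofReal_ne_zero.2 (hDpos y hy).ne'
    have hDe : (D y : ℂ) = α y + χ y ^ 2 := by simp [hD]
    simp only [hPapply]
    by_cases hχy : χ y = 0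
    · have hα' : (α y : ℂ) ≠ 0 := by
        rw [hDe, hχy] at hD0; simpa using hD0
      rw [hDe]
      simp [hχy, hα']
    · have hαe := hαχ y hχy
      rw [hαe] at hDe ⊢
      refine Prod.ext ?_ ?_
      · dsimp only
        field_simp
        rw [hDe]
        ring
      · dsimp only
        field_simp
        rw [hDe]
        ring
  obtain ⟨ρ, hρc, hρid, hρM⟩ := hR.exists_retraction
  set p := B.Φ 0 with hp
  have hRp : R p < 0 := (hR.neg_iff p).2 (mem_image_of_mem _ (by simp))
  have hRc : Continuous R := hR.smooth.continuous
  obtain ⟨δ, hδ, hδball⟩ := Metric.mem_nhds_iff.1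
    ((isOpen_lt hRc continuous_const).mem_nhds hRp)
  obtain ⟨r₁, hr₁⟩ := B.isCompact_carrier.isBounded.subset_ball 0
  have hfar : ∀ y : C2, max r₀ r₁ ≤ ‖y‖ → 0 ≤ R y ∧ χ y = 0 ∧ χ₂ y = 0 := by
    intro y hy
    have hy0 : y ∈ (Metric.ball (0 : C2) r₀)ᶜ := by
      simpa using (le_max_left _ _).trans hy
    refine ⟨?_, hχ0.self_of_nhdsSet y (Or.inr hy0), hχ₂0.self_of_nhdsSet y (Or.inr hy0)⟩
    by_contra hlt
    have := hr₁ ((hR.le_zero_iff y).1 (le_of_lt (not_le.1 hlt)))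
    rw [mem_ball_zero_iff] at this
    exact absurd ((le_max_right _ _).trans hy) this.not_ge
  have hPfar : ∀ y : C2, χ y = 0 → χ₂ y = 0 → P y = matrixCLM 1 0 0 0 := fun y h1 h2 => by
    simp [hP, hD, hα, h1, h2]
  have hnorm : ∀ y : C2, ‖y - p‖ ≤ ‖y‖ + ‖p‖ := fun y => norm_sub_le y p
  have hnorm' : ∀ y : C2, ‖y‖ - ‖p‖ ≤ ‖y - p‖ := fun y => norm_sub_norm_le y p
  have hnorm2 : ∀ y : C2, ‖y - p‖ - ‖p‖ ≤ ‖y‖ := fun y => by linarith [hnorm y]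
  obtain ⟨w, hw, ⟨R₁, hR₁⟩, hne⟩ := exists_contDiff_apply_ne_zero (p := p) (Q := fun y => P (ρ y))
    (hPcont.comp hρc fun y hy => hρM y hy) (fun y hy u => hPidem _ (hρM y hy) u)
    (R₀ := max r₀ r₁ + ‖p‖) hδ (Q₀ := matrixCLM 1 0 0 0)
    (fun y hy => by
      obtain ⟨h1, h2, h3⟩ := hfar y (by linarith [hnorm2 y])
      simp only [hρid y h1, hPfar y h2 h3])
    (v := (1, 0)) (by simp) (by simp [matrixCLM_apply])
    (M := {y | 0 ≤ R y}) (isClosed_le continuous_const hRc) (fun y hy => by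
      by_contra hlt
      have h1 : R y < 0 := hδball (mem_ball_iff_norm.2 (not_le.1 hlt))
      exact absurd hy h1.not_ge)
  have hof : ∀ {g : C2 → ℝ}, ContDiff ℝ ∞ g → ContDiff ℝ ∞ fun y => (g y : ℂ) := fun hg =>
    Complex.ofRealCLM.contDiff.comp hg
  refine ⟨fun y => α y * (w y).1 + χ y * f y * (w y).2, fun y => conj (f y) * (w y).1 + (w y).2,
    ((hof hαs).mul hw.fst).add (((hof hχ).mul hf).mul hw.snd),
    ((Complex.conjCLE.contDiff.comp hf).mul hw.fst).add hw.snd,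
    ⟨max (max r₀ r₁) (R₁ + ‖p‖), fun y hy => ?_⟩, fun y hy hF => ?_, fun y hy => ⟨?_, ?_⟩⟩
  · obtain ⟨-, h2, h3⟩ := hfar y ((le_max_left _ _).trans hy.le)
    have h4 := (le_max_right _ _).trans_lt hy
    have h5 : w y = (1, 0) := hR₁ y (by linarith [hnorm' y])
    simp [hα, h2, h3, h5]
  · have hne' := hne y hy
    simp only [hρid y hy, hPapply] at hne'
    have hF' : (α y : ℂ) * (w y).1 + χ y * f y * (w y).2 = 0 := hF
    rw [hF', mul_zero] at hne'
    have h2 : χ y * (conj (f y) * (w y).1 + χ y * (w y).2) ≠ 0 := fun h0 => hne' (by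
      have : (χ y * conj (f y) * (w y).1 + χ y ^ 2 * (w y).2 : ℂ) = 0 := by
        rw [← h0]; ring
      rw [this, mul_zero]; rfl)
    have hχy : χ y ≠ 0 := fun h => h2 (by simp [h])
    have h3 : f y * (conj (f y) * (w y).1 + χ y * (w y).2) = 0 := by
      rw [hαχ y hχy] at hF'
      rw [← hF']; ring
    have h4 : f y = 0 := (mul_eq_zero.1 h3).resolve_right (right_ne_zero_of_mul h2)
    rcases hK.superset ⟨h4, hy⟩ with h | h
    · exact h
    · exact absurd (hχ0.self_of_nhdsSet y (Or.inl h)) hχy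
  · obtain ⟨h1, h2⟩ := hK.subset (Or.inl hy)
    have hne' := hne y h2
    have hχy : χ y = 1 := hχ1.self_of_nhdsSet y hy
    have h1' : f y = 0 := h1
    have hα' : (α y : ℂ) = 0 := by
      rw [hαχ y (by rw [hχy]; exact one_ne_zero), h1', zero_mul]
    simp only [hρid y h2, hPapply, hα', hχy, h1'] at hne'
    intro h0
    refine hne' ?_
    replace h0 : conj (f y) * (w y).1 + (w y).2 = 0 := h0
    rw [h1', map_zero, zero_mul, zero_add] at h0
    simp [h0]
  · filter_upwards [eventually_nhdsSet_iff_forall.1 hχ1 y hy] with z hz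
    rw [hαχ z (by rw [hz]; exact one_ne_zero), hz, Complex.ofReal_one]
    ring

/-! ### Winding numbers and defining functions -/

/-- The winding number of a closed curve around `0` is the integral of the logarithmic derivative, up
to the factor `2πi`. -/
theorem exists_hasWindingNumber {c : ℝ → ℂ} (hc : ContDiff ℝ ∞ c) (h0 : ∀ t, c t ≠ 0)
    (h1 : c 1 = c 0) : ∃ m : ℤ, HasWindingNumber c m ∧
      ∫ t in (0 : ℝ)..1, deriv c t / c t = 2 * Real.pi * Complex.I * m := by
  have hcont : Continuous fun t => deriv c t / c t :=
    (hc.continuous_deriv (by simp)).div hc.continuous h0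
  set l : ℝ → ℂ := fun t => Complex.log (c 0) + ∫ s in (0 : ℝ)..t, deriv c s / c s with hl
  have hld : ∀ t, HasDerivAt l (deriv c t / c t) t := fun t =>
    (intervalIntegral.integral_hasDerivAt_right (hcont.intervalIntegrable _ _)
      hcont.aestronglyMeasurable.stronglyMeasurableAtFilter hcont.continuousAt).const_add _
  have hconst : ∀ t, c t * Complex.exp (-l t) = 1 := by
    intro t
    have hd : ∀ t, HasDerivAt (fun t => c t * Complex.exp (-l t)) 0 t := fun t => by
      have h := ((hc.differentiable (by simp)) t).hasDerivAt.mul (hld t).neg.cexp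
      have e : deriv c t * Complex.exp (-l t) +
          c t * (Complex.exp (-l t) * -(deriv c t / c t)) = 0 := by
        have := h0 t
        field_simp
        ring
      exact e ▸ h
    have := is_const_of_deriv_eq_zero (fun t => (hd t).differentiableAt) (fun t => (hd t).deriv) t 0
    rw [this]
    simp only [hl, intervalIntegral.integral_same, add_zero]
    rw [Complex.exp_neg, Complex.exp_log (h0 0), mul_inv_cancel₀ (h0 0)]
  have hexp : ∀ t, c t = Complex.exp (l t) := fun t => by
    have := hconst t
    rw [Complex.exp_neg, ← div_eq_mul_inv, div_eq_one_iff_eq (Complex.exp_ne_zero _)] at this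
    exact this
  have h10 : Complex.exp (l 1) = Complex.exp (l 0) := by rw [← hexp, ← hexp, h1]
  obtain ⟨m, hm⟩ := Complex.exp_eq_exp_iff_exists_int.1 h10
  have hm' : l 1 - l 0 = 2 * Real.pi * Complex.I * m := by rw [hm]; ring
  refine ⟨m, ⟨l, ?_, hexp, hm'⟩, ?_⟩
  · exact continuous_iff_continuousAt.2 fun t => (hld t).continuousAt
  · rw [← hm']
    simp [hl]

theorem realInner_add (x u v : C2) : realInner x (u + v) = realInner x u + realInner x v := by
  simp [realInner]

theorem realInner_smul (x u : C2) (s : ℝ) : realInner x (s • u) = s * realInner x u := by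
  simp only [realInner, PiLp.inner_apply, Fin.sum_univ_two, PiLp.smul_apply]
  simp
  ring

theorem realInner_self {x : C2} (hx : x ∈ S3) : realInner x x = 1 := by
  have h1 : ‖x‖ = 1 := by rwa [S3, mem_sphere_zero_iff_norm] at hx
  simp only [realInner, inner_self_eq_norm_sq_to_K, h1]
  simp

theorem OrientedLink.realInner_deriv {ι : Type*} (L : OrientedLink ι) (j : ι) (t : ℝ) :
    realInner (L.γ j t) (deriv (L.γ j) t) = 0 := by
  obtain ⟨A, hA, hAu⟩ := hasFDerivAt_norm_sq_C2 (L.γ j t)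
  have h1 := hA.comp_hasDerivAt t ((L.smooth j).differentiable (by simp) t).hasDerivAt
  have h2 : HasDerivAt (fun s => ‖L.γ j s‖ ^ 2) 0 t := by
    have : (fun s => ‖L.γ j s‖ ^ 2) = fun _ => (1 : ℝ) := funext fun s => by
      have := L.mem_S3 j s
      rw [S3, mem_sphere_zero_iff_norm] at this
      rw [this, one_pow]
    rw [this]; exact hasDerivAt_const t 1
  have h3 := h1.unique h2
  rw [hAu] at h3
  linarith

namespace OrientedLink
variable {ι : Type*} {L : OrientedLink ι} {B : SmoothBall} {f : MvPolynomial (Fin 2) ℂ}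

/-- A function which is a nonzero multiple of the polynomial along some components of the link, and
has no other zeros on the boundary of the ball, gives a defining function of these components. -/
theorem IsCutBy.isDefiningFunction (h : L.IsCutBy f B) (S : Finset ι) {F k : C2 → ℂ}
    (hF : ContDiff ℝ ∞ F) (hk : ContDiff ℝ ∞ k)
    (hzero : ∀ x ∈ S3, F (B.Φ x) = 0 → ∃ j ∈ S, ∃ t, L.γ j t = x)
    (hfk : ∀ j ∈ S, ∀ t, k (L.curve B j t) ≠ 0 ∧
      F =ᶠ[𝓝 (L.curve B j t)] fun z => MvPolynomial.eval z.ofLp f * k z) :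
    (L.sublink S).IsDefiningFunction fun x => F (B.Φ x) := by
  have hfd : ∀ j ∈ S, ∀ t e, fderiv ℝ (fun x => F (B.Φ x)) (L.γ j t) e =
      k (L.curve B j t) * polyDiff f (L.curve B j t) (fderiv ℝ B.Φ (L.γ j t) e) := by
    intro j hj t e
    obtain ⟨-, hev⟩ := hfk j hj t
    have hfz : MvPolynomial.eval (L.curve B j t).ofLp f = 0 := h.curve_mem j t
    have h1 : HasFDerivAt F _ (L.curve B j t) :=
      (((hasFDerivAt_eval f (L.curve B j t)).restrictScalars ℝ).mul
      (hk.differentiable (by simp) (L.curve B j t)).hasFDerivAt).congr_of_eventuallyEq hev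
    have h2 : HasFDerivAt (fun x => F (B.Φ x)) _ (L.γ j t) :=
      HasFDerivAt.comp (L.γ j t) h1 (B.differentiableAt (L.mem_closedBall j t)).hasFDerivAt
    rw [h2.fderiv, ← polyFDeriv_apply]
    simp [hfz]
  refine ⟨?_, fun x hx => ⟨fun h0 => ?_, ?_⟩, fun i t z => ?_, fun i t e₁ e₂ he₁ he₂ h₁ h₂ => ?_⟩
  · obtain ⟨U, hU, hsub, hΦ⟩ := B.smooth
    exact ⟨U, hU, SmoothBall.S3_subset_closedBall.trans hsub, hF.comp_contDiffOn hΦ⟩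
  · obtain ⟨j, hj, t, ht⟩ := hzero x hx h0
    exact ⟨⟨j, hj⟩, t, ht⟩
  · rintro ⟨i, t, rfl⟩
    have h1 := (hfk i i.2 t).2.eq_of_nhds
    have hfz : MvPolynomial.eval (L.curve B i t).ofLp f = 0 := h.curve_mem i t
    rw [hfz, zero_mul] at h1
    exact h1
  · obtain ⟨u, hu, hDu⟩ := h.orientation i t
    obtain ⟨w, hw⟩ := h.exists_polyDiff_ne_zero i t
    obtain ⟨A, hA⟩ := SmoothBall.exists_equiv_of_det_ne_zero
      (B.det_pos _ (L.mem_closedBall i t)).ne'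
    have hk0 := (hfk i i.2 t).1
    set a : ℂ := z / (k (L.curve B i t) * polyDiff f (L.curve B i t) w) with ha
    set e₀ := A.symm (a • w) with he₀
    have hAe₀ : fderiv ℝ B.Φ (L.γ i t) e₀ = a • w := by
      rw [← hA]; exact A.apply_symm_apply _
    refine ⟨e₀ + (-(realInner (L.γ i t) e₀ / realInner (L.γ i t) u)) • u, ?_, ?_⟩
    · show realInner (L.γ i t) _ = 0
      rw [realInner_add, realInner_smul]
      field_simp
      ring
    · show fderiv ℝ (fun x => F (B.Φ x)) (L.γ i t) _ = z
      have hτ := h.polyDiff_velocity i t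
      rw [← polyFDeriv_apply] at hτ hw
      rw [hfd i i.2 t, map_add, map_smul, hDu, hAe₀, ← polyFDeriv_apply, map_add,
        ← Complex.coe_smul, map_smul, map_smul, map_neg, map_smul]
      change _ * (_ + _ • -(Complex.I • polyFDeriv f (L.curve B i t) (L.velocity B i t))) = z
      rw [hτ, ha, ← polyFDeriv_apply]
      simp only [smul_eq_mul, mul_zero, neg_zero, add_zero]
      field_simp
  · have hk0 := (hfk i i.2 t).1
    obtain ⟨u, hu, hDu⟩ := h.orientation i t
    replace h₁ : fderiv ℝ (fun x => F (B.Φ x)) (L.γ i t) e₁ = 1 := h₁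
    replace h₂ : fderiv ℝ (fun x => F (B.Φ x)) (L.γ i t) e₂ = Complex.I := h₂
    rw [hfd i i.2 t] at h₁ h₂
    have hI : polyDiff f (L.curve B i t) (fderiv ℝ B.Φ (L.γ i t) e₂) =
        Complex.I * polyDiff f (L.curve B i t) (fderiv ℝ B.Φ (L.γ i t) e₁) := by
      refine mul_left_cancel₀ hk0 ?_
      rw [h₂]
      linear_combination (-Complex.I) * h₁
    have hne : polyDiff f (L.curve B i t) (fderiv ℝ B.Φ (L.γ i t) e₁) ≠ 0 := fun h0 => by
      rw [h0, mul_zero] at h₁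
      exact zero_ne_one h₁
    have hτ := h.polyDiff_velocity i t
    simp only [polyDiff, Fin.sum_univ_two] at hI hne hτ
    have hpos := det4_pos (L.velocity_ne_zero B i t) hτ hne hI
    rw [velocity, ← hDu, det4_map] at hpos
    have hpos' := (mul_pos_iff_of_pos_left (B.det_pos _ (L.mem_closedBall i t))).1 hpos
    have hself := realInner_self (L.mem_S3 i t)
    -- the outward vector `u` may be replaced by its component along the normal vector `γ` of `S³`
    set u' := u + (-realInner (L.γ i t) u) • L.γ i t with hu'
    have hdec : u = realInner (L.γ i t) u • L.γ i t + u' := by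
      rw [hu', neg_smul]; abel
    have hx0 : L.γ i t ≠ 0 := fun h0 => by
      rw [h0] at hself
      simp [realInner] at hself
    rw [hdec, det4_smul_add, det4_eq_zero (a := u') hx0
      (by rw [hu', realInner_add, realInner_smul, hself]; ring) (L.realInner_deriv i t) he₁ he₂,
      add_zero] at hpos'
    exact (mul_pos_iff_of_pos_left hu).1 hpos'

end OrientedLink

/-! ### The linking number -/

theorem fderiv_comp_realCoords_symm {E : Type*} [NormedAddCommGroup E] [NormedSpace ℝ E]
    {g : C2 → E} (hg : ContDiff ℝ ∞ g) (y v : C2) :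
    fderiv ℝ (fun x => g (realCoords.symm x)) (realCoords y) (realCoords v) = fderiv ℝ g y v := by
  have h1 : HasFDerivAt g (fderiv ℝ g y) (realCoords.symm (realCoords y)) := by
    rw [realCoords.symm_apply_apply]
    exact (hg.differentiable (by simp) y).hasFDerivAt
  have h2 : HasFDerivAt (fun x => g (realCoords.symm x)) _ (realCoords y) :=
    h1.comp (realCoords y) realCoords.symm.hasFDerivAt
  rw [h2.fderiv]
  show fderiv ℝ g y (realCoords.symm (realCoords v)) = _
  rw [realCoords.symm_apply_apply]

theorem fderiv_comp_realCoords_symm_eq_zero {E : Type*} [NormedAddCommGroup E] [NormedSpace ℝ E]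
    {g : C2 → E} {a : E} {y : Fin 4 → ℝ} (hg : ∀ᶠ x in 𝓝 (realCoords.symm y), g x = a) :
    fderiv ℝ (fun x => g (realCoords.symm x)) y = 0 := by
  have h : (fun x => g (realCoords.symm x)) =ᶠ[𝓝 y] fun _ => a :=
    (realCoords.symm.continuous.tendsto y).eventually hg
  rw [h.fderiv_eq]
  exact fderiv_const_apply a

namespace OrientedLink
variable {ι : Type*} {L : OrientedLink ι} {B : SmoothBall} {f : MvPolynomial (Fin 2) ℂ}
  {R : C2 → ℝ}

/-- The variation of the logarithm of `F` along the components in `K₁` vanishes in total: these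
components bound the part `K₁` of the curve, on which `F` has no zeros, and `F` is constant far
away on it. -/
theorem IsCutBy.sum_integral_logDeriv_eq_zero [DecidableEq ι] (h : L.IsCutBy f B)
    (hR : B.IsBoundaryDefining R) {K₀ K₁ : Set C2} (hK₀ : IsCompact K₀) (hK₁ : IsClosed K₁)
    (hd : Disjoint K₀ K₁) (hK : K₀ ∪ K₁ = zeroSet f ∩ {y | 0 ≤ R y}) {T : Finset ι}
    (hT : ∀ j ∈ T, ∀ t, L.curve B j t ∈ K₁) (hT' : ∀ j t, L.curve B j t ∈ K₁ → j ∈ T)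
    {F : C2 → ℂ} (hF : ContDiff ℝ ∞ F) {r : ℝ} (hFr : ∀ y, r < ‖y‖ → F y = 1)
    (hF0 : ∀ y, 0 ≤ R y → F y = 0 → y ∈ K₀) :
    ∑ j : T, ∫ t in (0 : ℝ)..1,
      deriv (fun t => F (L.curve B j t)) t / F (L.curve B j t) = 0 := by
  -- `χ` separates the two pieces, `θ` makes the support compact and is constant where `F` is not
  obtain ⟨χ, hχ, hχ1, hχ0, -⟩ := exists_contDiff_one_nhdsSet_zero_nhdsSet hK₁ hK₀.isClosed hd.symm
  obtain ⟨r₁, hr₁⟩ := B.isCompact_carrier.isBounded.subset_ball 0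
  set r₂ := max r r₁ with hr₂
  obtain ⟨θ, hθ, hθ1, hθ0, -⟩ := exists_contDiff_one_nhdsSet_zero_nhdsSet
    (K₀ := Metric.closedBall (0 : C2) r₂) (K₁ := (Metric.ball (0 : C2) (r₂ + 1))ᶜ)
    Metric.isClosed_closedBall Metric.isOpen_ball.isClosed_compl
    (disjoint_compl_right_iff_subset.2 (Metric.closedBall_subset_ball (by linarith)))
  have hθc : HasCompactSupport θ := by
    refine HasCompactSupport.of_support_subset_isCompact
      (isCompact_closedBall (0 : C2) (r₂ + 1)) fun y hy => ?_
    by_contra hlt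
    refine hy (hθ0.self_of_nhdsSet y fun hb => hlt (Metric.ball_subset_closedBall hb))
  set χ₁ : C2 → ℝ := fun y => χ y * θ y with hχ₁
  have hχ₁c : HasCompactSupport χ₁ := hθc.mul_left
  have hχ₁s : ContDiff ℝ ∞ χ₁ := hχ.mul hθ
  have hK₀χ : ∀ y ∈ K₀, y ∉ tsupport χ₁ := fun y hy => by
    rw [notMem_tsupport_iff_eventuallyEq]
    filter_upwards [eventually_nhdsSet_iff_forall.1 hχ0 y hy] with z hz
    simp [hχ₁, hz]
  have hsupp : ∀ y, y ∈ tsupport (fun x => χ₁ (realCoords.symm x)) →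
      realCoords.symm y ∈ tsupport χ₁ := fun y hy => by
    have h1 := tsupport_comp_subset_preimage χ₁ realCoords.symm.continuous
    exact h1 hy
  have hKmem : ∀ y, MvPolynomial.eval y.ofLp f = 0 → 0 ≤ R y → y ∈ K₀ ∨ y ∈ K₁ := fun y h1 h2 =>
    hK.superset ⟨h1, h2⟩
  -- close to the curve one of `χ₁` and `F` is locally constant
  have hlocal : ∃ ε > 0, ∀ y, 0 ≤ R y → ‖MvPolynomial.eval y.ofLp f‖ ≤ ε →
      (∃ a, ∀ᶠ x in 𝓝 y, χ₁ x = a) ∨ ∃ a, ∀ᶠ x in 𝓝 y, F x = a := by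
    set W : Set C2 := {y | (∃ a, ∀ᶠ x in 𝓝 y, χ₁ x = a) ∨ ∃ a, ∀ᶠ x in 𝓝 y, F x = a} with hW
    have hWo : IsOpen W := by
      have ho : ∀ {E : Type} (g : C2 → E), IsOpen {y | ∃ a, ∀ᶠ x in 𝓝 y, g x = a} := fun g => by
        have : {y | ∃ a, ∀ᶠ x in 𝓝 y, g x = a} = ⋃ a, {y | ∀ᶠ x in 𝓝 y, g x = a} := by
          ext; simp
        rw [this]
        exact isOpen_iUnion fun a => isOpen_setOfPred_eventually_nhds
      exact (ho χ₁).union (ho F)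
    have hfar : ∀ y, r < ‖y‖ → y ∈ W := fun y hy => Or.inr ⟨1, by
      filter_upwards [(isOpen_lt continuous_const continuous_norm).mem_nhds hy] with z hz
      exact hFr z hz⟩
    have hzero : ∀ y, MvPolynomial.eval y.ofLp f = 0 → 0 ≤ R y → y ∈ W := by
      intro y h1 h2
      by_cases hy : r < ‖y‖
      · exact hfar y hy
      · have hyb : y ∈ Metric.closedBall (0 : C2) r₂ := by
          rw [mem_closedBall_zero_iff]
          exact (not_lt.1 hy).trans (le_max_left _ _)
        have hθy := eventually_nhdsSet_iff_forall.1 hθ1 y hyb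
        rcases hKmem y h1 h2 with h | h
        · refine Or.inl ⟨0, ?_⟩
          filter_upwards [eventually_nhdsSet_iff_forall.1 hχ0 y h] with z hz
          simp [hχ₁, hz]
        · refine Or.inl ⟨1, ?_⟩
          filter_upwards [eventually_nhdsSet_iff_forall.1 hχ1 y h, hθy] with z hz hz'
          simp [hχ₁, hz, hz']
    set Z := Metric.closedBall (0 : C2) r ∩ ({y | 0 ≤ R y} ∩ Wᶜ) with hZ
    have hZc : IsCompact Z := (isCompact_closedBall (0 : C2) r).inter_right
      ((isClosed_le continuous_const hR.smooth.continuous).inter hWo.isClosed_compl)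
    obtain ⟨ε, hε, hεZ⟩ : ∃ ε > 0, ∀ y ∈ Z, ε < ‖MvPolynomial.eval y.ofLp f‖ := by
      rcases Z.eq_empty_or_nonempty with he | hne
      · exact ⟨1, one_pos, by simp [he]⟩
      · obtain ⟨y₀, hy₀, hmin⟩ := hZc.exists_isMinOn hne (continuous_eval f).norm.continuousOn
        have hpos : 0 < ‖MvPolynomial.eval y₀.ofLp f‖ := norm_pos_iff.2 fun h0 =>
          hy₀.2.2 (hzero y₀ h0 hy₀.2.1)
        exact ⟨_, half_pos hpos, fun y hy => (half_lt_self hpos).trans_le (hmin hy)⟩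
    refine ⟨ε, hε, fun y h1 h2 => ?_⟩
    by_contra hyW
    refine absurd h2 (hεZ y ⟨?_, h1, hyW⟩).not_ge
    rw [mem_closedBall_zero_iff]
    by_contra hlt
    exact hyW (hfar y (not_le.1 hlt))
  have hsymm : ContDiff ℝ ∞ (realCoords.symm : (Fin 4 → ℝ) → C2) := realCoords.symm.contDiff
  have hcd : ∀ j t, HasDerivAt (fun t => realCoords (L.curve B j t))
      (realCoords (L.velocity B j t)) t := fun j t =>
    realCoords.hasFDerivAt.comp_hasDerivAt t (L.hasDerivAt_curve B j t)
  have hmain := _root_.sum_integral_logDeriv_eq_zero (κ := T)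
    (R := fun x => R (realCoords.symm x)) (χ := fun x => χ₁ (realCoords.symm x))
    (f := fun x => MvPolynomial.eval (realCoords.symm x).ofLp f)
    (F := fun x => F (realCoords.symm x)) (hR.smooth.comp hsymm) ((contDiff_eval f).comp hsymm)
    (hF.comp hsymm) (hχ₁s.comp hsymm) (hχ₁c.comp_homeomorph realCoords.symm.toHomeomorph)
    (c := fun j t => realCoords (L.curve B j t))
    (fun j => realCoords.contDiff.comp (L.contDiff_curve B j))
    (fun j t => by simp only [L.periodic_curve B j t])
    (fun j t => by
      rw [(hcd j t).deriv]
      exact realCoords.map_ne_zero_iff.2 (L.velocity_ne_zero B j t))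
    (fun i j s hs t ht hst => by
      have h1 : L.γ i s = L.γ j t :=
        B.injOn (L.mem_closedBall i s) (L.mem_closedBall j t) (realCoords.injective hst)
      obtain ⟨h2, h3⟩ := L.embedded i j s hs t ht h1
      exact ⟨Subtype.ext h2, h3⟩)
    (fun j t => by
      simp only [realCoords.symm_apply_apply]
      exact hR.curve_eq_zero L j t)
    (fun j t => by
      simp only [realCoords.symm_apply_apply]
      exact h.curve_mem j t)
    (fun j t => by
      obtain ⟨w, hw⟩ := h.exists_polyDiff_ne_zero (j : ι) t
      rw [← polyFDeriv_apply] at hw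
      set y := L.curve B j t with hy
      set τ := L.velocity B j t with hτ
      set a : C2 := (polyFDeriv f y w)⁻¹ • w with ha
      have hfa : polyFDeriv f y a = 1 := by
        rw [ha, map_smul, smul_eq_mul, inv_mul_cancel₀ hw]
      have hfτ : polyFDeriv f y τ = 0 := by
        rw [polyFDeriv_apply]; exact h.polyDiff_velocity (j : ι) t
      refine ⟨realCoords (-(Complex.I • τ)), realCoords a, realCoords (Complex.I • a), ?_, ?_, ?_,
        ?_, ?_⟩
      · rw [fderiv_comp_realCoords_symm hR.smooth]
        exact hR.fderiv_neg_I_smul_velocity h (j : ι) t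
      · rw [fderiv_comp_realCoords_symm (contDiff_eval f), fderiv_eval_apply, ← polyFDeriv_apply,
          map_neg, map_smul, hfτ, smul_zero, neg_zero]
      · rw [fderiv_comp_realCoords_symm (contDiff_eval f), fderiv_eval_apply, ← polyFDeriv_apply,
          hfa]
      · rw [fderiv_comp_realCoords_symm (contDiff_eval f), fderiv_eval_apply, ← polyFDeriv_apply,
          map_smul, hfa, smul_eq_mul, mul_one]
      · rw [(hcd j t).deriv, ← det4_eq]
        rw [polyFDeriv_apply] at hfa hfτ
        simp only [polyDiff, Fin.sum_univ_two] at hfa hfτ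
        refine det4_pos (L.velocity_ne_zero B j t) hfτ (by rw [hfa]; exact one_ne_zero) ?_
        simp only [PiLp.smul_apply, smul_eq_mul]
        ring)
    (fun j t => by
      have hmem := hT j j.2 t
      have h1 := hχ1.self_of_nhdsSet _ hmem
      have h2 : L.curve B j t ∈ Metric.closedBall (0 : C2) r₂ := by
        have h3 := hr₁ ((hR.le_zero_iff _).1 (hR.curve_eq_zero L j t).le)
        rw [mem_ball_zero_iff] at h3
        rw [mem_closedBall_zero_iff]
        exact h3.le.trans (le_max_right _ _)
      simp only [hχ₁, realCoords.symm_apply_apply, h1, hθ1.self_of_nhdsSet _ h2, mul_one])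
    (fun y hy h1 h2 => by
      obtain ⟨j, t, hjt⟩ := h.exists_curve_eq h2 ((hR.zero_iff _).1 h1)
      have hyK : realCoords.symm y ∈ K₁ := (hKmem _ h2 h1.ge).resolve_left fun h0 =>
        hK₀χ _ h0 (hsupp y hy)
      refine ⟨⟨j, hT' j t (by rw [hjt]; exact hyK)⟩, t, ?_⟩
      show realCoords (L.curve B j t) = y
      rw [hjt, realCoords.apply_symm_apply])
    (fun y hy h1 h0 => hK₀χ _ (hF0 _ h1 h0) (hsupp y hy))
    (by
      obtain ⟨ε, hε, hloc⟩ := hlocal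
      refine ⟨ε, hε, fun y h1 h2 => ?_⟩
      rcases hloc _ h1 h2 with ⟨a, ha⟩ | ⟨a, ha⟩
      · exact Or.inl (fderiv_comp_realCoords_symm_eq_zero ha)
      · exact Or.inr (fderiv_comp_realCoords_symm_eq_zero ha))
  simpa only [realCoords.symm_apply_apply] using hmain

end OrientedLink

theorem lemma3p8 {r : ℕ} (L : OrientedLink (Fin r)) (hL : L.IsCBoundary)
    (hL' : ¬ L.IsStrongCBoundary) :
    ∃ S : Finset (Fin r), S.Nonempty ∧ S ≠ Finset.univ ∧
      (L.sublink S).HasLinkingNumber (L.sublink Sᶜ) 0 := by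
  classical
  obtain ⟨f, B, h⟩ := hL
  obtain ⟨R, hR⟩ := B.exists_isBoundaryDefining
  obtain ⟨K₀, K₁, hK₀, hK₁, hd, hK, ⟨j₀, t₀, h₀⟩, j₁, t₁, h₁⟩ := h.exists_decomposition hR hL'
  obtain ⟨F, k, hF, hk, ⟨r₀, hr₀⟩, hF0, hFk⟩ :=
    hR.exists_contDiff_vanishing_on (contDiff_eval f) hK₀ hK₁ hd hK
  have hmem : ∀ j t, L.curve B j t ∈ K₀ ∪ K₁ := fun j t => by
    rw [hK]
    exact ⟨h.curve_mem j t, (hR.curve_eq_zero L j t).ge⟩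
  -- a component is connected and hence contained in one of the two pieces
  have hcomp : ∀ j, (∀ t, L.curve B j t ∈ K₀) ∨ ∀ t, L.curve B j t ∈ K₁ := fun j => by
    have h1 := isPreconnected_iff_subset_of_disjoint_closed.1
      (isPreconnected_range (L.contDiff_curve B j).continuous) K₀ K₁ hK₀.isClosed hK₁
      (range_subset_iff.2 (hmem j)) (by rw [hd.inter_eq, inter_empty])
    simpa only [range_subset_iff] using h1
  have hnot : ∀ y, y ∈ K₀ → y ∉ K₁ := fun y hy => hd.notMem_of_mem_left hy
  set S : Finset (Fin r) := Finset.univ.filter fun j => ∀ t, L.curve B j t ∈ K₀ with hS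
  have hSmem : ∀ j, j ∈ S ↔ ∀ t, L.curve B j t ∈ K₀ := fun j => by simp [hS]
  have hSc : ∀ j ∈ Sᶜ, ∀ t, L.curve B j t ∈ K₁ := fun j hj =>
    (hcomp j).resolve_left fun h0 => Finset.mem_compl.1 hj ((hSmem j).2 h0)
  have hSc' : ∀ j t, L.curve B j t ∈ K₁ → j ∈ Sᶜ := fun j t hjt =>
    Finset.mem_compl.2 fun hj => hnot _ ((hSmem j).1 hj t) hjt
  refine ⟨S, ⟨j₀, ?_⟩, fun hu => ?_, fun x => F (B.Φ x), ?_, ?_⟩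
  · by_contra hj
    exact hnot _ h₀ (hSc j₀ (Finset.mem_compl.2 hj) t₀)
  · have := hSc' j₁ t₁ h₁
    rw [hu] at this
    simp at this
  · refine h.isDefiningFunction S hF hk (fun x hx h0 => ?_) fun j hj t => hFk _ ((hSmem j).1 hj t)
    have hx0 : R (B.Φ x) = 0 := (hR.zero_iff _).2 (mem_image_of_mem _ hx)
    have hxK := hF0 _ hx0.ge h0
    obtain ⟨j, t, hjt⟩ := h.exists_curve_eq (hK.subset (Or.inl hxK)).1 (mem_image_of_mem _ hx)
    refine ⟨j, ?_, t, B.injOn (L.mem_closedBall j t) (SmoothBall.S3_subset_closedBall hx) hjt⟩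
    by_contra hj
    exact hnot _ hxK (hjt ▸ hSc j (Finset.mem_compl.2 hj) t)
  · have hne : ∀ j : (Sᶜ : Finset (Fin r)), ∀ t, F (L.curve B j t) ≠ 0 := fun j t h0 =>
      hnot _ (hF0 _ (hR.curve_eq_zero L j t).ge h0) (hSc j j.2 t)
    choose m hm hmint using fun j : (Sᶜ : Finset (Fin r)) =>
      exists_hasWindingNumber (hF.comp (L.contDiff_curve B j)) (hne j)
        (congrArg F ((congrArg _ (zero_add 1).symm).trans (L.periodic_curve B j 0)))
    refine ⟨m, hm, ?_⟩
    have hsum := h.sum_integral_logDeriv_eq_zero hR hK₀ hK₁ hd hK hSc hSc' hF hr₀ hF0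
    have hsum' : ∑ j, 2 * Real.pi * Complex.I * (m j : ℂ) = 0 := by
      rw [← hsum]
      exact Finset.sum_congr rfl fun j _ => (hmint j).symm
    rw [← Finset.mul_sum] at hsum'
    have h2 := (mul_eq_zero.1 hsum').resolve_left Complex.two_pi_I_ne_zero
    exact_mod_cast h2
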